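/- Let $(E,d)$ be a Polish metric space, $x_0\in E$, $\mu$ a Borel probability measure on $E$ and $S\subset E$ a set with $\mu(S)=1$. Let $X_1,\dots,X_n$ ($n\ge 1$) be i.i.d. random variables with law $\mu$, defined on a probability space $(\Omega,\mathcal A,\mathbb P)$, let $L_n=\frac1n\sum_{i=1}^n\delta_{X_i}$ be their empirical measure, and let $$W_p^p(\mu,\nu)=\inf_{\pi}\int d(x,y)^p\,\pi(dx,dy),$$ the infimum being over the couplings $\pi$ of $\mu$ and $\nu$. Let $B(x_0,t)$ be the closed ball, let $N(A,\delta)$ be the minimal number of closed balls of radius $\delta$ with centres in $A$ needed to cover $A$, and put $$H(t)=\mu(B(x_0,t)^c),\quad \|X\|_{q,w}^q=\sup_{t\ge0}t^qH(t),\quad I_{2p,p}=\int_0^\infty\sqrt{H(t)}\,t^{p-1}\,dt,\quad \|d(x_0,X)\|_p^p=\int d(x_0,y)^p\,\mu(dy).$$ We say that $\mu$ has a weak moment of order $q$ if $\|X\|_{q,w}<\infty$. **Theorem (critical case $\alpha=2p$).** Let $p\ge1$ and $\beta>0$, and assume that, with $\alpha=2p$, $$N(S\cap B(x_0,r),\delta)\le\beta\left(\frac{2r}{\delta}\right)^{\alpha}\qquad\text{for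 all } r>0 \text{ and } \delta\in(0,2r].$$ Below, $C_{a_1,\dots,a_k}$ denotes positive constants that depend only on $a_1,\dots,a_k$ (in particular not on $E$, $d$, $x_0$, $S$, $\mu$, $n$, $x$); different occurrences may have different values. For $x>0$ set $$A(n,x)=e^2\exp\left(-n\,C_{p,\alpha,\beta}\left[\frac{x}{I_{2p,p}\log\left(e+C_{p,\alpha,\beta}\frac{I_{2p,p}}{x}\right)}\right]^2\right)\mathbf 1_{x\le C_p\|d(x_0,X)\|_p^p}.$$ 1. If $\mu$ has a weak moment of order $rp$ with $r>2$, then $I_{2p,p}<\infty$, $\|d(x_0,X)\|_p<\infty$ and, for any $q>r$ and any $x>0$, $$\mathbb P\left(W_p^p(\mu,L_n)>x\right)\le A(n,x)+C_{p,q,r}\left\{\frac{I_{2p,p}^q}{x^qn^{q/2}}+\frac{\|X\|_{rp,w}^{rp}}{x^rn^{r-1}}\right\}.$$ 2. If $I_{2p,p}<\infty$, then $\|d(x_0,X)\|_p<\infty$ and, for any $x>0$, $$\mathbb P\left(W_p^p(\mu,L_n)>x\right)\le A(n,x)+C_{p,\alpha,\beta}\frac{I_{2p,p}^2}{x^2n}.$$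 3. If $\mu$ has a weak moment of order $rp$ with $r\in(1,2)$, then, for any $x>0$, $$\mathbb P\left(W_p^p(\mu,L_n)>x\right)\le C_{p,\alpha,\beta,r}\frac{\|X\|_{rp,w}^{rp}}{x^rn^{r-1}}.$$ (If $\|d(x_0,X)\|_p=0$, the term $A(n,x)$ is read as $0$.) -/

import Mathlib

open MeasureTheory ProbabilityTheory
open scoped ENNReal NNReal

universe u v

noncomputable section

/-- The set of couplings of `μ` and `ν`: measures on the product with marginals `μ` and `ν`. -/
def couplings {E : Type u} [MeasurableSpace E] (μ ν : Measure E) : Set (Measure (E × E)) :=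
  {π | π.map Prod.fst = μ ∧ π.map Prod.snd = ν}

/-- The `p`-th power `W_p^p(μ, ν)` of the Wasserstein distance of order `p`, the infimum of
`∫ d(x, y)^p dπ` over all couplings `π`, as an extended nonnegative number. -/
def wassersteinPow {E : Type u} [MetricSpace E] [MeasurableSpace E]
    (p : ℝ) (μ ν : Measure E) : ℝ≥0∞ :=
  ⨅ π ∈ couplings μ ν, ∫⁻ z, edist z.1 z.2 ^ p ∂π

/-- The empirical measure `(1/n) ∑ δ_{x_i}` of a sample of size `n`. -/
def empiricalMeasure {E : Type u} [MeasurableSpace E] {n : ℕ} (x : Fin n → E) : Measure E :=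
  (n : ℝ≥0∞)⁻¹ • ∑ i, Measure.dirac (x i)

/-- `X` is a sample of `n` independent random variables with common law `μ`. -/
structure IsIIDSample {Ω : Type v} [MeasurableSpace Ω] {E : Type u} [MeasurableSpace E] {n : ℕ}
    (X : Fin n → Ω → E) (P : Measure Ω) (μ : Measure E) : Prop where
  measurable : ∀ i, Measurable (X i)
  map_eq : ∀ i, P.map (X i) = μ
  indep : iIndepFun X P

/-- Uniform covering condition: `N(S ∩ B(x₀, r), δ) ≤ β (2r/δ)^α` for all `r > 0`, `0 < δ ≤ 2r`.
Here `Metric.coveringNumber δ A` is the minimal number of closed balls of radius `δ`, with centres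
in `A`, that cover `A`. -/
def HasCoveringDim {E : Type u} [MetricSpace E] (x₀ : E) (S : Set E) (α β : ℝ) : Prop :=
  ∀ r : ℝ, 0 < r → ∀ δ : ℝ, 0 < δ → δ ≤ 2 * r →
    (Metric.coveringNumber δ.toNNReal (S ∩ Metric.closedBall x₀ r) : ℝ≥0∞)
      ≤ ENNReal.ofReal (β * (2 * r / δ) ^ α)

/-- Tail function `H(t) = μ(B(x₀, t)ᶜ)`, with `B` the closed ball. -/
def tailFun {E : Type u} [MetricSpace E] [MeasurableSpace E] (x₀ : E) (μ : Measure E) (t : ℝ) : ℝ :=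
  μ.real (Metric.closedBall x₀ t)ᶜ

/-- `‖X‖_{q,w}^q = sup_{t ≥ 0} t^q H(t)`; the weak moment of order `q` exists when it is finite. -/
def weakMomentPow {E : Type u} [MetricSpace E] [MeasurableSpace E]
    (x₀ : E) (μ : Measure E) (q : ℝ) : ℝ≥0∞ :=
  ⨆ t : ℝ, ⨆ _ : 0 ≤ t, ENNReal.ofReal (t ^ q * tailFun x₀ μ t)

/-- `I_{2p,p} = ∫_0^∞ √(H(t)) t^{p-1} dt`, possibly infinite. -/
def sqrtTailIntegral {E : Type u} [MetricSpace E] [MeasurableSpace E]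
    (x₀ : E) (μ : Measure E) (p : ℝ) : ℝ≥0∞ :=
  ∫⁻ t in Set.Ioi (0 : ℝ), ENNReal.ofReal (√(tailFun x₀ μ t) * t ^ (p - 1))

/-- `‖d(x₀, X)‖_p^p = ∫ d(x₀, y)^p dμ(y)`, possibly infinite. -/
def distMomentPow {E : Type u} [MetricSpace E] [MeasurableSpace E]
    (x₀ : E) (μ : Measure E) (p : ℝ) : ℝ≥0∞ :=
  ∫⁻ y, edist x₀ y ^ p ∂μ

open Classical in
/-- The term `e² exp(-n c [x / (I log(e + c' I / x))]²) 1_{x ≤ a m}`. -/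
def criticalExpTerm (n : ℕ) (c c' a I m x : ℝ) : ℝ :=
  Real.exp 2 * Real.exp (-((n : ℝ) * c * (x / (I * Real.log (Real.exp 1 + c' * I / x))) ^ 2)) *
    (if x ≤ a * m then 1 else 0)

end

/-! ### Partial couplings inside the cells of a finite partition -/

section Transport

variable {E : Type u} [MeasurableSpace E]

/-! Transport. Cut the ball of radius `R` about `x₀` into dyadic rings of outer radius `R / 2 ^ k`,
and each ring into nested cells of diameter of order `R / 2 ^ k / 2 ^ l`, at most `(β + 1) * 2 ^ (2
* p * l)` of them at level `l`. Match `μ` and the empirical measure greedily, from the finest level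
to the coarsest: mass left unmatched at level `l + 1` is the cell discrepancy there, and it pays the
diameter of level `l`. What survives level `0` is coupled arbitrarily through `x₀`. Hence `W_p^p` is
at most `16 ^ p` times the sum of a finest-level term, the `p`-moment of `μ` outside the ball, and a
weighted sum of cell discrepancies (`RingPartition.wassersteinPow_le`).

Probability. The discrepancy is a Lipschitz function of a sum of i.i.d. vectors of cell indicators.
One observation moves it by at most `2 * R ^ p / n`, and by much less in the inner rings, so a
Bennett-type bound (`measure_lipschitz_sum_ge_le`) controls its deviation above the mean by a power
`κ` of variance over squared deviation. Taking `R ^ p` proportional to `n * x / κ` makes that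
deviation a quarter of the budget; observations outside the ball cost `n * H(R)`. This is
`measure_wassersteinPow_gt_le`, which requires the other three terms to be at most a quarter each.

Mean. By Cauchy-Schwarz over the cells, level `l` contributes to the mean about `2 ^ (-p l)` times
`√(2 ^ (2 p l) / n)` times a dyadic sum comparable to `I_{2p,p}`. In the critical case the powers of
`2 ^ l` cancel, so all levels contribute equally (`discrepancyBound_le`). About `log (I / x)` levels
make the finest-level term small, whence the logarithm. The mean fits its quarter unless the
exponent in `A(n,x)` is at most `1`; then `A(n,x) ≥ 1` thanks to the factor `e²`, and nothing is to
be proved. If `x` is large compared with the `p`-moment, one level suffices and `A(n,x)` is not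
needed, which explains the indicator.

The first statement takes `κ = q / 2`, with `H(R)` bounded by the weak moment; the second takes `κ =
1`, with `H(R)` bounded through `I_{2p,p}`. For `r < 2` the integral `I_{2p,p}` may diverge: there
the two bounds `√(mass / n)` and `2 * mass` on the mean discrepancy are interpolated so that the
sums over levels and rings are both geometric, and all terms are controlled by the single quantity
`n * w / (n x) ^ r`, up to constants. -/

theorem measure_eq_sum_inter_fiber {ι : Type*} (μ : Measure E) (f : E → ι) (s : Finset ι)
    (hf : ∀ x, f x ∈ s) (hm : ∀ i ∈ s, MeasurableSet (f ⁻¹' {i})) (A : Set E) :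
    ∑ i ∈ s, μ (A ∩ f ⁻¹' {i}) = μ A := by
  classical
  have h1 : ∀ i ∈ s, μ (A ∩ f ⁻¹' {i}) = μ.restrict A (f ⁻¹' {i}) := fun i hi => by
    rw [Measure.restrict_apply (hm i hi), Set.inter_comm]
  rw [Finset.sum_congr rfl h1, ← measure_biUnion_finset _ hm]
  · have : (⋃ b ∈ s, f ⁻¹' {b}) = Set.univ := by
      ext x; simpa using hf x
    rw [this, Measure.restrict_apply_univ]
  · intro i _ j _ hij
    exact Disjoint.preimage f (by simpa using hij)

/-- Greedy coupling inside the cells of a finite partition: the matched part `π` couples points of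
the same cell, and the unmatched parts `μ'`, `ν'` carry the positive and negative parts of the
discrepancy of each cell. -/
theorem exists_partial_coupling {ι : Type*} (μ ν : Measure E) [IsFiniteMeasure μ]
    [IsFiniteMeasure ν] (f : E → ι) (s : Finset ι) (hf : ∀ x, f x ∈ s)
    (hm : ∀ i ∈ s, MeasurableSet (f ⁻¹' {i})) :
    ∃ (π : Measure (E × E)) (μ' ν' : Measure E), π.map Prod.fst + μ' = μ ∧
      π.map Prod.snd + ν' = ν ∧
      (∀ i ∈ s, μ' (f ⁻¹' {i}) = μ (f ⁻¹' {i}) - ν (f ⁻¹' {i})) ∧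
      (∀ i ∈ s, ν' (f ⁻¹' {i}) = ν (f ⁻¹' {i}) - μ (f ⁻¹' {i})) ∧
      ∀ᵐ z ∂π, f z.1 = f z.2 := by
  classical
  set a : ι → ℝ≥0∞ := fun i => μ (f ⁻¹' {i}) with ha
  set b : ι → ℝ≥0∞ := fun i => ν (f ⁻¹' {i}) with hb
  -- With this scaling the product of the two restrictions has mass `min (a i) (b i)` on the cell.
  -- If both masses vanish then `c i = ∞`, which is harmless because `∞ * 0 = 0`.
  set c : ι → ℝ≥0∞ := fun i => (max (a i) (b i))⁻¹ with hc
  have hafin : ∀ i, a i ≠ ∞ := fun i => measure_ne_top _ _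
  have hbfin : ∀ i, b i ≠ ∞ := fun i => measure_ne_top _ _
  have hca : ∀ i, c i * a i ≤ 1 := fun i =>
    (mul_le_mul_right (le_max_left _ (b i)) _).trans (ENNReal.inv_mul_le_one _)
  have hcb : ∀ i, c i * b i ≤ 1 := fun i =>
    (mul_le_mul_right (le_max_right (a i) _) _).trans (ENNReal.inv_mul_le_one _)
  have key : ∀ x y : ℝ≥0∞, x ≠ ∞ → y ≠ ∞ → (1 - (max x y)⁻¹ * y) * x = x - y := by
    intro x y hx hy
    rcases le_total x y with h | h
    · rw [max_eq_right h, tsub_eq_zero_of_le h]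
      rcases eq_or_ne y 0 with h0 | h0
      · simp [le_antisymm (h0 ▸ h) bot_le]
      · rw [ENNReal.inv_mul_cancel h0 hy]; simp
    · rw [max_eq_left h]
      rcases eq_or_ne x 0 with h0 | h0
      · simp [h0]
      · rw [ENNReal.sub_mul (fun _ _ => hx), mul_right_comm, ENNReal.inv_mul_cancel h0 hx]; simp
  have hinter : ∀ i ∈ s, ∀ j ∈ s, j ≠ i → f ⁻¹' {i} ∩ f ⁻¹' {j} = ∅ := by
    intro i _ j _ hij
    ext x; simp only [Set.mem_inter_iff, Set.mem_preimage, Set.mem_singleton_iff,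
      Set.mem_empty_iff_false, iff_false, not_and]
    intro h1 h2; exact hij (h2 ▸ h1)
  refine ⟨∑ i ∈ s, c i • (μ.restrict (f ⁻¹' {i})).prod (ν.restrict (f ⁻¹' {i})),
    ∑ i ∈ s, (1 - c i * b i) • μ.restrict (f ⁻¹' {i}),
    ∑ i ∈ s, (1 - c i * a i) • ν.restrict (f ⁻¹' {i}), ?_, ?_, ?_, ?_, ?_⟩
  · ext A hA
    rw [Measure.add_apply, Measure.map_apply measurable_fst hA, Measure.finsetSum_apply,
      Measure.finsetSum_apply, ← Finset.sum_add_distrib,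
      ← measure_eq_sum_inter_fiber μ f s hf hm A]
    refine Finset.sum_congr rfl fun i hi => ?_
    have : (μ.restrict (f ⁻¹' {i})).prod (ν.restrict (f ⁻¹' {i})) (Prod.fst ⁻¹' A)
        = b i * μ (A ∩ f ⁻¹' {i}) := by
      rw [← Measure.map_apply measurable_fst hA, Measure.map_fst_prod]
      simp [Measure.restrict_apply hA, hb]
    rw [Measure.smul_apply, Measure.smul_apply, this, Measure.restrict_apply hA, smul_eq_mul,
      smul_eq_mul, ← mul_assoc, ← add_mul, add_tsub_cancel_of_le (hcb i), one_mul]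
  · ext A hA
    rw [Measure.add_apply, Measure.map_apply measurable_snd hA, Measure.finsetSum_apply,
      Measure.finsetSum_apply, ← Finset.sum_add_distrib,
      ← measure_eq_sum_inter_fiber ν f s hf hm A]
    refine Finset.sum_congr rfl fun i hi => ?_
    have : (μ.restrict (f ⁻¹' {i})).prod (ν.restrict (f ⁻¹' {i})) (Prod.snd ⁻¹' A)
        = a i * ν (A ∩ f ⁻¹' {i}) := by
      rw [← Measure.map_apply measurable_snd hA, Measure.map_snd_prod]
      simp [Measure.restrict_apply hA, ha]
    rw [Measure.smul_apply, Measure.smul_apply, this, Measure.restrict_apply hA, smul_eq_mul,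
      smul_eq_mul, ← mul_assoc, ← add_mul, add_tsub_cancel_of_le (hca i), one_mul]
  · intro i hi
    rw [Measure.finsetSum_apply, Finset.sum_eq_single i]
    · rw [Measure.smul_apply, Measure.restrict_apply (hm i hi), Set.inter_self, smul_eq_mul]
      exact key _ _ (hafin i) (hbfin i)
    · intro j hj hji
      rw [Measure.smul_apply, Measure.restrict_apply (hm i hi), hinter i hi j hj hji]; simp
    · intro h; exact absurd hi h
  · intro i hi
    rw [Measure.finsetSum_apply, Finset.sum_eq_single i]
    · rw [Measure.smul_apply, Measure.restrict_apply (hm i hi), Set.inter_self, smul_eq_mul]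
      have := key _ _ (hbfin i) (hafin i)
      rwa [max_comm] at this
    · intro j hj hji
      rw [Measure.smul_apply, Measure.restrict_apply (hm i hi), hinter i hi j hj hji]; simp
    · intro h; exact absurd hi h
  · rw [ae_iff, Measure.finsetSum_apply]
    refine Finset.sum_eq_zero fun i hi => ?_
    rw [Measure.smul_apply, Measure.prod_restrict]
    have h := ae_restrict_mem (μ := μ.prod ν) ((hm i hi).prod (hm i hi))
    have h2 : ∀ᵐ z ∂(μ.prod ν).restrict ((f ⁻¹' {i}) ×ˢ (f ⁻¹' {i})), f z.1 = f z.2 := by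
      filter_upwards [h] with z hz
      have h1 := hz.1; have h2 := hz.2
      simp only [Set.mem_preimage, Set.mem_singleton_iff] at h1 h2
      rw [h1, h2]
    rw [ae_iff] at h2
    rw [h2]; simp

/-- A plan that never leaves a cell has marginals of equal mass on that cell. Removing the matched
part therefore leaves the difference of the two measures on every coarser cell unchanged. -/
theorem map_fst_fiber_eq_map_snd_fiber {ι : Type*} {π : Measure (E × E)} {f : E → ι}
    (h : ∀ᵐ z ∂π, f z.1 = f z.2) {A : Set ι} (hA : MeasurableSet (f ⁻¹' A)) :
    π.map Prod.fst (f ⁻¹' A) = π.map Prod.snd (f ⁻¹' A) := by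
  rw [Measure.map_apply measurable_fst hA, Measure.map_apply measurable_snd hA]
  refine measure_congr ?_
  filter_upwards [h] with z hz
  have : (f z.1 ∈ A) = (f z.2 ∈ A) := by rw [hz]
  exact this

theorem lintegral_fst_le {π : Measure (E × E)} {μ μ' : Measure E}
    (h : π.map Prod.fst + μ' = μ) {g : E → ℝ≥0∞} (hg : Measurable g) :
    ∫⁻ z, g z.1 ∂π ≤ ∫⁻ x, g x ∂μ := by
  rw [← h, lintegral_add_measure, lintegral_map hg measurable_fst]
  exact le_self_add

theorem ae_fst_of_marginal {π : Measure (E × E)} {μ μ' : Measure E}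
    (h : π.map Prod.fst + μ' = μ) {G : Set E} (hG : ∀ᵐ x ∂μ, x ∈ G) :
    ∀ᵐ z ∂π, z.1 ∈ G := by
  rw [← h, ae_add_measure_iff] at hG
  exact ae_of_ae_map measurable_fst.aemeasurable hG.1

theorem ae_snd_of_marginal {π : Measure (E × E)} {ν ν' : Measure E}
    (h : π.map Prod.snd + ν' = ν) {G : Set E} (hG : ∀ᵐ x ∂ν, x ∈ G) :
    ∀ᵐ z ∂π, z.2 ∈ G := by
  rw [← h, ae_add_measure_iff] at hG
  exact ae_of_ae_map measurable_snd.aemeasurable hG.1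

theorem lintegral_comp_label_eq_sum {ι : Type*} (μ : Measure E) (f : E → ι) (s : Finset ι)
    (hf : ∀ x, f x ∈ s) (hm : ∀ i ∈ s, MeasurableSet (f ⁻¹' {i})) (w : ι → ℝ≥0∞) :
    ∫⁻ x, w (f x) ∂μ = ∑ i ∈ s, w i * μ (f ⁻¹' {i}) := by
  classical
  have h1 : ∀ x, w (f x) = ∑ i ∈ s, (f ⁻¹' {i}).indicator (fun _ => w i) x := by
    intro x
    rw [Finset.sum_eq_single (f x)]
    · simp
    · intro j _ hj; simp [Ne.symm hj]
    · intro h; exact absurd (hf x) h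
  simp_rw [h1]
  rw [lintegral_finsetSum' _ (fun i hi => (measurable_const.indicator (hm i hi)).aemeasurable)]
  refine Finset.sum_congr rfl fun i hi => ?_
  rw [lintegral_indicator (hm i hi)]; simp

theorem measurable_of_label {ι γ : Type*} [MeasurableSpace γ] (f : E → ι) (s : Finset ι)
    (hf : ∀ x, f x ∈ s) (hm : ∀ i ∈ s, MeasurableSet (f ⁻¹' {i})) (A : Set ι) :
    MeasurableSet (f ⁻¹' A) := by
  classical
  have : f ⁻¹' A = ⋃ i ∈ s.filter (· ∈ A), f ⁻¹' {i} := by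
    ext x; simp only [Set.mem_preimage, Finset.mem_filter, Set.mem_iUnion,
      Set.mem_singleton_iff, exists_prop]
    exact ⟨fun h => ⟨f x, ⟨hf x, h⟩, rfl⟩, fun ⟨i, hi, h⟩ => h ▸ hi.2⟩
  rw [this]
  exact Finset.measurableSet_biUnion _ fun i hi => hm i (Finset.mem_filter.1 hi).1

end Transport

/-! ### Multilevel coupling and the bound on the transport cost -/

section Chain

variable {E : Type u} [MeasurableSpace E]

/-- Matching proceeds from level `L` down to level `0`. The whole of `μ` may pay the finest cost,
while the part matched at level `l` is at most the residual of level `l + 1`, whose cell masses are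
truncated differences. The families `f`, `s`, `u` are quantified after `L` so that the induction can
shift all levels by one. -/
theorem exists_multilevel_partial_coupling {ι : Type*} (μ ν : Measure E) [IsFiniteMeasure μ]
    [IsFiniteMeasure ν] (c : E × E → ℝ≥0∞) (G G' : Set E) (hG : ∀ᵐ x ∂μ, x ∈ G)
    (hG' : ∀ᵐ x ∂ν, x ∈ G') (L : ℕ) :
    ∀ (f : ℕ → E → ι) (s : ℕ → Finset ι) (u : ℕ → ι → ℝ≥0∞),
      (∀ l x, f l x ∈ s l) → (∀ l, ∀ i ∈ s l, MeasurableSet (f l ⁻¹' {i})) →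
      (∀ l x y, f (l + 1) x = f (l + 1) y → f l x = f l y) →
      (∀ l x, u l (f l x) = u l (f (l + 1) x)) →
      (∀ l ≤ L, ∀ x ∈ G, ∀ y ∈ G', f l x = f l y → c (x, y) ≤ u l (f l x)) →
      ∃ (π : Measure (E × E)) (μ' ν' : Measure E), π.map Prod.fst + μ' = μ ∧
        π.map Prod.snd + ν' = ν ∧
        (∀ i ∈ s 0, μ' (f 0 ⁻¹' {i}) = μ (f 0 ⁻¹' {i}) - ν (f 0 ⁻¹' {i})) ∧
        (∀ i ∈ s 0, ν' (f 0 ⁻¹' {i}) = ν (f 0 ⁻¹' {i}) - μ (f 0 ⁻¹' {i})) ∧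
        (∀ᵐ z ∂π, f 0 z.1 = f 0 z.2) ∧
        ∫⁻ z, c z ∂π ≤ ∑ i ∈ s L, u L i * μ (f L ⁻¹' {i}) +
          ∑ l ∈ Finset.range L, ∑ i ∈ s (l + 1),
            u l i * (μ (f (l + 1) ⁻¹' {i}) - ν (f (l + 1) ⁻¹' {i})) := by
  have step : ∀ (μ₁ ν₁ : Measure E), IsFiniteMeasure μ₁ → IsFiniteMeasure ν₁ →
      (∀ᵐ x ∂μ₁, x ∈ G) → (∀ᵐ x ∂ν₁, x ∈ G') →
      ∀ (f : E → ι) (s : Finset ι) (u : ι → ℝ≥0∞), (∀ x, f x ∈ s) →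
      (∀ i ∈ s, MeasurableSet (f ⁻¹' {i})) →
      (∀ x ∈ G, ∀ y ∈ G', f x = f y → c (x, y) ≤ u (f x)) →
      ∃ (π : Measure (E × E)) (μ' ν' : Measure E), π.map Prod.fst + μ' = μ₁ ∧
        π.map Prod.snd + ν' = ν₁ ∧
        (∀ i ∈ s, μ' (f ⁻¹' {i}) = μ₁ (f ⁻¹' {i}) - ν₁ (f ⁻¹' {i})) ∧
        (∀ i ∈ s, ν' (f ⁻¹' {i}) = ν₁ (f ⁻¹' {i}) - μ₁ (f ⁻¹' {i})) ∧
        (∀ᵐ z ∂π, f z.1 = f z.2) ∧ ∫⁻ z, c z ∂π ≤ ∫⁻ x, u (f x) ∂μ₁ := by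
    intro μ₁ ν₁ _ _ h1 h2 f s u hf hm hc
    obtain ⟨π, μ', ν', e1, e2, e3, e4, e5⟩ := exists_partial_coupling μ₁ ν₁ f s hf hm
    refine ⟨π, μ', ν', e1, e2, e3, e4, e5, ?_⟩
    have hmeas : Measurable fun x => u (f x) := by
      intro A _
      exact measurable_of_label (γ := ℝ≥0∞) f s hf hm (u ⁻¹' A)
    refine le_trans (lintegral_mono_ae ?_) (lintegral_fst_le e1 hmeas)
    filter_upwards [e5, ae_fst_of_marginal e1 h1, ae_snd_of_marginal e2 h2] with z z1 z2 z3
    exact hc _ z2 _ z3 z1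
  induction L with
  | zero =>
    intro f s u hf hm hn hu hc
    obtain ⟨π, μ', ν', e1, e2, e3, e4, e5, e6⟩ :=
      step μ ν inferInstance inferInstance hG hG' (f 0) (s 0) (u 0) (hf 0) (hm 0) (hc 0 le_rfl)
    refine ⟨π, μ', ν', e1, e2, e3, e4, e5, ?_⟩
    rw [lintegral_comp_label_eq_sum μ (f 0) (s 0) (hf 0) (hm 0)] at e6
    simpa using e6
  | succ L ih =>
    intro f s u hf hm hn hu hc
    obtain ⟨π, μ', ν', e1, e2, e3, e4, e5, e6⟩ := ih (fun l => f (l + 1)) (fun l => s (l + 1))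
      (fun l => u (l + 1)) (fun l => hf (l + 1)) (fun l => hm (l + 1)) (fun l => hn (l + 1))
      (fun l => hu (l + 1)) (fun l hl => hc (l + 1) (by omega))
    simp only [zero_add] at e3 e4 e5
    have hμ' : μ' ≤ μ := by rw [← e1]; exact Measure.le_add_left le_rfl
    have hν' : ν' ≤ ν := by rw [← e2]; exact Measure.le_add_left le_rfl
    have fμ' : IsFiniteMeasure μ' := isFiniteMeasure_of_le μ hμ'
    have fν' : IsFiniteMeasure ν' := isFiniteMeasure_of_le ν hν'
    obtain ⟨π₂, μ₂, ν₂, g1, g2, g3, g4, g5, g6⟩ := step μ' ν' fμ' fν'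
      (ae_mono hμ' hG) (ae_mono hν' hG') (f 0) (s 0) (u 0) (hf 0) (hm 0) (hc 0 (Nat.zero_le _))
    have e5' : ∀ᵐ z ∂π, f 0 z.1 = f 0 z.2 := by
      filter_upwards [e5] with z hz using hn 0 _ _ hz
    -- The plan for the levels above `0` is balanced on the cells of level `0`, so the residuals
    -- have there the same truncated differences as the original measures.
    have hbal : ∀ i ∈ s 0, π.map Prod.fst (f 0 ⁻¹' {i}) = π.map Prod.snd (f 0 ⁻¹' {i}) :=
      fun i hi => map_fst_fiber_eq_map_snd_fiber e5' (hm 0 i hi)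
    have hfin : ∀ A, π.map Prod.fst A ≠ ∞ := fun A => by
      have : π.map Prod.fst A ≤ μ A := by rw [← e1]; exact le_self_add
      exact ne_top_of_le_ne_top (measure_ne_top μ A) this
    have hμF : ∀ A, μ A = π.map Prod.fst A + μ' A := fun A => by
      conv_lhs => rw [← e1]
      exact Measure.add_apply _ _ _
    have hνF : ∀ A, ν A = π.map Prod.snd A + ν' A := fun A => by
      conv_lhs => rw [← e2]
      exact Measure.add_apply _ _ _
    refine ⟨π + π₂, μ₂, ν₂, ?_, ?_, ?_, ?_, ?_, ?_⟩
    · rw [Measure.map_add _ _ measurable_fst, add_assoc, g1, e1]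
    · rw [Measure.map_add _ _ measurable_snd, add_assoc, g2, e2]
    · intro i hi
      rw [g3 i hi, hμF, hνF, ← hbal i hi, ENNReal.add_sub_add_eq_sub_left (hfin _)]
    · intro i hi
      rw [g4 i hi, hμF, hνF, ← hbal i hi, ENNReal.add_sub_add_eq_sub_left (hfin _)]
    · exact ae_add_measure_iff.2 ⟨e5', g5⟩
    · rw [lintegral_add_measure, Finset.sum_range_succ', ← add_assoc]
      refine add_le_add e6 (g6.trans ?_)
      -- The residual masses are known on cells of level `1`, so the cost of level `0` is read off
      -- the label of level `1`.
      simp_rw [hu 0]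
      rw [lintegral_comp_label_eq_sum μ' (f (0 + 1)) (s (0 + 1)) (hf _) (hm _)]
      refine Finset.sum_le_sum fun i hi => ?_
      simp only [zero_add] at hi ⊢
      rw [e3 i hi]

/-- Multilevel upper bound for the transport cost: `u l` bounds the cost inside the cells of level
`l`, and `v` bounds the `p`-th power of the distance to `x₀` inside the cells of level `0`, up to
an error `O` supported where `ν` does not charge. -/
theorem wassersteinPow_le_multilevel {E : Type u} [MetricSpace E] [MeasurableSpace E]
    [BorelSpace E] {ι : Type*} {p : ℝ} (hp : 1 ≤ p)
    (μ ν : Measure E) [IsProbabilityMeasure μ]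
    [IsProbabilityMeasure ν] (G G' : Set E) (hG : ∀ᵐ x ∂μ, x ∈ G)
    (hG' : ∀ᵐ x ∂ν, x ∈ G') (L : ℕ) (f : ℕ → E → ι) (s : ℕ → Finset ι) (u : ℕ → ι → ℝ≥0∞)
    (hf : ∀ l x, f l x ∈ s l) (hm : ∀ l, ∀ i ∈ s l, MeasurableSet (f l ⁻¹' {i}))
    (hn : ∀ l x y, f (l + 1) x = f (l + 1) y → f l x = f l y)
    (hu : ∀ l x, u l (f l x) = u l (f (l + 1) x))
    (hc : ∀ l ≤ L, ∀ x ∈ G, ∀ y ∈ G', f l x = f l y → edist x y ^ p ≤ u l (f l x))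
    (x₀ : E) (v : ι → ℝ≥0∞) (O : E → ℝ≥0∞)
    (hv : ∀ x, edist x₀ x ^ p ≤ v (f 0 x) + O x) (hO' : ∀ y ∈ G', O y = 0) :
    wassersteinPow p μ ν ≤ (∑ i ∈ s L, u L i * μ (f L ⁻¹' {i}) +
          ∑ l ∈ Finset.range L, ∑ i ∈ s (l + 1),
            u l i * (μ (f (l + 1) ⁻¹' {i}) - ν (f (l + 1) ⁻¹' {i}))) +
        2 ^ (p - 1) * (∑ i ∈ s 0, v i * ((μ (f 0 ⁻¹' {i}) - ν (f 0 ⁻¹' {i})) +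
          (ν (f 0 ⁻¹' {i}) - μ (f 0 ⁻¹' {i}))) + ∫⁻ x, O x ∂μ) := by
  obtain ⟨π, μ', ν', e1, e2, e3, e4, e5, e6⟩ := exists_multilevel_partial_coupling μ ν
    (fun z => edist z.1 z.2 ^ p) G G' hG hG' L f s u hf hm hn hu hc
  have hμ' : μ' ≤ μ := by rw [← e1]; exact Measure.le_add_left le_rfl
  have hν' : ν' ≤ ν := by rw [← e2]; exact Measure.le_add_left le_rfl
  have fμ' : IsFiniteMeasure μ' := isFiniteMeasure_of_le μ hμ'
  have fν' : IsFiniteMeasure ν' := isFiniteMeasure_of_le ν hν'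
  have hmass : μ' Set.univ = ν' Set.univ := by
    have h1 : π.map Prod.fst Set.univ + μ' Set.univ = 1 := by
      rw [← Measure.add_apply, e1, measure_univ]
    have h2 : π.map Prod.snd Set.univ + ν' Set.univ = 1 := by
      rw [← Measure.add_apply, e2, measure_univ]
    rw [Measure.map_apply measurable_fst MeasurableSet.univ, Set.preimage_univ] at h1
    rw [Measure.map_apply measurable_snd MeasurableSet.univ, Set.preimage_univ] at h2
    refine (ENNReal.add_right_inj (a := π Set.univ) ?_).1 (h1.trans h2.symm)
    exact ne_top_of_le_ne_top ENNReal.one_ne_top (h1 ▸ le_self_add)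
  -- The two residuals have equal mass, so the trivial one-cell partition matches them completely.
  obtain ⟨π₂, μ₂, ν₂, g1, g2, g3, g4, g5⟩ := exists_partial_coupling μ' ν' (fun _ : E => ())
    Finset.univ (fun _ => Finset.mem_univ _) (fun _ _ => MeasurableSet.const _)
  have hz1 : μ₂ = 0 := by
    have := g3 () (Finset.mem_univ _)
    simp only [Set.preimage_const_of_mem (Set.mem_singleton ()), hmass, tsub_self] at this
    exact Measure.measure_univ_eq_zero.1 this
  have hz2 : ν₂ = 0 := by
    have := g4 () (Finset.mem_univ _)
    simp only [Set.preimage_const_of_mem (Set.mem_singleton ()), hmass, tsub_self] at this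
    exact Measure.measure_univ_eq_zero.1 this
  have hcoup : π + π₂ ∈ couplings μ ν := by
    constructor
    · rw [Measure.map_add _ _ measurable_fst]
      rw [hz1, add_zero] at g1; rw [g1, e1]
    · rw [Measure.map_add _ _ measurable_snd]
      rw [hz2, add_zero] at g2; rw [g2, e2]
  refine (iInf₂_le (π + π₂) hcoup).trans ?_
  rw [lintegral_add_measure]
  refine add_le_add e6 ?_
  have hmd : Measurable fun x : E => edist x₀ x ^ p :=
    (measurable_edist_right).pow_const p
  have hmv : Measurable fun x : E => v (f 0 x) := fun A _ =>
    measurable_of_label (γ := ℝ≥0∞) (f 0) (s 0) (hf 0) (hm 0) (v ⁻¹' A)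
  calc ∫⁻ z, edist z.1 z.2 ^ p ∂π₂
      ≤ ∫⁻ z, 2 ^ (p - 1) * (edist x₀ z.1 ^ p + edist x₀ z.2 ^ p) ∂π₂ := by
        refine lintegral_mono fun z => ?_
        refine le_trans ?_ (ENNReal.rpow_add_le_mul_rpow_add_rpow _ _ hp)
        refine ENNReal.rpow_le_rpow ?_ (by linarith)
        rw [edist_comm x₀]; exact edist_triangle _ _ _
    _ = 2 ^ (p - 1) * (∫⁻ z, edist x₀ z.1 ^ p ∂π₂ + ∫⁻ z, edist x₀ z.2 ^ p ∂π₂) := by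
        rw [lintegral_const_mul' _ _ (by
          exact ENNReal.rpow_ne_top_of_nonneg (by linarith) (by simp)),
          lintegral_add_left (f := fun z : E × E => edist x₀ z.1 ^ p) (hmd.comp measurable_fst)]
    _ ≤ 2 ^ (p - 1) * (∫⁻ x, edist x₀ x ^ p ∂μ' + ∫⁻ x, edist x₀ x ^ p ∂ν') := by
        gcongr
        · exact lintegral_fst_le g1 hmd
        · rw [hz2, add_zero] at g2
          rw [← g2, lintegral_map hmd measurable_snd]
    _ ≤ 2 ^ (p - 1) * ((∫⁻ x, v (f 0 x) ∂μ' + ∫⁻ x, O x ∂μ) + ∫⁻ x, v (f 0 x) ∂ν') := by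
        refine mul_le_mul_right (add_le_add ?_ ?_) _
        · refine (lintegral_mono fun x => hv x).trans ?_
          rw [lintegral_add_left hmv]
          exact add_le_add le_rfl (lintegral_mono' hμ' le_rfl)
        · refine lintegral_mono_ae ?_
          filter_upwards [ae_mono hν' hG'] with y hy
          have := hv y
          rwa [hO' y hy, add_zero] at this
    _ = _ := by
        rw [lintegral_comp_label_eq_sum μ' (f 0) (s 0) (hf 0) (hm 0),
          lintegral_comp_label_eq_sum ν' (f 0) (s 0) (hf 0) (hm 0), add_right_comm,
          ← Finset.sum_add_distrib]
        congr 2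
        refine Finset.sum_congr rfl fun i hi => ?_
        rw [e3 i hi, e4 i hi, mul_add]

end Chain

/-! ### Deviation inequality for Lipschitz functions of i.i.d. sums -/

section Concentration

/-- Termwise comparison of Taylor series from order two on: `u ^ (k + 2) ≤ u ^ 2 * c ^ k`. The
numerator `exp c - 1 - c` is weakened to `exp c - 1` so that the Chernoff parameter can be chosen
explicitly. -/
theorem exp_le_quadratic_of_abs_le {u c : ℝ} (hc : 0 < c) (hu : |u| ≤ c) :
    Real.exp u ≤ 1 + u + u ^ 2 * ((Real.exp c - 1) / c ^ 2) := by
  have hs : ∀ x : ℝ, HasSum (fun k : ℕ => x ^ (k + 2) / (k + 2).factorial)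
      (Real.exp x - (1 + x)) := by
    intro x
    have h := NormedSpace.expSeries_div_hasSum_exp (𝔸 := ℝ) x
    rw [← Real.exp_eq_exp_ℝ] at h
    have := (hasSum_nat_add_iff' 2).2 h
    simpa [Finset.sum_range_succ] using this
  have h1 := hs u
  have h2 := (hs c).mul_left (u ^ 2 / c ^ 2)
  have h3 : Real.exp u - (1 + u) ≤ u ^ 2 / c ^ 2 * (Real.exp c - (1 + c)) := by
    refine hasSum_le (fun k => ?_) h1 h2
    have hk : (0 : ℝ) < (k + 2).factorial := by positivity
    rw [pow_add u, pow_add c]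
    have : u ^ 2 / c ^ 2 * (c ^ k * c ^ 2 / (k + 2).factorial)
        = c ^ k * u ^ 2 / (k + 2).factorial := by
      field_simp
    rw [this]
    refine div_le_div_of_nonneg_right (mul_le_mul_of_nonneg_right ?_ (sq_nonneg u)) hk.le
    calc u ^ k ≤ |u ^ k| := le_abs_self _
      _ = |u| ^ k := abs_pow _ _
      _ ≤ c ^ k := by gcongr
  have h4 : u ^ 2 / c ^ 2 * (Real.exp c - (1 + c)) ≤ u ^ 2 * ((Real.exp c - 1) / c ^ 2) := by
    rw [div_mul_eq_mul_div, mul_div_assoc]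
    gcongr
    linarith
  linarith

/-- Bennett's bound for one variable. Both `Z` and its mean lie within `M` of `a`, hence within `2 *
M` of each other, and the variance is at most the second moment about `a`. -/
theorem integral_exp_le_of_bounded {V : Type*} [MeasurableSpace V] (ν : Measure V)
    [IsProbabilityMeasure ν] {Z g : V → ℝ} (hZ : Measurable Z) (hg : Measurable g) {a M σ2 l : ℝ}
    (hM : 0 < M) (hl : 0 < l) (h1 : ∀ v, |Z v - a| ≤ g v) (h2 : ∀ᵐ v ∂ν, g v ≤ M)
    (h3 : ∫ v, g v ^ 2 ∂ν ≤ σ2) :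
    ∫ v, Real.exp (l * Z v) ∂ν ≤
      Real.exp (σ2 * ((Real.exp (l * (2 * M)) - 1) / (2 * M) ^ 2)) *
        Real.exp (l * ∫ v, Z v ∂ν) := by
  set θ := (Real.exp (l * (2 * M)) - 1) / (2 * M) ^ 2 with hθ
  have hθ0 : 0 ≤ θ := div_nonneg (by
    have := Real.add_one_le_exp (l * (2 * M)); nlinarith [mul_pos hl hM]) (by positivity)
  have hb : ∀ᵐ v ∂ν, |Z v - a| ≤ M := by
    filter_upwards [h2] with v hv using (h1 v).trans hv
  have hZi : Integrable Z ν := by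
    refine Integrable.of_bound hZ.aestronglyMeasurable (|a| + M) ?_
    filter_upwards [hb] with v hv
    rw [Real.norm_eq_abs]
    have := abs_sub_abs_le_abs_sub (Z v) a
    linarith
  set e := ∫ v, Z v ∂ν with he
  have hea : |e - a| ≤ M := by
    have : e - a = ∫ v, (Z v - a) ∂ν := by
      rw [integral_sub hZi (integrable_const _)]; simp [he]
    rw [this]
    have := norm_integral_le_of_norm_le_const (μ := ν) (f := fun v => Z v - a) (C := M)
      (by simpa using hb)
    simpa using this
  have hbe : ∀ᵐ v ∂ν, |Z v - e| ≤ 2 * M := by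
    filter_upwards [hb] with v hv
    have : Z v - e = (Z v - a) - (e - a) := by ring
    rw [this]
    exact (abs_sub _ _).trans (by linarith)
  have hsq : Integrable (fun v => (Z v - e) ^ 2) ν := by
    refine Integrable.of_bound ((hZ.sub_const e).pow_const 2).aestronglyMeasurable
      ((2 * M) ^ 2) ?_
    filter_upwards [hbe] with v hv
    rw [Real.norm_eq_abs, abs_pow]
    gcongr
  have hsqa : Integrable (fun v => (Z v - a) ^ 2) ν := by
    refine Integrable.of_bound ((hZ.sub_const a).pow_const 2).aestronglyMeasurable
      (M ^ 2) ?_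
    filter_upwards [hb] with v hv
    rw [Real.norm_eq_abs, abs_pow]
    gcongr
  have hg2 : Integrable (fun v => g v ^ 2) ν := by
    refine Integrable.of_bound (hg.pow_const 2).aestronglyMeasurable (M ^ 2) ?_
    filter_upwards [h2] with v hv
    rw [Real.norm_eq_abs, abs_pow]
    have : 0 ≤ g v := (abs_nonneg _).trans (h1 v)
    rw [abs_of_nonneg this]
    gcongr
  have hvar : ∫ v, (Z v - e) ^ 2 ∂ν ≤ σ2 := by
    have e1 : ∫ v, (Z v - a) ^ 2 ∂ν = ∫ v, (Z v - e) ^ 2 ∂ν + (e - a) ^ 2 := by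
      have : ∀ v, (Z v - a) ^ 2 = (Z v - e) ^ 2 + (2 * (e - a) * (Z v - e) + (e - a) ^ 2) := by
        intro v; ring
      simp_rw [this]
      have i1 : Integrable (fun v => Z v - e) ν := hZi.sub (integrable_const _)
      have i2 : Integrable (fun v => 2 * (e - a) * (Z v - e) + (e - a) ^ 2) ν :=
        (i1.const_mul _).add (integrable_const _)
      rw [integral_add hsq i2, integral_add (i1.const_mul _) (integrable_const _), integral_const_mul,
        integral_sub hZi (integrable_const _)]
      simp [he]
    have e2 : ∫ v, (Z v - a) ^ 2 ∂ν ≤ ∫ v, g v ^ 2 ∂ν := by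
      refine integral_mono hsqa hg2 fun v => ?_
      have := h1 v
      rw [← sq_abs (Z v - a)]
      gcongr
    nlinarith [sq_nonneg (e - a)]
  have hpt : ∀ᵐ v ∂ν, Real.exp (l * Z v) ≤
      Real.exp (l * e) * (1 + l * (Z v - e) + (Z v - e) ^ 2 * θ) := by
    filter_upwards [hbe] with v hv
    have h := exp_le_quadratic_of_abs_le (u := l * (Z v - e)) (c := l * (2 * M)) (by positivity)
      (by rw [abs_mul, abs_of_pos hl]; gcongr)
    have : l * Z v = l * e + l * (Z v - e) := by ring
    rw [this, Real.exp_add]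
    refine mul_le_mul_of_nonneg_left (h.trans (le_of_eq ?_)) (Real.exp_pos _).le
    rw [hθ]; field_simp
  have hexpi : Integrable (fun v => Real.exp (l * Z v)) ν := by
    refine Integrable.of_bound (hZ.const_mul l).exp.aestronglyMeasurable
      (Real.exp (l * (e + 2 * M))) ?_
    filter_upwards [hbe] with v hv
    rw [Real.norm_eq_abs, abs_of_pos (Real.exp_pos _)]
    gcongr
    linarith [(abs_le.1 hv).2]
  have i1 : Integrable (fun v => l * (Z v - e)) ν := (hZi.sub (integrable_const _)).const_mul _
  have i2 : Integrable (fun v => 1 + l * (Z v - e)) ν := (integrable_const _).add i1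
  have i3 : Integrable (fun v => (Z v - e) ^ 2 * θ) ν := hsq.mul_const _
  calc ∫ v, Real.exp (l * Z v) ∂ν
      ≤ ∫ v, Real.exp (l * e) * (1 + l * (Z v - e) + (Z v - e) ^ 2 * θ) ∂ν :=
        integral_mono_ae hexpi ((i2.add i3).const_mul _) hpt
    _ = Real.exp (l * e) * (1 + (∫ v, (Z v - e) ^ 2 ∂ν) * θ) := by
        rw [integral_const_mul, integral_add i2 i3, integral_add (integrable_const _) i1,
          integral_const_mul, integral_sub hZi (integrable_const _), integral_mul_const]
        simp [he]
    _ ≤ Real.exp (l * e) * Real.exp (σ2 * θ) := by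
        gcongr
        have := Real.add_one_le_exp (σ2 * θ)
        nlinarith [mul_le_mul_of_nonneg_right hvar hθ0]
    _ = _ := mul_comm _ _

/-- Telescoping of the increments; it provides the boundedness behind the integrability claims
below. -/
theorem ae_abs_sum_le {Ω : Type*} [MeasurableSpace Ω] {P : Measure Ω} {V : Type*}
    [MeasurableSpace V] [AddCommMonoid V] {ι : Type*} {ξ : ι → Ω → V} {ν : Measure V}
    (hξ : ∀ i, Measurable (ξ i)) (hν : ∀ i, P.map (ξ i) = ν) {g h : V → ℝ} {M : ℝ}
    (hgM : ∀ᵐ v ∂ν, g v ≤ M) (hg : ∀ z v, |h (z + v) - h z| ≤ g v) (s : Finset ι) :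
    ∀ᵐ ω ∂P, |h (∑ i ∈ s, ξ i ω)| ≤ |h 0| + s.card * M := by
  classical
  induction s using Finset.induction_on with
  | empty => simp
  | insert j s hj ih =>
    have hj' : ∀ᵐ ω ∂P, g (ξ j ω) ≤ M := by
      rw [← hν j] at hgM
      exact ae_of_ae_map (hξ j).aemeasurable hgM
    filter_upwards [ih, hj'] with ω h1 h2
    rw [Finset.sum_insert hj, Finset.card_insert_of_notMem hj, add_comm (ξ j ω)]
    have h3 := hg (∑ i ∈ s, ξ i ω) (ξ j ω)
    have h4 := abs_sub_abs_le_abs_sub (h (∑ i ∈ s, ξ i ω + ξ j ω)) (h (∑ i ∈ s, ξ i ω))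
    push_cast
    linarith

variable {Ω : Type*} [MeasurableSpace Ω] {P : Measure Ω} [IsProbabilityMeasure P]
  {V : Type*} [MeasurableSpace V] [AddCommMonoid V] [MeasurableAdd₂ V]

/-- Martingale argument by induction on the number of variables. Given the other variables, the
one-variable bound applies to the last one, with `a` the value of `h` before it is added. Averaging
`h` over the last variable preserves the increment bound `g`, so the induction hypothesis applies to
the average. -/
theorem integral_exp_lipschitz_sum_le {ι : Type*} {ξ : ι → Ω → V} {ν : Measure V}
    [IsProbabilityMeasure ν] (hξ : ∀ i, Measurable (ξ i)) (hν : ∀ i, P.map (ξ i) = ν)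
    (hind : iIndepFun ξ P) {g : V → ℝ} (hgm : Measurable g) {M σ2 l : ℝ} (hM : 0 < M)
    (hl : 0 < l) (hgM : ∀ᵐ v ∂ν, g v ≤ M) (hσ : ∫ v, g v ^ 2 ∂ν ≤ σ2) (s : Finset ι) :
    ∀ h : V → ℝ, Measurable h → (∀ z v, |h (z + v) - h z| ≤ g v) →
      ∫ ω, Real.exp (l * h (∑ i ∈ s, ξ i ω)) ∂P ≤
        Real.exp (s.card * (σ2 * ((Real.exp (l * (2 * M)) - 1) / (2 * M) ^ 2))) *
          Real.exp (l * ∫ ω, h (∑ i ∈ s, ξ i ω) ∂P) := by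
  classical
  set θ := σ2 * ((Real.exp (l * (2 * M)) - 1) / (2 * M) ^ 2) with hθ
  induction s using Finset.induction_on with
  | empty => intro h _ _; simp
  | insert j s hj ih =>
    intro h hm hg
    set S : Ω → V := fun ω => ∑ i ∈ s, ξ i ω with hS
    have hSm : Measurable S := Finset.measurable_sum _ fun i _ => hξ i
    have hSind : IndepFun S (ξ j) P := by
      have := iIndepFun.indepFun_finsetSum_of_notMem hind hξ hj
      have e : (∑ i ∈ s, ξ i) = S := by ext ω; simp [hS]
      rwa [e] at this
    have hlaw : P.map (fun ω => (S ω, ξ j ω)) = (P.map S).prod ν := by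
      rw [← hν j]
      exact (indepFun_iff_map_prod_eq_prod_map_map hSm.aemeasurable
        (hξ j).aemeasurable).1 hSind
    have : IsProbabilityMeasure (P.map S) := Measure.isProbabilityMeasure_map hSm.aemeasurable
    have hpair : Measurable fun ω => (S ω, ξ j ω) := hSm.prodMk (hξ j)
    have haddm : Measurable fun z : V × V => h (z.1 + z.2) := hm.comp measurable_add
    have hins : ∀ ω, ∑ i ∈ insert j s, ξ i ω = S ω + ξ j ω := fun ω => by
      rw [Finset.sum_insert hj, add_comm]
    set h1 : V → ℝ := fun z => ∫ v, h (z + v) ∂ν with hh1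
    have hzi : ∀ z, Integrable (fun v => h (z + v)) ν := by
      intro z
      refine Integrable.of_bound (hm.comp (measurable_const_add z)).aestronglyMeasurable
        (|h z| + M) ?_
      filter_upwards [hgM] with v hv
      have h3 := hg z v
      have h4 := abs_sub_abs_le_abs_sub (h (z + v)) (h z)
      rw [Real.norm_eq_abs]; linarith
    have h1m : Measurable h1 :=
      (haddm.stronglyMeasurable.integral_prod_right' (ν := ν)).measurable
    have h1g : ∀ z w, |h1 (z + w) - h1 z| ≤ g w := by
      intro z w
      rw [hh1]; simp only
      rw [← integral_sub (hzi _) (hzi _)]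
      have := norm_integral_le_of_norm_le_const (μ := ν)
        (f := fun v => h (z + w + v) - h (z + v)) (C := g w)
        (Filter.Eventually.of_forall fun v => by
          rw [Real.norm_eq_abs, add_right_comm]; exact hg _ _)
      simpa using this
    have hbd := ae_abs_sum_le (P := P) hξ hν hgM hg (insert j s)
    simp_rw [hins] at hbd ⊢
    have hI1 : Integrable (fun z : V × V => h (z.1 + z.2)) ((P.map S).prod ν) := by
      rw [← hlaw, integrable_map_measure haddm.aestronglyMeasurable hpair.aemeasurable]
      exact Integrable.of_bound (haddm.comp hpair).aestronglyMeasurable _ hbd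
    have hI2 : Integrable (fun z : V × V => Real.exp (l * h (z.1 + z.2)))
        ((P.map S).prod ν) := by
      rw [← hlaw, integrable_map_measure (haddm.const_mul l).exp.aestronglyMeasurable
        hpair.aemeasurable]
      refine Integrable.of_bound ((haddm.const_mul l).exp.comp hpair).aestronglyMeasurable
        (Real.exp (l * (|h 0| + (insert j s).card * M))) ?_
      filter_upwards [hbd] with ω hω
      simp only [Function.comp, Real.norm_eq_abs, Real.abs_exp]
      gcongr
      exact (le_abs_self _).trans hω
    have hE1 : ∫ ω, h (S ω + ξ j ω) ∂P = ∫ ω, h1 (S ω) ∂P := by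
      rw [← integral_map (f := h1) hSm.aemeasurable h1m.aestronglyMeasurable,
        ← integral_prod _ hI1, ← hlaw,
        integral_map hpair.aemeasurable haddm.aestronglyMeasurable]
    have hE2 : ∫ ω, Real.exp (l * h (S ω + ξ j ω)) ∂P =
        ∫ z, ∫ v, Real.exp (l * h (z + v)) ∂ν ∂(P.map S) := by
      rw [← integral_prod _ hI2, ← hlaw,
        integral_map hpair.aemeasurable (haddm.const_mul l).exp.aestronglyMeasurable]
    have hbd1 := ae_abs_sum_le (P := P) hξ hν hgM h1g s
    have hI3 : Integrable (fun z => Real.exp (l * h1 z)) (P.map S) := by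
      rw [integrable_map_measure (h1m.const_mul l).exp.aestronglyMeasurable hSm.aemeasurable]
      refine Integrable.of_bound ((h1m.const_mul l).exp.comp hSm).aestronglyMeasurable
        (Real.exp (l * (|h1 0| + s.card * M))) ?_
      filter_upwards [hbd1] with ω hω
      simp only [Function.comp, Real.norm_eq_abs, Real.abs_exp]
      gcongr
      exact (le_abs_self _).trans hω
    rw [hE2, hE1, Finset.card_insert_of_notMem hj]
    calc ∫ z, ∫ v, Real.exp (l * h (z + v)) ∂ν ∂(P.map S)
        ≤ ∫ z, Real.exp θ * Real.exp (l * h1 z) ∂(P.map S) := by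
          refine integral_mono hI2.integral_prod_left (hI3.const_mul _) fun z => ?_
          exact integral_exp_le_of_bounded ν (hm.comp (measurable_const_add z)) hgm hM hl
            (hg z) hgM hσ
      _ = Real.exp θ * ∫ ω, Real.exp (l * h1 (S ω)) ∂P := by
          rw [integral_const_mul, integral_map hSm.aemeasurable
            (h1m.const_mul l).exp.aestronglyMeasurable]
      _ ≤ Real.exp θ * (Real.exp (s.card * θ) * Real.exp (l * ∫ ω, h1 (S ω) ∂P)) := by
          gcongr
          exact ih h1 h1m h1g
      _ = _ := by
          rw [← mul_assoc, ← Real.exp_add]; push_cast; ring_nf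

/-- Fuk–Nagaev type deviation inequality for Lipschitz functions of sums of independent
identically distributed bounded variables. -/
theorem measure_lipschitz_sum_ge_le {n : ℕ} (hn : 0 < n) {ξ : Fin n → Ω → V} {ν : Measure V}
    [IsProbabilityMeasure ν] (hξ : ∀ i, Measurable (ξ i)) (hν : ∀ i, P.map (ξ i) = ν)
    (hind : iIndepFun ξ P) {g : V → ℝ} (hgm : Measurable g) {M σ2 κ : ℝ} (hM : 0 < M)
    (hκ : 0 < κ) (hσ0 : 0 < σ2)
    (hgM : ∀ᵐ v ∂ν, g v ≤ M) (hσ : ∫ v, g v ^ 2 ∂ν ≤ σ2) {h : V → ℝ} (hm : Measurable h)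
    (hg : ∀ z v, |h (z + v) - h z| ≤ g v) :
    P.real {ω | ∫ ω, h (∑ i, ξ i ω) ∂P + κ * (2 * M) ≤ h (∑ i, ξ i ω)} ≤
      Real.exp (κ ^ 2) * (n * σ2 / (κ * (2 * M)) ^ 2) ^ κ := by
  set t := κ * (2 * M) with ht
  have ht0 : 0 < t := by positivity
  set τ := t ^ 2 / (n * σ2) with hτ
  have hn' : (0 : ℝ) < n := by exact_mod_cast hn
  have hτ0 : 0 < τ := by positivity
  -- With this parameter the quadratic term sums to exactly `κ ^ 2`, and the linear term leaves `(1
  -- + τ) ^ (-κ) ≤ τ ^ (-κ)`.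
  set l := Real.log (1 + τ) / (2 * M) with hl
  have hl0 : 0 < l := div_pos (Real.log_pos (by linarith)) (by positivity)
  have hlM : l * (2 * M) = Real.log (1 + τ) := by rw [hl]; field_simp
  have hmain := integral_exp_lipschitz_sum_le hξ hν hind hgm hM hl0 hgM hσ Finset.univ h hm hg
  set e := ∫ ω, h (∑ i, ξ i ω) ∂P with he
  have hSm : Measurable fun ω => h (∑ i, ξ i ω) :=
    hm.comp (Finset.measurable_sum _ fun i _ => hξ i)
  have hint : Integrable (fun ω => Real.exp (l * h (∑ i, ξ i ω))) P := by
    refine Integrable.of_bound (hSm.const_mul l).exp.aestronglyMeasurable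
      (Real.exp (l * (|h 0| + (Finset.univ : Finset (Fin n)).card * M))) ?_
    filter_upwards [ae_abs_sum_le (P := P) hξ hν hgM hg Finset.univ] with ω hω
    simp only [Real.norm_eq_abs, Real.abs_exp]
    gcongr
    exact (le_abs_self _).trans hω
  have hmk := measure_ge_le_exp_mul_mgf (μ := P) (X := fun ω => h (∑ i, ξ i ω)) (e + t) hl0.le hint
  refine hmk.trans ?_
  rw [mgf]
  refine (mul_le_mul_of_nonneg_left hmain (Real.exp_pos _).le).trans ?_
  rw [hlM, Real.exp_log (by linarith), Finset.card_univ, Fintype.card_fin]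
  have e1 : (n : ℝ) * (σ2 * ((1 + τ - 1) / (2 * M) ^ 2)) = κ ^ 2 := by
    rw [hτ, ht]; field_simp; ring
  rw [e1, ← mul_assoc, mul_comm (Real.exp (-l * (e + t))), mul_assoc, ← Real.exp_add]
  refine mul_le_mul_of_nonneg_left ?_ (Real.exp_pos _).le
  have e2 : -l * (e + t) + l * e = Real.log (1 + τ) * (-κ) := by
    rw [← hlM, ht]; ring
  rw [e2, ← Real.rpow_def_of_pos (by linarith)]
  have e3 : (n * σ2 / t ^ 2) = τ⁻¹ := by rw [hτ, inv_div]
  rw [e3, Real.inv_rpow hτ0.le, ← Real.rpow_neg hτ0.le]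
  exact Real.rpow_le_rpow_of_nonpos hτ0 (by linarith) (by linarith)

end Concentration

/-! ### Dyadic rings and nested cells from the covering condition -/

section Partition

variable {E : Type u} [MetricSpace E] [MeasurableSpace E] [BorelSpace E]

omit [MeasurableSpace E] [BorelSpace E] in
-- A minimal cover at scale `2 * r / 2 ^ l`, to which `x₀` is added as a default centre; this turns
-- `β` into `β + 1`. Centres lie in the covered set or equal `x₀`, so each of them has a near centre
-- at every coarser level.
theorem HasCoveringDim.exists_centres {x₀ : E} {S : Set E} {p β : ℝ} (hp : 0 ≤ p) (hβ : 0 < β)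
    (hS : HasCoveringDim x₀ S (2 * p) β) {r : ℝ} (hr : 0 < r) (l : ℕ) :
    ∃ C : Finset E, x₀ ∈ C ∧ (C.card : ℝ) ≤ (β + 1) * 2 ^ (2 * p * l) ∧
      (∀ y ∈ S ∩ Metric.closedBall x₀ r, ∃ c ∈ C, dist y c ≤ 2 * r / 2 ^ l) ∧
      ∀ c ∈ C, c ∈ S ∩ Metric.closedBall x₀ r ∨ c = x₀ := by
  classical
  have hδ : 0 < 2 * r / 2 ^ l := by positivity
  have h := hS r hr (2 * r / 2 ^ l) hδ
    (div_le_self (by positivity) (one_le_pow₀ (by norm_num)))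
  have e1 : 2 * r / (2 * r / 2 ^ l) = 2 ^ l := by field_simp
  have e2 : ((2 : ℝ) ^ l) ^ (2 * p) = 2 ^ (2 * p * l) := by
    rw [← Real.rpow_natCast, ← Real.rpow_mul (by norm_num)]; ring_nf
  rw [e1, e2] at h
  set N := Metric.coveringNumber (2 * r / 2 ^ l).toNNReal (S ∩ Metric.closedBall x₀ r) with hN
  have hNtop : N ≠ ⊤ := by
    intro h0
    rw [h0] at h
    simp at h
  obtain ⟨C, hCs, hCf, hCc, hCn⟩ := Metric.exists_set_encard_eq_coveringNumber hNtop
  have hcard : (hCf.toFinset.card : ℝ) ≤ β * 2 ^ (2 * p * l) := by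
    have : N = (hCf.toFinset.card : ℕ∞) := by
      rw [← hN] at hCn
      rw [← hCn, hCf.encard_eq_coe_toFinset_card]
    rw [this] at h
    have h2 : ((hCf.toFinset.card : ℕ) : ℝ≥0∞) ≤ ENNReal.ofReal (β * 2 ^ (2 * p * l)) := by
      simpa using h
    rw [← ENNReal.ofReal_natCast] at h2
    exact (ENNReal.ofReal_le_ofReal_iff (by positivity)).1 h2
  refine ⟨insert x₀ hCf.toFinset, Finset.mem_insert_self _ _, ?_, ?_, ?_⟩
  · have h1 : ((insert x₀ hCf.toFinset).card : ℝ) ≤ hCf.toFinset.card + 1 := by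
      exact_mod_cast Finset.card_insert_le _ _
    have h2 : (1 : ℝ) ≤ 2 ^ (2 * p * l) := Real.one_le_rpow (by norm_num) (by positivity)
    nlinarith
  · intro y hy
    obtain ⟨c, hc, hyc⟩ := hCc hy
    refine ⟨c, by simp [hc], ?_⟩
    have h3 : edist y c ≤ ((2 * r / 2 ^ l).toNNReal : ℝ≥0∞) := hyc
    rw [edist_nndist, ENNReal.coe_le_coe] at h3
    rw [← Real.coe_toNNReal _ hδ.le]
    exact_mod_cast h3
  · intro c hc
    rcases Finset.mem_insert.1 hc with h | h
    · exact Or.inr h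
    · exact Or.inl (hCs (by simpa using h))

/-- A point takes the nearest centre of level `L`, and then each centre takes a parent one level up.
Coarser labels are functions of finer ones, which gives nestedness, and the successive displacements
form a geometric series. The set `G`, a finite union of closed balls, replaces the possibly
non-measurable `S`. -/
theorem HasCoveringDim.exists_nested_labels {x₀ : E} {S : Set E} {p β : ℝ} (hp : 0 ≤ p)
    (hβ : 0 < β) (hS : HasCoveringDim x₀ S (2 * p) β) {r : ℝ} (hr : 0 < r) (L : ℕ) :
    ∃ (C : ℕ → Finset E) (φ : ℕ → SimpleFunc E E) (G : Set E),
      (∀ l x, φ l x ∈ C l) ∧ (∀ l ≤ L, ((C l).card : ℝ) ≤ (β + 1) * 2 ^ (2 * p * l)) ∧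
      (∀ l x y, φ (l + 1) x = φ (l + 1) y → φ l x = φ l y) ∧
      MeasurableSet G ∧ S ∩ Metric.closedBall x₀ r ⊆ G ∧
      ∀ x ∈ G, ∀ l ≤ L, dist x (φ l x) ≤ 4 * r / 2 ^ l := by
  classical
  choose C hC0 hCcard hCcov hCmem using fun l => hS.exists_centres hp hβ hr l
  have hpar : ∀ l, ∀ c ∈ C (l + 1), ∃ c' ∈ C l, dist c c' ≤ 2 * r / 2 ^ l := by
    intro l c hc
    rcases hCmem _ c hc with h | h
    · exact hCcov l c h
    · exact ⟨x₀, hC0 l, by rw [h, dist_self]; positivity⟩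
  let g : ℕ → E → E := fun l c =>
    if h : ∃ c' ∈ C l, dist c c' ≤ 2 * r / 2 ^ l then h.choose else x₀
  have hgC : ∀ l c, g l c ∈ C l := by
    intro l c
    by_cases h : ∃ c' ∈ C l, dist c c' ≤ 2 * r / 2 ^ l
    · simp only [g, h, dif_pos]; exact h.choose_spec.1
    · simp only [g, h, dif_neg, not_false_iff]; exact hC0 l
  have hgd : ∀ l, ∀ c ∈ C (l + 1), dist c (g l c) ≤ 2 * r / 2 ^ l := by
    intro l c hc
    have h := hpar l c hc
    simp only [g, h, dif_pos]; exact h.choose_spec.2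
  let lst := (C L).toList
  let e : ℕ → E := fun i => lst.getD i x₀
  have heC : ∀ i, e i ∈ C L := by
    intro i
    by_cases h : i < lst.length
    · have : e i = lst[i] := List.getD_eq_getElem _ _ h
      rw [this]; exact Finset.mem_toList.1 (List.getElem_mem h)
    · have : e i = x₀ := List.getD_eq_default _ _ (not_lt.1 h)
      rw [this]; exact hC0 L
  -- The index `j` counts upwards from the finest level: `ψ j` is the label of level `L - j`.
  let ψ : ℕ → SimpleFunc E E := fun j =>
    Nat.rec (SimpleFunc.nearestPt e lst.length) (fun j φ => φ.map (g (L - (j + 1)))) j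
  have hψ0 : ψ 0 = SimpleFunc.nearestPt e lst.length := rfl
  have hψs : ∀ j x, ψ (j + 1) x = g (L - (j + 1)) (ψ j x) := fun j x => rfl
  have hψC : ∀ j x, ψ j x ∈ C (L - j) := by
    intro j x
    cases j with
    | zero =>
      rw [hψ0, SimpleFunc.nearestPt, SimpleFunc.map_apply]; exact heC _
    | succ j => rw [hψs]; exact hgC _ _
  let G : Set E := ⋃ c ∈ C L, Metric.closedBall c (2 * r / 2 ^ L)
  have hGd : ∀ x ∈ G, ∀ j ≤ L, dist x (ψ j x) ≤ 4 * r / 2 ^ (L - j) := by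
    intro x hx j
    induction j with
    | zero =>
      intro _
      obtain ⟨c, hc, hxc⟩ := Set.mem_iUnion₂.1 hx
      obtain ⟨i, hi, hic⟩ := List.mem_iff_getElem.1 (Finset.mem_toList.2 hc)
      have h1 := SimpleFunc.edist_nearestPt_le e x (k := i) (N := lst.length) hi.le
      have h2 : e i = c := by
        have : e i = lst[i] := List.getD_eq_getElem _ _ hi
        rw [this]; exact hic
      rw [h2, ← hψ0] at h1
      have h3 : dist (ψ 0 x) x ≤ dist c x := by
        rw [edist_dist, edist_dist] at h1
        exact (ENNReal.ofReal_le_ofReal_iff dist_nonneg).1 h1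
      have h4 : dist x c ≤ 2 * r / 2 ^ L := Metric.mem_closedBall.1 hxc
      rw [Nat.sub_zero, dist_comm]
      refine h3.trans ?_
      rw [dist_comm]
      refine h4.trans ?_
      gcongr; norm_num
    | succ j ih =>
      intro hj
      have h1 := ih (by omega)
      obtain ⟨q, hq⟩ : ∃ q, L - j = q + 1 := ⟨L - j - 1, by omega⟩
      have hq' : L - (j + 1) = q := by omega
      have h2 := hgd q (ψ j x) (hq ▸ hψC j x)
      rw [hψs, hq']
      rw [hq] at h1
      have h3 := dist_triangle x (ψ j x) (g q (ψ j x))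
      have h4 : 4 * r / 2 ^ (q + 1) + 2 * r / 2 ^ q = 4 * r / 2 ^ q := by
        rw [pow_succ]; field_simp; ring
      linarith
  -- Truncated subtraction freezes the labels beyond level `L`, so nestedness holds at every `l`.
  refine ⟨fun l => C (min l L), fun l => ψ (L - l), G, ?_, ?_, ?_, ?_, ?_, ?_⟩
  · intro l x
    have := hψC (L - l) x
    have e : L - (L - l) = min l L := by omega
    rwa [e] at this
  · intro l hl
    simp only [min_eq_left hl]; exact hCcard l
  · intro l x y h
    by_cases hl : l < L
    · have e : L - l = (L - (l + 1)) + 1 := by omega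
      simp only [e, hψs]
      exact congrArg _ h
    · have e : L - l = L - (l + 1) := by omega
      simp only [e]; exact h
  · exact Finset.measurableSet_biUnion _ fun c _ => Metric.isClosed_closedBall.measurableSet
  · intro y hy
    obtain ⟨c, hc, hyc⟩ := hCcov L y hy
    exact Set.mem_iUnion₂.2 ⟨c, hc, Metric.mem_closedBall.2 hyc⟩
  · intro x hx l hl
    have := hGd x hx (L - l) (by omega)
    have e : L - (L - l) = l := by omega
    rwa [e] at this

open Classical in
/-- Index of the dyadic ring containing `x`: rings `0, …, J` have outer radius `R / 2 ^ k`, and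
`J + 1` is the index of the complement of the ball of radius `R`. -/
noncomputable def ringIndex (x₀ : E) (R : ℝ) (J : ℕ) (x : E) : ℕ :=
  if dist x x₀ ≤ R then Nat.findGreatest (fun k => dist x x₀ ≤ R / 2 ^ k) J else J + 1

omit [MeasurableSpace E] [BorelSpace E] in
theorem ringIndex_le_succ (x₀ : E) (R : ℝ) (J : ℕ) (x : E) : ringIndex x₀ R J x ≤ J + 1 := by
  unfold ringIndex
  split_ifs
  · exact (Nat.findGreatest_le J).trans (Nat.le_succ J)
  · exact le_rfl

omit [MeasurableSpace E] [BorelSpace E] in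
theorem ringIndex_le_iff (x₀ : E) (R : ℝ) (J : ℕ) (x : E) :
    ringIndex x₀ R J x ≤ J ↔ dist x x₀ ≤ R := by
  unfold ringIndex
  split_ifs with h
  · simp [h, Nat.findGreatest_le]
  · simp [h]

omit [MeasurableSpace E] [BorelSpace E] in
theorem dist_le_of_ringIndex_le {x₀ : E} {R : ℝ} {J : ℕ} {x : E} (h : ringIndex x₀ R J x ≤ J) :
    dist x x₀ ≤ R / 2 ^ ringIndex x₀ R J x := by
  have h' := (ringIndex_le_iff x₀ R J x).1 h
  have := Nat.findGreatest_spec (P := fun k => dist x x₀ ≤ R / 2 ^ k) (Nat.zero_le J)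
    (by simpa using h')
  simpa only [ringIndex, h', if_true] using this

omit [MeasurableSpace E] [BorelSpace E] in
-- The innermost index `J` is excluded: it stands for a full ball, on which the distance to `x₀` has
-- no lower bound.
theorem lt_dist_of_ringIndex_lt {x₀ : E} {R : ℝ} {J : ℕ} {x : E} (h : ringIndex x₀ R J x < J) :
    R / 2 ^ (ringIndex x₀ R J x + 1) < dist x x₀ := by
  have h' := (ringIndex_le_iff x₀ R J x).1 h.le
  have e : ringIndex x₀ R J x = Nat.findGreatest (fun k => dist x x₀ ≤ R / 2 ^ k) J := by
    simp only [ringIndex, h', if_true]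
  rw [e] at h ⊢
  exact not_le.1 (Nat.findGreatest_is_greatest (Nat.lt_succ_self _) h)

theorem measurable_ringIndex (x₀ : E) (R : ℝ) (J : ℕ) : Measurable (ringIndex x₀ R J) := by
  classical
  have hd : ∀ t : ℝ, MeasurableSet {x : E | dist x x₀ ≤ t} := fun t =>
    (Metric.isClosed_closedBall (x := x₀) (ε := t)).measurableSet
  unfold ringIndex
  exact Measurable.ite (hd R) (measurable_findGreatest fun k _ => hd _) measurable_const

/-- Nested finite partitions of the rings of index at most `J` into cells, level `l` having at most
`N l` cells per ring and cells of diameter at most `8 (R / 2 ^ k) / 2 ^ l` in the ring `k`, up to a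
`μ`-null set. Labels of cells are pairs (ring, centre). -/
structure RingPartition (μ : Measure E) (x₀ : E) (R : ℝ) (J L : ℕ) (N : ℕ → ℝ) where
  label : ℕ → E → ℕ × E
  cells : ℕ → Finset (ℕ × E)
  core : Set E
  measurableSet_core : MeasurableSet core
  ae_mem_core : ∀ᵐ x ∂μ, x ∈ core
  label_mem : ∀ l x, label l x ∈ cells l
  measurableSet_fiber : ∀ l, ∀ i ∈ cells l, MeasurableSet (label l ⁻¹' {i})
  nested : ∀ l x y, label (l + 1) x = label (l + 1) y → label l x = label l y
  label_fst : ∀ l x, (label l x).1 = ringIndex x₀ R J x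
  fst_le : ∀ l, ∀ i ∈ cells l, i.1 ≤ J + 1
  card_le : ∀ l ≤ L, ∀ k ≤ J, ∃ C : Finset (ℕ × E), (∀ i ∈ cells l, i.1 = k → i ∈ C) ∧
    (C.card : ℝ) ≤ N l
  dist_le : ∀ l ≤ L, ∀ x ∈ core, ∀ y ∈ core, label l x = label l y → ringIndex x₀ R J x ≤ J →
    dist x y ≤ 8 * (R / 2 ^ ringIndex x₀ R J x) / 2 ^ l

/-- Nested labels are taken separately in each ball of radius `R / 2 ^ k` and used only on ring `k`.
Two core points sharing a label are each within `4 * (R / 2 ^ k) / 2 ^ l` of it. The exterior of the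
ball forms a single cell. -/
theorem HasCoveringDim.nonempty_ringPartition {x₀ : E} {S : Set E} {p β : ℝ} (hp : 0 ≤ p)
    (hβ : 0 < β) (hS : HasCoveringDim x₀ S (2 * p) β) (μ : Measure E) [IsProbabilityMeasure μ]
    (hμ : μ S = 1) {R : ℝ} (hR : 0 < R) (J L : ℕ) :
    Nonempty (RingPartition μ x₀ R J L fun l => (β + 1) * 2 ^ (2 * p * l)) := by
  classical
  have hRk : ∀ k : ℕ, 0 < R / 2 ^ k := fun k => by positivity
  choose C φ G hφC hCcard hφn hGm hSG hGd using
    fun k : ℕ => hS.exists_nested_labels hp hβ (hRk k) L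
  set rk := ringIndex x₀ R J with hrk
  have hrkm : Measurable rk := measurable_ringIndex x₀ R J
  let f : ℕ → E → ℕ × E := fun l x => (rk x, if rk x ≤ J then φ (rk x) l x else x₀)
  let s : ℕ → Finset (ℕ × E) := fun l =>
    insert (J + 1, x₀) ((Finset.range (J + 1)).biUnion fun k => (C k l).image fun c => (k, c))
  -- A measurable set containing `S`: on ring `k` it asks for membership in the good set of that
  -- ring. It has full measure even if `S` is only of outer measure one.
  let G₀ : Set E := ⋂ k ∈ Finset.range (J + 1), ((rk ⁻¹' {k})ᶜ ∪ G k)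
  have hG₀ : ∀ x ∈ G₀, rk x ≤ J → x ∈ G (rk x) := by
    intro x hx hk
    have := Set.mem_iInter₂.1 hx (rk x) (Finset.mem_range.2 (by omega))
    simpa using this
  have hG₀m : MeasurableSet G₀ :=
    Finset.measurableSet_biInter _ fun k _ =>
      ((hrkm (measurableSet_singleton k)).compl).union (hGm k)
  refine ⟨⟨f, s, G₀, hG₀m, ?_, ?_, ?_, ?_, fun l x => rfl, ?_, ?_, ?_⟩⟩
  · have hsub : S ⊆ G₀ := by
      intro x hx
      refine Set.mem_iInter₂.2 fun k hk => ?_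
      by_cases h : rk x = k
      · right
        have hkJ : rk x ≤ J := by have := Finset.mem_range.1 hk; omega
        have hd : dist x x₀ ≤ R / 2 ^ rk x := dist_le_of_ringIndex_le hkJ
        exact hSG k ⟨hx, Metric.mem_closedBall.2 (h ▸ hd)⟩
      · left; simpa using h
    have h1 : μ G₀ = 1 := le_antisymm prob_le_one (hμ ▸ measure_mono hsub)
    exact (mem_ae_iff_prob_eq_one hG₀m).2 h1
  · intro l x
    by_cases h : rk x ≤ J
    · refine Finset.mem_insert_of_mem (Finset.mem_biUnion.2 ⟨rk x, Finset.mem_range.2 (by omega), ?_⟩)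
      refine Finset.mem_image.2 ⟨φ (rk x) l x, hφC _ _ _, ?_⟩
      simp [f, h]
    · have h2 : rk x = J + 1 := le_antisymm (ringIndex_le_succ _ _ _ _) (by omega)
      refine Finset.mem_insert.2 (Or.inl ?_)
      simp [f, h2]
  · rintro l ⟨k, c⟩ _
    by_cases h : k ≤ J
    · have : f l ⁻¹' {(k, c)} = rk ⁻¹' {k} ∩ φ k l ⁻¹' {c} := by
        ext x
        simp only [f, Set.mem_preimage, Set.mem_singleton_iff, Prod.mk.injEq, Set.mem_inter_iff]
        refine and_congr_right fun hk => ?_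
        rw [hk, if_pos h]
      rw [this]
      exact (hrkm (measurableSet_singleton k)).inter ((φ k l).measurableSet_fiber c)
    · have : f l ⁻¹' {(k, c)} = rk ⁻¹' {k} ∩ {_x | x₀ = c} := by
        ext x
        simp only [f, Set.mem_preimage, Set.mem_singleton_iff, Prod.mk.injEq, Set.mem_inter_iff,
          Set.mem_ofPred_eq]
        refine and_congr_right fun hk => ?_
        rw [hk, if_neg h]
      rw [this]
      exact (hrkm (measurableSet_singleton k)).inter (MeasurableSet.const _)
  · intro l x y h
    simp only [f, Prod.mk.injEq] at h ⊢
    obtain ⟨h1, h2⟩ := h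
    refine ⟨h1, ?_⟩
    by_cases hk : rk y ≤ J
    · rw [h1, if_pos hk, if_pos hk] at h2 ⊢
      exact hφn _ _ _ _ h2
    · rw [h1, if_neg hk, if_neg hk]
  · intro l i hi
    rcases Finset.mem_insert.1 hi with h | h
    · simp [h]
    · obtain ⟨k, hk, hi⟩ := Finset.mem_biUnion.1 h
      obtain ⟨c, _, rfl⟩ := Finset.mem_image.1 hi
      exact (Finset.mem_range.1 hk).le
  · intro l hl k hk
    refine ⟨(C k l).image fun c => (k, c), ?_, ?_⟩
    · rintro i hi rfl
      rcases Finset.mem_insert.1 hi with h | h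
      · rw [h] at hk; simp at hk
      · obtain ⟨k', hk', hi⟩ := Finset.mem_biUnion.1 h
        obtain ⟨c, hc, rfl⟩ := Finset.mem_image.1 hi
        exact Finset.mem_image_of_mem _ hc
    · refine le_trans ?_ (hCcard k l hl)
      exact_mod_cast Finset.card_image_le
  · intro l hl x hx y hy hxy hk
    simp only [f, Prod.mk.injEq] at hxy
    obtain ⟨h1, h2⟩ := hxy
    have hky : rk y ≤ J := h1 ▸ hk
    rw [if_pos hk, if_pos hky] at h2
    have d1 := hGd _ x (hG₀ x hx hk) l hl
    have d2 := hGd _ y (hG₀ y hy hky) l hl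
    rw [h2] at d1
    rw [← h1] at d1 d2
    have h3 := dist_triangle_right x y (φ (rk x) l y)
    change dist x y ≤ 8 * (R / 2 ^ rk x) / 2 ^ l
    rw [h1] at h3 d1 d2 ⊢
    calc dist x y ≤ _ := h3
      _ ≤ _ := add_le_add d1 d2
      _ = 8 * (R / 2 ^ rk y) / 2 ^ l := by ring

end Partition

/-! ### Transport cost bounded by the weighted discrepancy -/

section RingBound

variable {E : Type u} [MetricSpace E] [MeasurableSpace E] [BorelSpace E]

/-- Mass of the ring of index `k`. -/
noncomputable def ringMass (μ : Measure E) (x₀ : E) (R : ℝ) (J k : ℕ) : ℝ :=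
  μ.real (ringIndex x₀ R J ⁻¹' {k})

/-- Weight `((R / 2 ^ k) / 2 ^ l) ^ p` of the cells of level `l` in the ring `k ≤ J`. -/
noncomputable def ringWeight (p R : ℝ) (J l k : ℕ) : ℝ :=
  if k ≤ J then (R / 2 ^ k / 2 ^ l) ^ p else 0

omit [BorelSpace E] in
theorem ringMass_nonneg (μ : Measure E) (x₀ : E) (R : ℝ) (J k : ℕ) :
    0 ≤ ringMass μ x₀ R J k := measureReal_nonneg

theorem ringWeight_nonneg {p R : ℝ} (hR : 0 < R) (J l k : ℕ) : 0 ≤ ringWeight p R J l k := by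
  unfold ringWeight; split_ifs <;> positivity

theorem ringWeight_succ {p R : ℝ} (hR : 0 < R) (J l k : ℕ) :
    ringWeight p R J l k = 2 ^ p * ringWeight p R J (l + 1) k := by
  unfold ringWeight
  split_ifs
  · rw [← Real.mul_rpow (by norm_num) (by positivity), pow_succ]
    congr 1; field_simp
  · simp

namespace RingPartition

variable {μ : Measure E} [IsProbabilityMeasure μ] {x₀ : E} {R : ℝ} {J L : ℕ} {N : ℕ → ℝ}
  (Q : RingPartition μ x₀ R J L N)

/-- Weighted multilevel discrepancy between `μ` and the cell masses `m`. -/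
noncomputable def discrepancy (p : ℝ) (m : ℕ → ℕ × E → ℝ) : ℝ :=
  ∑ l ∈ Finset.range (L + 1), ∑ i ∈ Q.cells l,
    ringWeight p R J l i.1 * |μ.real (Q.label l ⁻¹' {i}) - m l i|

omit [BorelSpace E] [IsProbabilityMeasure μ] in
theorem measurableSet_label_preimage (l : ℕ) (A : Set (ℕ × E)) :
    MeasurableSet (Q.label l ⁻¹' A) :=
  measurable_of_label (γ := ℝ) (Q.label l) (Q.cells l) (Q.label_mem l) (Q.measurableSet_fiber l) A

omit [BorelSpace E] in
theorem sum_filter_cells (l k : ℕ) :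
    ∑ i ∈ Q.cells l with i.1 = k, μ.real (Q.label l ⁻¹' {i}) = ringMass μ x₀ R J k := by
  classical
  have h : ringIndex x₀ R J ⁻¹' {k} =
      ⋃ i ∈ (Q.cells l).filter (fun i => i.1 = k), Q.label l ⁻¹' {i} := by
    ext x
    simp only [Set.mem_preimage, Set.mem_singleton_iff, Finset.mem_filter, Set.mem_iUnion,
      exists_prop]
    constructor
    · intro hx
      exact ⟨Q.label l x, ⟨Q.label_mem l x, by rw [Q.label_fst, hx]⟩, rfl⟩
    · rintro ⟨i, hi, hx⟩
      rw [← Q.label_fst l x, hx, hi.2]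
  rw [ringMass, h, measureReal_biUnion_finset]
  · intro i _ j _ hij
    exact Disjoint.preimage _ (by simpa using hij)
  · intro i _
    exact Q.measurableSet_label_preimage l {i}

omit [BorelSpace E] [IsProbabilityMeasure μ] in
theorem sum_cells_eq (l : ℕ) (F : ℕ × E → ℝ) (hF : ∀ i ∈ Q.cells l, i.1 = J + 1 → F i = 0) :
    ∑ i ∈ Q.cells l, F i =
      ∑ k ∈ Finset.range (J + 1), ∑ i ∈ Q.cells l with i.1 = k, F i := by
  classical
  rw [← Finset.sum_fiberwise_of_maps_to (t := Finset.range (J + 2)) (g := Prod.fst)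
    (fun i hi => Finset.mem_range.2 (by have := Q.fst_le l i hi; omega)),
    Finset.sum_range_succ _ (J + 1)]
  rw [Finset.sum_eq_zero (s := (Q.cells l).filter fun i => i.1 = J + 1), add_zero]
  intro i hi
  exact hF i (Finset.mem_filter.1 hi).1 (Finset.mem_filter.1 hi).2

omit [BorelSpace E] in
theorem sum_weight_mul_measure {p : ℝ} (l : ℕ) :
    ∑ i ∈ Q.cells l, ringWeight p R J l i.1 * μ.real (Q.label l ⁻¹' {i}) =
      ∑ k ∈ Finset.range (J + 1), ringWeight p R J l k * ringMass μ x₀ R J k := by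
  rw [Q.sum_cells_eq l _ (fun i _ h => by simp [ringWeight, h])]
  refine Finset.sum_congr rfl fun k _ => ?_
  rw [← Q.sum_filter_cells l k, Finset.mul_sum]
  refine Finset.sum_congr rfl fun i hi => ?_
  rw [(Finset.mem_filter.1 hi).2]

/-- The multilevel bound with cost `8 ^ p * ringWeight` inside cells, the level `0` weight as bound
for the distance to `x₀`, and the part of `μ` beyond `R` as outer error. Since `ν` charges only the
ball, the exterior cell is never matched. -/
theorem wassersteinPow_le {p : ℝ} (hp : 1 ≤ p) (hR : 0 < R) (ν : Measure E)
    [IsProbabilityMeasure ν] (hν : ∀ᵐ x ∂ν, x ∈ Q.core) (hνR : ∀ᵐ x ∂ν, dist x x₀ ≤ R)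
    {m : ℝ} (hm0 : 0 ≤ m)
    (hm : ∫⁻ x in {x | R < dist x x₀}, edist x₀ x ^ p ∂μ ≤ ENNReal.ofReal m) :
    wassersteinPow p μ ν ≤ ENNReal.ofReal (16 ^ p *
      (∑ k ∈ Finset.range (J + 1), ringWeight p R J L k * ringMass μ x₀ R J k + m +
        Q.discrepancy p fun l i => ν.real (Q.label l ⁻¹' {i}))) := by
  classical
  have hp0 : 0 ≤ p := by linarith
  set wt := ringWeight p R J with hwt
  have hwt0 : ∀ l k, 0 ≤ wt l k := ringWeight_nonneg hR J
  have hout : MeasurableSet {x | R < dist x x₀} :=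
    (isOpen_lt continuous_const (continuous_id.dist continuous_const)).measurableSet
  have hGs : ∀ᵐ x ∂ν, x ∈ Q.core ∩ {x | dist x x₀ ≤ R} := by
    filter_upwards [hν, hνR] with x h1 h2 using ⟨h1, h2⟩
  have hedist : ∀ (x y : E) (a : ℝ), dist x y ≤ a → edist x y ^ p ≤ ENNReal.ofReal (a ^ p) := by
    intro x y a h
    rw [edist_dist, ENNReal.ofReal_rpow_of_nonneg dist_nonneg hp0]
    exact ENNReal.ofReal_le_ofReal (Real.rpow_le_rpow dist_nonneg h hp0)
  have key := wassersteinPow_le_multilevel hp μ ν Q.core (Q.core ∩ {x | dist x x₀ ≤ R})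
    Q.ae_mem_core hGs L Q.label Q.cells (fun l i => ENNReal.ofReal (8 ^ p * wt l i.1))
    Q.label_mem Q.measurableSet_fiber Q.nested
    (fun l x => by simp only [Q.label_fst])
    (fun l hl x hx y hy hxy => by
      have hy2 : dist y x₀ ≤ R := hy.2
      have hk : ringIndex x₀ R J x ≤ J := by
        rw [← Q.label_fst l x, hxy, Q.label_fst l y]
        exact (ringIndex_le_iff x₀ R J y).2 hy2
      refine (hedist x y _ (Q.dist_le l hl x hx y hy.1 hxy hk)).trans ?_
      rw [Q.label_fst, hwt, ringWeight, if_pos hk, mul_div_assoc,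
        Real.mul_rpow (by norm_num) (by positivity)])
    x₀ (fun i => ENNReal.ofReal (wt 0 i.1))
    ({x | R < dist x x₀}.indicator fun x => edist x₀ x ^ p)
    (fun x => by
      by_cases h : dist x x₀ ≤ R
      · have hk := (ringIndex_le_iff x₀ R J x).2 h
        refine le_trans ?_ le_self_add
        rw [Q.label_fst, hwt, ringWeight, if_pos hk]
        exact hedist _ _ _ (by rw [dist_comm]; simpa using dist_le_of_ringIndex_le hk)
      · rw [Set.indicator_of_mem (by simpa using h)]
        exact le_add_self)
    (fun y hy => Set.indicator_of_notMem (by simpa using hy.2) _)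
  set D : ℕ → ℝ := fun l => ∑ i ∈ Q.cells l,
    wt l i.1 * |μ.real (Q.label l ⁻¹' {i}) - ν.real (Q.label l ⁻¹' {i})| with hD
  have hD0 : ∀ l, 0 ≤ D l := fun l =>
    Finset.sum_nonneg fun i _ => mul_nonneg (hwt0 _ _) (abs_nonneg _)
  have hsub : ∀ (μ₁ μ₂ : Measure E) [IsProbabilityMeasure μ₁] [IsProbabilityMeasure μ₂]
      (A : Set E), μ₁ A - μ₂ A = ENNReal.ofReal (μ₁.real A - μ₂.real A) := by
    intro μ₁ μ₂ _ _ A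
    rw [ENNReal.ofReal_sub _ measureReal_nonneg, ofReal_measureReal, ofReal_measureReal]
  have hT1 : ∑ i ∈ Q.cells L, ENNReal.ofReal (8 ^ p * wt L i.1) * μ (Q.label L ⁻¹' {i}) =
      ENNReal.ofReal (8 ^ p *
        ∑ k ∈ Finset.range (J + 1), wt L k * ringMass μ x₀ R J k) := by
    rw [← Q.sum_weight_mul_measure, Finset.mul_sum, ENNReal.ofReal_sum_of_nonneg
      (fun i _ => by have := hwt0 L i.1; positivity)]
    refine Finset.sum_congr rfl fun i _ => ?_
    rw [← mul_assoc, ENNReal.ofReal_mul (p := 8 ^ p * ringWeight p R J L i.1)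
      (by have := hwt0 L i.1; positivity), ofReal_measureReal]
  have hT2 : ∀ l, ∑ i ∈ Q.cells (l + 1), ENNReal.ofReal (8 ^ p * wt l i.1) *
      (μ (Q.label (l + 1) ⁻¹' {i}) - ν (Q.label (l + 1) ⁻¹' {i})) ≤
        ENNReal.ofReal (16 ^ p * D (l + 1)) := by
    intro l
    rw [hD, Finset.mul_sum, ENNReal.ofReal_sum_of_nonneg
      (fun i _ => by have := hwt0 (l + 1) i.1; positivity)]
    refine Finset.sum_le_sum fun i _ => ?_
    rw [hsub, ← ENNReal.ofReal_mul (by have := hwt0 l i.1; positivity)]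
    refine ENNReal.ofReal_le_ofReal ?_
    -- The residual of level `l + 1` pays the weight of level `l`, which is `2 ^ p` times its own;
    -- this turns `8 ^ p` into `16 ^ p`.
    have e : (16 : ℝ) ^ p = 8 ^ p * 2 ^ p := by
      rw [← Real.mul_rpow (by norm_num) (by norm_num)]; norm_num
    rw [hwt, ringWeight_succ hR, e, ← mul_assoc, ← mul_assoc]
    exact mul_le_mul_of_nonneg_left (le_abs_self _)
      (by have := hwt0 (l + 1) i.1; positivity)
  have hT3 : ∑ i ∈ Q.cells 0, ENNReal.ofReal (wt 0 i.1) *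
      (μ (Q.label 0 ⁻¹' {i}) - ν (Q.label 0 ⁻¹' {i}) +
        (ν (Q.label 0 ⁻¹' {i}) - μ (Q.label 0 ⁻¹' {i}))) = ENNReal.ofReal (D 0) := by
    rw [hD, ENNReal.ofReal_sum_of_nonneg (fun i _ => by have := hwt0 0 i.1; positivity)]
    refine Finset.sum_congr rfl fun i _ => ?_
    rw [ENNReal.ofReal_mul (hwt0 _ _), hsub, hsub]
    congr 1
    rcases le_total (μ.real (Q.label 0 ⁻¹' {i})) (ν.real (Q.label 0 ⁻¹' {i})) with h | h
    · rw [ENNReal.ofReal_of_nonpos (sub_nonpos.2 h), zero_add, abs_of_nonpos (sub_nonpos.2 h),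
        neg_sub]
    · rw [ENNReal.ofReal_of_nonpos (sub_nonpos.2 h) (p := _ - _), add_zero,
        abs_of_nonneg (sub_nonneg.2 h)]
  rw [hT1, hT3, lintegral_indicator hout] at key
  set A := ∑ k ∈ Finset.range (J + 1), wt L k * ringMass μ x₀ R J k with hA
  have hA0 : 0 ≤ A := Finset.sum_nonneg fun k _ => mul_nonneg (hwt0 _ _) (ringMass_nonneg ..)
  have h2 : (2 : ℝ≥0∞) ^ (p - 1) ≤ ENNReal.ofReal (16 ^ p) := by
    have : (2 : ℝ≥0∞) ^ (p - 1) = ENNReal.ofReal (2 ^ (p - 1)) := by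
      rw [← ENNReal.ofReal_rpow_of_pos (by norm_num)]; norm_num
    rw [this]
    refine ENNReal.ofReal_le_ofReal ?_
    calc (2 : ℝ) ^ (p - 1) ≤ 2 ^ p := Real.rpow_le_rpow_of_exponent_le (by norm_num) (by linarith)
      _ ≤ 16 ^ p := Real.rpow_le_rpow (by norm_num) (by norm_num) hp0
  have h8 : (8 : ℝ) ^ p ≤ 16 ^ p := Real.rpow_le_rpow (by norm_num) (by norm_num) hp0
  have hdisc : Q.discrepancy p (fun l i => ν.real (Q.label l ⁻¹' {i})) =
      ∑ l ∈ Finset.range L, D (l + 1) + D 0 := by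
    rw [discrepancy, Finset.sum_range_succ']
  calc wassersteinPow p μ ν ≤ _ := key
    _ ≤ (ENNReal.ofReal (16 ^ p * A) + ∑ l ∈ Finset.range L, ENNReal.ofReal (16 ^ p * D (l + 1))) +
        ENNReal.ofReal (16 ^ p) * (ENNReal.ofReal (D 0) + ENNReal.ofReal m) := by
        refine add_le_add (add_le_add ?_ (Finset.sum_le_sum fun l _ => hT2 l))
          (mul_le_mul' h2 (add_le_add le_rfl hm))
        exact ENNReal.ofReal_le_ofReal (mul_le_mul_of_nonneg_right h8 hA0)
    _ = _ := by
        have h16 : (0 : ℝ) ≤ 16 ^ p := by positivity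
        have hs0 : 0 ≤ ∑ l ∈ Finset.range L, 16 ^ p * D (l + 1) :=
          Finset.sum_nonneg fun l _ => mul_nonneg h16 (hD0 _)
        rw [← ENNReal.ofReal_sum_of_nonneg (fun l _ => mul_nonneg h16 (hD0 _)),
          ← ENNReal.ofReal_add (hD0 0) hm0, ← ENNReal.ofReal_mul h16,
          ← ENNReal.ofReal_add (by positivity) hs0,
          ← ENNReal.ofReal_add (by positivity)
            (mul_nonneg h16 (add_nonneg (hD0 0) hm0)), hdisc, ← Finset.mul_sum]
        congr 1; ring

end RingPartition

end RingBound

/-! ### Empirical frequencies of an i.i.d. sample -/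

section Empirical

variable {Ω : Type v} [MeasurableSpace Ω] {P : Measure Ω} [IsProbabilityMeasure P]
  {E : Type u} [MeasurableSpace E] {μ : Measure E} [IsProbabilityMeasure μ] {n : ℕ}
  {X : Fin n → Ω → E}

theorem isProbabilityMeasure_empiricalMeasure (hn : 0 < n) (x : Fin n → E) :
    IsProbabilityMeasure (empiricalMeasure x) := by
  constructor
  rw [empiricalMeasure, Measure.smul_apply, Measure.finsetSum_apply]
  simp only [measure_univ, Finset.sum_const, Finset.card_univ, Fintype.card_fin, smul_eq_mul,
    nsmul_eq_mul, mul_one]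
  exact ENNReal.inv_mul_cancel (by exact_mod_cast hn.ne') (by simp)

theorem empiricalMeasure_real_apply (x : Fin n → E) {A : Set E} (hA : MeasurableSet A) :
    (empiricalMeasure x).real A = (∑ i, A.indicator (fun _ => (1 : ℝ)) (x i)) / n := by
  rw [Measure.real, empiricalMeasure, Measure.smul_apply, Measure.finsetSum_apply, smul_eq_mul,
    ENNReal.toReal_mul, ENNReal.toReal_inv, ENNReal.toReal_natCast, ENNReal.toReal_sum
      (fun i _ => measure_ne_top _ _), div_eq_inv_mul]
  congr 1
  refine Finset.sum_congr rfl fun i _ => ?_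
  rw [Measure.dirac_apply' _ hA]
  by_cases h : x i ∈ A <;> simp [h]

theorem ae_empiricalMeasure (hn : 0 < n) (x : Fin n → E) {A : Set E} (hA : MeasurableSet A)
    (h : ∀ i, x i ∈ A) : ∀ᵐ y ∂(empiricalMeasure x), y ∈ A := by
  have := isProbabilityMeasure_empiricalMeasure hn x
  refine (mem_ae_iff_prob_eq_one hA).2 ?_
  have h1 : (empiricalMeasure x).real A = 1 := by
    rw [empiricalMeasure_real_apply x hA]
    have hn' : (n : ℝ) ≠ 0 := by exact_mod_cast hn.ne'
    simp [h, hn']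
  rw [Measure.real] at h1
  rw [← ENNReal.ofReal_toReal (measure_ne_top (empiricalMeasure x) A), h1, ENNReal.ofReal_one]

omit [IsProbabilityMeasure P] [IsProbabilityMeasure μ] in
theorem IsIIDSample.integral_comp (hX : IsIIDSample X P μ) (i : Fin n) {f : E → ℝ}
    (hf : Measurable f) : ∫ ω, f (X i ω) ∂P = ∫ x, f x ∂μ := by
  rw [← hX.map_eq i, integral_map (hX.measurable i).aemeasurable hf.aestronglyMeasurable]

omit [IsProbabilityMeasure μ] in
-- The first bound comes from the variance of the frequency, at most `μ(A) / n`; the second is the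
-- triangle inequality and is better for cells of mass below order `1 / n`.
theorem IsIIDSample.integral_abs_freq_sub_le (hX : IsIIDSample X P μ) (hn : 0 < n) {A : Set E}
    (hA : MeasurableSet A) :
    ∫ ω, |μ.real A - (∑ i, A.indicator (fun _ => (1 : ℝ)) (X i ω)) / n| ∂P ≤
      min (√(μ.real A / n)) (2 * μ.real A) := by
  set a : E → ℝ := A.indicator fun _ => (1 : ℝ) with ha
  have ham : Measurable a := measurable_const.indicator hA
  have ha0 : ∀ x, 0 ≤ a x := fun x => Set.indicator_nonneg (fun _ _ => zero_le_one) x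
  have ha1 : ∀ x, a x ≤ 1 := fun x => Set.indicator_le_self' (fun _ _ => zero_le_one) x
  have haE : ∫ x, a x ∂μ = μ.real A := by
    rw [ha, integral_indicator hA]; simp
  have hn' : (0 : ℝ) < n := by exact_mod_cast hn
  set Y : Fin n → Ω → ℝ := fun i ω => a (X i ω) with hY
  have hYm : ∀ i, Measurable (Y i) := fun i => ham.comp (hX.measurable i)
  have hYL : ∀ i, MemLp (Y i) 2 P := fun i =>
    MemLp.of_bound (hYm i).aestronglyMeasurable 1
      (Filter.Eventually.of_forall fun ω => by
        rw [Real.norm_eq_abs, abs_of_nonneg (ha0 _)]; exact ha1 _)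
  have hYI : ∀ i, Integrable (Y i) P := fun i => (hYL i).integrable (by norm_num)
  have hYE : ∀ i, ∫ ω, Y i ω ∂P = μ.real A := fun i => by
    rw [← haE]; exact hX.integral_comp i ham
  set Z : Ω → ℝ := fun ω => μ.real A - (∑ i, Y i ω) / n with hZ
  have hZm : Measurable Z := (measurable_const).sub
    ((Finset.measurable_sum _ fun i _ => hYm i).div_const _)
  have hSI : Integrable (fun ω => ∑ i, Y i ω) P := integrable_finsetSum _ fun i _ => hYI i
  have hZI : Integrable Z P := (integrable_const _).sub (hSI.div_const _)
  have hSE : ∫ ω, ∑ i, Y i ω ∂P = n * μ.real A := by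
    rw [integral_finsetSum _ fun i _ => hYI i]
    simp [hYE]
  refine le_min ?_ ?_
  · change ∫ ω, |Z ω| ∂P ≤ _
    have hSL : MemLp (∑ i, Y i) 2 P := memLp_finsetSum' _ fun i _ => hYL i
    have hvar : variance (∑ i, Y i) P ≤ n * μ.real A := by
      rw [IndepFun.variance_sum (fun i _ => hYL i)]
      · calc ∑ i, variance (Y i) P ≤ ∑ _i : Fin n, μ.real A := by
              refine Finset.sum_le_sum fun i _ => ?_
              refine (variance_le_expectation_sq (hYm i).aestronglyMeasurable).trans ?_
              rw [← hYE i]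
              refine integral_mono (hYL i).integrable_sq (hYI i) fun ω => ?_
              have h0 := ha0 (X i ω); have h1 := ha1 (X i ω)
              simp only [Pi.pow_apply, hY]
              nlinarith
          _ = _ := by simp
      · intro i _ j _ hij
        exact (hX.indep.indepFun hij).comp ham ham
    have hZL : MemLp Z 2 P := by
      have h1 : MemLp (fun ω => (∑ i, Y i) ω / n) 2 P := by
        simpa [div_eq_mul_inv] using hSL.mul_const ((n : ℝ)⁻¹)
      have h2 := (memLp_const (μ.real A) (μ := P) (p := 2)).sub h1
      convert! h2 using 1
      ext ω; simp [hZ]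
    have hZ2 : ∫ ω, Z ω ^ 2 ∂P ≤ μ.real A / n := by
      have h1 : variance (∑ i, Y i) P = n ^ 2 * ∫ ω, Z ω ^ 2 ∂P := by
        rw [variance_eq_integral hSL.aemeasurable, ← integral_const_mul]
        refine integral_congr_ae (Filter.Eventually.of_forall fun ω => ?_)
        simp only [hZ, Finset.sum_apply, hSE]
        field_simp; ring
      rw [h1] at hvar
      rw [le_div_iff₀ hn']
      nlinarith
    -- Nonnegativity of this variance is the inequality `(∫ |Z|) ^ 2 ≤ ∫ Z ^ 2`.
    have h3 : 0 ≤ variance |Z| P := variance_nonneg _ _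
    rw [variance_eq_sub hZL.abs] at h3
    refine Real.le_sqrt_of_sq_le (le_trans ?_ hZ2)
    simp only [Pi.pow_apply, Pi.abs_apply, sq_abs] at h3
    linarith
  · calc ∫ ω, |Z ω| ∂P ≤ ∫ ω, (μ.real A + (∑ i, Y i ω) / n) ∂P := by
          refine integral_mono hZI.abs ((integrable_const _).add (hSI.div_const _)) fun ω => ?_
          have h1 : 0 ≤ (∑ i, Y i ω) / n :=
            div_nonneg (Finset.sum_nonneg fun i _ => ha0 _) hn'.le
          have h2 : 0 ≤ μ.real A := measureReal_nonneg
          simp only [hZ]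
          rw [abs_le]; constructor <;> linarith
      _ = 2 * μ.real A := by
          rw [integral_add (integrable_const _) (hSI.div_const _), integral_div, hSE]
          simp; field_simp; ring

end Empirical

/-! ### Mean of the multilevel discrepancy -/

section Discrepancy

variable {E : Type u} [MetricSpace E] [MeasurableSpace E] [BorelSpace E]

/-- Bound for the expected multilevel discrepancy of an empirical measure. -/
noncomputable def discrepancyBound (μ : Measure E) (x₀ : E) (p β R : ℝ) (J L n : ℕ) : ℝ :=
  ∑ l ∈ Finset.range (L + 1), ∑ k ∈ Finset.range (J + 1), ringWeight p R J l k *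
    min (√((β + 1) * 2 ^ (2 * p * l) * ringMass μ x₀ R J k / n)) (2 * ringMass μ x₀ R J k)

/-- Cauchy-Schwarz over the cells of one ring: only their number and the total mass of the ring
remain. -/
theorem sum_min_sqrt_le {ι : Type*} (s : Finset ι) (a : ι → ℝ) (ha : ∀ i ∈ s, 0 ≤ a i) {N b : ℝ}
    (hN : (s.card : ℝ) ≤ N) (hb : 0 ≤ b) :
    ∑ i ∈ s, min (√(a i / b)) (2 * a i) ≤
      min (√(N * (∑ i ∈ s, a i) / b)) (2 * ∑ i ∈ s, a i) := by
  refine le_min ?_ ?_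
  · refine (Finset.sum_le_sum fun i _ => min_le_left _ _).trans ?_
    refine Real.le_sqrt_of_sq_le (sq_sum_le_card_mul_sum_sq.trans ?_)
    have h1 : ∑ i ∈ s, √(a i / b) ^ 2 = (∑ i ∈ s, a i) / b := by
      rw [Finset.sum_div]
      exact Finset.sum_congr rfl fun i hi => Real.sq_sqrt (div_nonneg (ha i hi) hb)
    rw [h1, mul_div_assoc]
    exact mul_le_mul_of_nonneg_right hN (div_nonneg (Finset.sum_nonneg ha) hb)
  · rw [Finset.mul_sum]
    exact Finset.sum_le_sum fun i _ => min_le_right _ _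

namespace RingPartition

variable {Ω : Type v} [MeasurableSpace Ω] {P : Measure Ω} [IsProbabilityMeasure P]
  {μ : Measure E} [IsProbabilityMeasure μ] {n : ℕ} {X : Fin n → Ω → E}
  {x₀ : E} {R : ℝ} {J L : ℕ} {p β : ℝ}
  (Q : RingPartition μ x₀ R J L fun l => (β + 1) * 2 ^ (2 * p * l))

omit [BorelSpace E] in
theorem integral_discrepancy_le (hR : 0 < R) (hX : IsIIDSample X P μ)
    (hn : 0 < n) :
    ∫ ω, Q.discrepancy p (fun l i =>
      (∑ j, (Q.label l ⁻¹' {i}).indicator (fun _ => (1 : ℝ)) (X j ω)) / n) ∂P ≤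
      discrepancyBound μ x₀ p β R J L n := by
  classical
  have hm : ∀ l i, MeasurableSet (Q.label l ⁻¹' {i}) := fun l i =>
    Q.measurableSet_label_preimage l {i}
  have hI : ∀ l i, Integrable (fun ω => |μ.real (Q.label l ⁻¹' {i}) -
      (∑ j, (Q.label l ⁻¹' {i}).indicator (fun _ => (1 : ℝ)) (X j ω)) / n|) P := by
    intro l i
    refine ((integrable_const _).sub (Integrable.div_const
      (integrable_finsetSum _ fun j _ => ?_) _)).abs
    refine Integrable.of_bound ((measurable_const.indicator (hm l i)).comp
      (hX.measurable j)).aestronglyMeasurable 1 (Filter.Eventually.of_forall fun ω => ?_)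
    by_cases h : X j ω ∈ Q.label l ⁻¹' {i} <;> simp [Set.indicator, h]
  unfold discrepancy discrepancyBound
  rw [integral_finsetSum _ fun l _ => integrable_finsetSum _ fun i _ => (hI l i).const_mul _]
  refine Finset.sum_le_sum fun l hl => ?_
  have hlL : l ≤ L := by have := Finset.mem_range.1 hl; omega
  rw [integral_finsetSum _ fun i _ => (hI l i).const_mul _]
  calc _ ≤ ∑ i ∈ Q.cells l, ringWeight p R J l i.1 *
        min (√(μ.real (Q.label l ⁻¹' {i}) / n)) (2 * μ.real (Q.label l ⁻¹' {i})) := by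
        refine Finset.sum_le_sum fun i _ => ?_
        rw [integral_const_mul]
        exact mul_le_mul_of_nonneg_left (hX.integral_abs_freq_sub_le hn (hm l i))
          (ringWeight_nonneg hR _ _ _)
    _ ≤ _ := by
        rw [Q.sum_cells_eq l _ (fun i _ h => by simp [ringWeight, h])]
        refine Finset.sum_le_sum fun k hk => ?_
        have hkJ : k ≤ J := by have := Finset.mem_range.1 hk; omega
        have h1 : ∀ i ∈ (Q.cells l).filter (fun i => i.1 = k), ringWeight p R J l i.1 *
            min (√(μ.real (Q.label l ⁻¹' {i}) / n)) (2 * μ.real (Q.label l ⁻¹' {i})) =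
            ringWeight p R J l k *
            min (√(μ.real (Q.label l ⁻¹' {i}) / n)) (2 * μ.real (Q.label l ⁻¹' {i})) := by
          intro i hi
          rw [(Finset.mem_filter.1 hi).2]
        rw [Finset.sum_congr rfl h1, ← Finset.mul_sum, ← Q.sum_filter_cells l k]
        refine mul_le_mul_of_nonneg_left (sum_min_sqrt_le _ _ (fun i _ => measureReal_nonneg) ?_
          (Nat.cast_nonneg n)) (ringWeight_nonneg hR _ _ _)
        obtain ⟨C, hC, hCc⟩ := Q.card_le l hlL k hkJ
        refine le_trans ?_ hCc
        exact_mod_cast Finset.card_le_card fun i hi =>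
          hC i (Finset.mem_filter.1 hi).1 (Finset.mem_filter.1 hi).2

end RingPartition

/-- The weights decay at least like `2 ^ (-l)` because `p ≥ 1`. Hence one observation, which
occupies one cell per level, counts at most twice its level `0` weight. -/
theorem sum_ringWeight_le {p R : ℝ} (hp : 1 ≤ p) (hR : 0 < R) (J L k : ℕ) :
    ∑ l ∈ Finset.range L, ringWeight p R J l k ≤ 2 * ringWeight p R J 0 k := by
  have h : ∀ l, ringWeight p R J l k ≤ (1 / 2) ^ l * ringWeight p R J 0 k := by
    intro l
    induction l with
    | zero => simp
    | succ l ih =>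
      have h1 := ringWeight_succ (p := p) hR J l k
      have h2 : (2 : ℝ) ≤ 2 ^ p := by
        simpa using Real.rpow_le_rpow_of_exponent_le (x := 2) (by norm_num) hp
      have h3 := ringWeight_nonneg (p := p) hR J (l + 1) k
      rw [pow_succ]
      nlinarith
  calc _ ≤ ∑ l ∈ Finset.range L, (1 / 2 : ℝ) ^ l * ringWeight p R J 0 k :=
        Finset.sum_le_sum fun l _ => h l
    _ ≤ _ := by
        rw [← Finset.sum_mul]
        refine mul_le_mul_of_nonneg_right ?_ (ringWeight_nonneg hR _ _ _)
        have := summable_geometric_two.sum_le_tsum (Finset.range L) (fun i _ => by positivity)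
        rwa [tsum_geometric_two] at this

theorem ringWeight_zero_le {p R : ℝ} (hp : 0 ≤ p) (hR : 0 < R) (J k : ℕ) :
    ringWeight p R J 0 k ≤ R ^ p := by
  unfold ringWeight
  split_ifs
  · refine Real.rpow_le_rpow (by positivity) ?_ hp
    simp only [pow_zero, div_one]
    exact div_le_self hR.le (one_le_pow₀ (by norm_num))
  · positivity

end Discrepancy

/-! ### Deviation of the discrepancy and of the transport cost -/

section DeviationBound

variable {E : Type u} [MetricSpace E] [MeasurableSpace E] [BorelSpace E]

theorem integral_comp_ringIndex (μ : Measure E) [IsProbabilityMeasure μ] (x₀ : E) (R : ℝ) (J : ℕ)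
    (F : ℕ → ℝ) (hF : F (J + 1) = 0) :
    ∫ x, F (ringIndex x₀ R J x) ∂μ =
      ∑ k ∈ Finset.range (J + 1), F k * ringMass μ x₀ R J k := by
  have hm : ∀ k, MeasurableSet (ringIndex x₀ R J ⁻¹' {k}) := fun k =>
    measurable_ringIndex x₀ R J (measurableSet_singleton k)
  have h1 : ∀ x, F (ringIndex x₀ R J x) = ∑ k ∈ Finset.range (J + 2),
      (ringIndex x₀ R J ⁻¹' {k}).indicator (fun _ => F k) x := by
    intro x
    rw [Finset.sum_eq_single (ringIndex x₀ R J x)]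
    · simp
    · intro j _ hj; simp [Ne.symm hj]
    · intro h
      exact absurd (Finset.mem_range.2 (Nat.lt_succ_of_le (ringIndex_le_succ x₀ R J x))) h
  simp_rw [h1]
  rw [integral_finsetSum _ fun k _ => (integrable_const (F k)).indicator (hm k),
    Finset.sum_range_succ]
  have h2 : ∀ k, ∫ x, (ringIndex x₀ R J ⁻¹' {k}).indicator (fun _ => F k) x ∂μ =
      F k * ringMass μ x₀ R J k := by
    intro k
    rw [integral_indicator (hm k)]
    simp [ringMass, mul_comm]
  simp_rw [h2]
  rw [hF]; simp

variable {Ω : Type v} [MeasurableSpace Ω] {P : Measure Ω} [IsProbabilityMeasure P]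
  {μ : Measure E} [IsProbabilityMeasure μ] {n : ℕ} {X : Fin n → Ω → E} {x₀ : E}

omit [IsProbabilityMeasure P] [IsProbabilityMeasure μ] in
omit [MetricSpace E] [BorelSpace E] in
theorem IsIIDSample.measure_preimage (hX : IsIIDSample X P μ) (i : Fin n) {A : Set E}
    (hA : MeasurableSet A) : P.real (X i ⁻¹' A) = μ.real A := by
  rw [← hX.map_eq i, map_measureReal_apply (hX.measurable i) hA]

/-- An observation `x` is encoded as the vector `ψ x` of its cell indicators, so that the
discrepancy is a function of a sum of i.i.d. vectors. Its increments are bounded by a weighted `ℓ¹`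
norm `g`, and `g (ψ x)` depends on `x` only through its ring up to a constant factor: this gives
both the uniform bound `2 * R ^ p / n` and the second moment. -/
theorem RingPartition.measure_discrepancy_ge_le {R : ℝ} {J L : ℕ} {p β : ℝ}
    (Q : RingPartition μ x₀ R J L fun l => (β + 1) * 2 ^ (2 * p * l)) (hp : 1 ≤ p) (hR : 0 < R)
    (hX : IsIIDSample X P μ) (hn : 0 < n) {κ σ2 : ℝ} (hκ : 0 < κ) (hσ0 : 0 < σ2)
    (hσ : ∑ k ∈ Finset.range (J + 1), 4 * ringWeight p R J 0 k ^ 2 * ringMass μ x₀ R J k ≤ σ2) :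
    P.real {ω | discrepancyBound μ x₀ p β R J L n + 4 * κ * R ^ p / n ≤
      Q.discrepancy p (fun l i =>
        (∑ j, (Q.label l ⁻¹' {i}).indicator (fun _ => (1 : ℝ)) (X j ω)) / n)} ≤
      Real.exp (κ ^ 2) * (n * (σ2 / n ^ 2) / (4 * κ * R ^ p / n) ^ 2) ^ κ := by
  classical
  have hp0 : 0 ≤ p := by linarith
  have hn' : (0 : ℝ) < n := by exact_mod_cast hn
  have hw0 : ∀ l k, 0 ≤ ringWeight p R J l k := ringWeight_nonneg hR J
  have hm : ∀ l i, MeasurableSet (Q.label l ⁻¹' {i}) := fun l i =>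
    Q.measurableSet_label_preimage l {i}
  let ψ : E → ℕ → ℕ × E → ℝ := fun x l i => (Q.label l ⁻¹' {i}).indicator (fun _ => (1 : ℝ)) x
  have hψ : Measurable ψ := measurable_pi_lambda _ fun l => measurable_pi_lambda _ fun i =>
    measurable_const.indicator (hm l i)
  let h : (ℕ → ℕ × E → ℝ) → ℝ := fun z => Q.discrepancy p fun l i => z l i / n
  let g : (ℕ → ℕ × E → ℝ) → ℝ := fun z =>
    ∑ l ∈ Finset.range (L + 1), ∑ i ∈ Q.cells l, ringWeight p R J l i.1 * (|z l i| / n)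
  have hcoord : ∀ (l : ℕ) (i : ℕ × E), Measurable fun z : ℕ → ℕ × E → ℝ => z l i := fun l i =>
    (measurable_pi_apply i).comp (measurable_pi_apply l)
  have hhm : Measurable h := by
    refine Finset.measurable_sum _ fun l _ => Finset.measurable_sum _ fun i _ => ?_
    exact (((hcoord l i).div_const _).const_sub _).abs.const_mul _
  have hgm : Measurable g := by
    refine Finset.measurable_sum _ fun l _ => Finset.measurable_sum _ fun i _ => ?_
    exact ((hcoord l i).abs.div_const _).const_mul _
  have hlip : ∀ z v, |h (z + v) - h z| ≤ g v := by
    intro z v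
    simp only [h, g, RingPartition.discrepancy, ← Finset.sum_sub_distrib]
    refine (Finset.abs_sum_le_sum_abs _ _).trans (Finset.sum_le_sum fun l _ => ?_)
    refine (Finset.abs_sum_le_sum_abs _ _).trans (Finset.sum_le_sum fun i _ => ?_)
    rw [← mul_sub, abs_mul, abs_of_nonneg (hw0 _ _)]
    refine mul_le_mul_of_nonneg_left ?_ (hw0 _ _)
    refine (abs_abs_sub_abs_le_abs_sub _ _).trans (le_of_eq ?_)
    rw [Pi.add_apply, Pi.add_apply, add_div]
    rw [show ∀ a b c : ℝ, a - (b + c) - (a - b) = -c by intros; ring, abs_neg, abs_div,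
      abs_of_pos hn']
  have hgψ : ∀ x, g (ψ x) ≤ 2 * ringWeight p R J 0 (ringIndex x₀ R J x) / n := by
    intro x
    have h1 : ∀ l, ∑ i ∈ Q.cells l, ringWeight p R J l i.1 * (|ψ x l i| / n) =
        ringWeight p R J l (ringIndex x₀ R J x) / n := by
      intro l
      rw [Finset.sum_eq_single (Q.label l x)]
      · rw [Q.label_fst]; simp [ψ]; rfl
      · intro i _ hi; simp [ψ, Ne.symm hi]
      · intro hh; exact absurd (Q.label_mem l x) hh
    simp only [g, h1]
    rw [← Finset.sum_div]
    exact div_le_div_of_nonneg_right (sum_ringWeight_le hp hR _ _ _) hn'.le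
  have hg0 : ∀ z, 0 ≤ g z := fun z => Finset.sum_nonneg fun l _ => Finset.sum_nonneg fun i _ =>
    mul_nonneg (hw0 _ _) (by positivity)
  set ν := μ.map ψ with hν
  have : IsProbabilityMeasure ν := Measure.isProbabilityMeasure_map hψ.aemeasurable
  have hξ : ∀ j, Measurable fun ω => ψ (X j ω) := fun j => hψ.comp (hX.measurable j)
  have hξν : ∀ j, P.map (fun ω => ψ (X j ω)) = ν := by
    intro j
    rw [hν, ← hX.map_eq j, Measure.map_map hψ (hX.measurable j)]; rfl
  have hind : iIndepFun (fun j ω => ψ (X j ω)) P := hX.indep.comp (fun _ => ψ) fun _ => hψ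
  have hgM : ∀ᵐ v ∂ν, g v ≤ 2 * R ^ p / n := by
    rw [hν, ae_map_iff hψ.aemeasurable (measurableSet_le hgm measurable_const)]
    refine Filter.Eventually.of_forall fun x => (hgψ x).trans ?_
    have := ringWeight_zero_le hp0 hR J (ringIndex x₀ R J x)
    gcongr
  have hgσ : ∫ v, g v ^ 2 ∂ν ≤ σ2 / n ^ 2 := by
    rw [hν, integral_map hψ.aemeasurable (hgm.pow_const 2).aestronglyMeasurable]
    have h2 : ∫ x, 4 * ringWeight p R J 0 (ringIndex x₀ R J x) ^ 2 ∂μ ≤ σ2 := by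
      rw [integral_comp_ringIndex μ x₀ R J (fun k => 4 * ringWeight p R J 0 k ^ 2)
        (by simp [ringWeight])]
      exact hσ
    have hbd : ∀ x, g (ψ x) ^ 2 ≤
        (4 * ringWeight p R J 0 (ringIndex x₀ R J x) ^ 2) / n ^ 2 := by
      intro x
      have := pow_le_pow_left₀ (hg0 _) (hgψ x) 2
      refine this.trans (le_of_eq ?_)
      rw [div_pow, mul_pow]; norm_num
    have hi : Integrable
        (fun x => (4 * ringWeight p R J 0 (ringIndex x₀ R J x) ^ 2) / (n : ℝ) ^ 2) μ := by
      have hmr : Measurable fun x => (4 * ringWeight p R J 0 (ringIndex x₀ R J x) ^ 2) / (n : ℝ) ^ 2 :=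
        (measurable_from_top (f := fun k : ℕ => (4 * ringWeight p R J 0 k ^ 2) / (n : ℝ) ^ 2)).comp
          (measurable_ringIndex x₀ R J)
      refine Integrable.of_bound hmr.aestronglyMeasurable (4 * (R ^ p) ^ 2 / n ^ 2)
        (Filter.Eventually.of_forall fun x => ?_)
      have h0 := hw0 0 (ringIndex x₀ R J x)
      have h1 := ringWeight_zero_le hp0 hR J (ringIndex x₀ R J x)
      rw [Real.norm_eq_abs, abs_of_nonneg (by positivity)]
      gcongr
    calc _ ≤ ∫ x, (4 * ringWeight p R J 0 (ringIndex x₀ R J x) ^ 2) / (n : ℝ) ^ 2 ∂μ := by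
          refine integral_mono_of_nonneg (Filter.Eventually.of_forall fun x => sq_nonneg _) hi
            (Filter.Eventually.of_forall hbd)
      _ ≤ _ := by
          rw [integral_div]
          gcongr
  have hconc := measure_lipschitz_sum_ge_le (P := P) hn hξ hξν hind hgm (M := 2 * R ^ p / n)
    (by positivity) hκ (by positivity) hgM hgσ hhm hlip
  have hsum : ∀ ω, h (∑ j, ψ (X j ω)) = Q.discrepancy p (fun l i =>
      (∑ j, (Q.label l ⁻¹' {i}).indicator (fun _ => (1 : ℝ)) (X j ω)) / n) := by
    intro ω
    simp only [h, Finset.sum_apply, ψ]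
  simp only [hsum] at hconc
  have e1 : κ * (2 * (2 * R ^ p / n)) = 4 * κ * R ^ p / n := by ring
  rw [e1] at hconc
  refine le_trans (measureReal_mono fun ω hω => ?_) hconc
  have hE := Q.integral_discrepancy_le (p := p) hR hX hn
  exact le_trans (add_le_add hE le_rfl) hω

/-- Deviation bound for the Wasserstein distance in terms of the masses of the dyadic rings. -/
theorem measure_wassersteinPow_gt_le {S : Set E} {p β : ℝ} (hp : 1 ≤ p) (hβ : 0 < β)
    (hS : HasCoveringDim x₀ S (2 * p) β) (hμ : μ S = 1) (hX : IsIIDSample X P μ) (hn : 0 < n)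
    {x κ R m σ2 : ℝ} (hx : 0 < x) (hκ : 0 < κ) (hR : 0 < R)
    (hRp : R ^ p = n * (x / 16 ^ p) / (16 * κ)) (J L : ℕ) (hm0 : 0 ≤ m)
    (hm : ∫⁻ y in {y | R < dist y x₀}, edist x₀ y ^ p ∂μ ≤ ENNReal.ofReal m)
    (hmx : m ≤ x / 16 ^ p / 4)
    (hL : ∑ k ∈ Finset.range (J + 1), ringWeight p R J L k * ringMass μ x₀ R J k ≤
      x / 16 ^ p / 4)
    (hB : discrepancyBound μ x₀ p β R J L n ≤ x / 16 ^ p / 4) (hσ0 : 0 < σ2)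
    (hσ : ∑ k ∈ Finset.range (J + 1), 4 * ringWeight p R J 0 k ^ 2 * ringMass μ x₀ R J k ≤ σ2) :
    P.real {ω | ENNReal.ofReal x < wassersteinPow p μ (empiricalMeasure fun i => X i ω)} ≤
      n * tailFun x₀ μ R + Real.exp (κ ^ 2) * (16 * σ2 / (n * (x / 16 ^ p) ^ 2)) ^ κ := by
  have hn' : (0 : ℝ) < n := by exact_mod_cast hn
  obtain ⟨Q⟩ := hS.nonempty_ringPartition (by linarith) hβ μ hμ hR J L
  have h16 : (0 : ℝ) < 16 ^ p := by positivity
  set y := x / 16 ^ p with hy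
  have hy0 : 0 < y := div_pos hx h16
  have hxy : x = 16 ^ p * y := by rw [hy]; field_simp
  set A : Set Ω := {ω | discrepancyBound μ x₀ p β R J L n + 4 * κ * R ^ p / n ≤
      Q.discrepancy p (fun l i =>
        (∑ j, (Q.label l ⁻¹' {i}).indicator (fun _ => (1 : ℝ)) (X j ω)) / n)} with hA
  -- The radius is chosen so that the deviation takes one quarter of `y`; the outer moment, the
  -- finest level and the mean discrepancy take the other three.
  have ht : 4 * κ * R ^ p / n = y / 4 := by rw [hRp]; field_simp; ring
  have hAP := Q.measure_discrepancy_ge_le hp hR hX hn hκ hσ0 hσ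
  rw [← hA, ht] at hAP
  have e1 : (n : ℝ) * (σ2 / n ^ 2) / (y / 4) ^ 2 = 16 * σ2 / (n * y ^ 2) := by
    field_simp; ring
  rw [e1] at hAP
  -- If all observations lie in the ball and in the core and the discrepancy is below its threshold,
  -- the transport bound contradicts a cost above `x`.
  have hsub : {ω | ENNReal.ofReal x < wassersteinPow p μ (empiricalMeasure fun i => X i ω)} ⊆
      ((⋃ i, X i ⁻¹' (Metric.closedBall x₀ R)ᶜ) ∪ ⋃ i, X i ⁻¹' Q.coreᶜ) ∪ A := by
    intro ω hω
    by_contra hcon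
    simp only [Set.mem_union, Set.mem_iUnion, Set.mem_preimage, Set.mem_compl_iff, not_or,
      not_exists, not_not] at hcon
    obtain ⟨⟨h1, h2⟩, h3⟩ := hcon
    have := isProbabilityMeasure_empiricalMeasure hn fun i => X i ω
    have hW := Q.wassersteinPow_le (p := p) hp hR (empiricalMeasure fun i => X i ω)
      (ae_empiricalMeasure hn _ Q.measurableSet_core h2)
      (ae_empiricalMeasure hn _ Metric.isClosed_closedBall.measurableSet h1) hm0 hm
    have h4 := lt_of_lt_of_le hω hW
    rw [ENNReal.ofReal_lt_ofReal_iff_of_nonneg hx.le, hxy, mul_lt_mul_iff_right₀ h16] at h4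
    refine h3 ?_
    rw [hA, Set.mem_ofPred_eq, ht]
    simp only [empiricalMeasure_real_apply _ (Q.measurableSet_label_preimage _ _)] at h4
    linarith
  have hcore : μ.real Q.coreᶜ = 0 := by
    rw [Measure.real, (mem_ae_iff.1 Q.ae_mem_core : μ Q.coreᶜ = 0), ENNReal.toReal_zero]
  have hball : MeasurableSet (Metric.closedBall x₀ R)ᶜ :=
    Metric.isClosed_closedBall.measurableSet.compl
  calc _ ≤ P.real (((⋃ i, X i ⁻¹' (Metric.closedBall x₀ R)ᶜ) ∪ ⋃ i, X i ⁻¹' Q.coreᶜ) ∪ A) :=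
        measureReal_mono hsub
    _ ≤ (P.real (⋃ i, X i ⁻¹' (Metric.closedBall x₀ R)ᶜ) + P.real (⋃ i, X i ⁻¹' Q.coreᶜ)) +
        P.real A := (measureReal_union_le _ _).trans
          (add_le_add (measureReal_union_le _ _) le_rfl)
    _ ≤ (∑ i : Fin n, P.real (X i ⁻¹' (Metric.closedBall x₀ R)ᶜ) +
        ∑ i : Fin n, P.real (X i ⁻¹' Q.coreᶜ)) + P.real A := by
        gcongr <;> exact measureReal_iUnion_fintype_le _
    _ = n * tailFun x₀ μ R + P.real A := by
        simp only [hX.measure_preimage _ hball, hX.measure_preimage _ Q.measurableSet_core.compl,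
          hcore, tailFun]
        simp
    _ ≤ _ := by gcongr

end DeviationBound

/-! ### Moment inequalities for the tail function -/

section Moments

variable {E : Type u} [MetricSpace E] [MeasurableSpace E] [BorelSpace E]
  (x₀ : E) (μ : Measure E) [IsProbabilityMeasure μ]

omit [BorelSpace E] [IsProbabilityMeasure μ] in
theorem tailFun_nonneg (t : ℝ) : 0 ≤ tailFun x₀ μ t := measureReal_nonneg

omit [BorelSpace E] in
theorem tailFun_le_one (t : ℝ) : tailFun x₀ μ t ≤ 1 := measureReal_le_one

omit [BorelSpace E] in
theorem tailFun_antitone : Antitone (tailFun x₀ μ) := fun _ _ h =>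
  measureReal_mono (Set.compl_subset_compl.2 (Metric.closedBall_subset_closedBall h))

omit [BorelSpace E] in
theorem measure_lt_dist (t : ℝ) :
    μ {y | t < dist y x₀} = ENNReal.ofReal (tailFun x₀ μ t) := by
  have : {y | t < dist y x₀} = (Metric.closedBall x₀ t)ᶜ := by ext; simp
  rw [this, tailFun, ofReal_measureReal]

theorem distMomentPow_eq {s : ℝ} (hs : 0 < s) :
    distMomentPow x₀ μ s = ENNReal.ofReal s *
      ∫⁻ t in Set.Ioi (0 : ℝ), ENNReal.ofReal (tailFun x₀ μ t) * ENNReal.ofReal (t ^ (s - 1)) := by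
  have h := lintegral_rpow_eq_lintegral_meas_lt_mul μ (f := fun y => dist y x₀)
    (Filter.Eventually.of_forall fun _ => dist_nonneg)
    (continuous_id.dist continuous_const).measurable.aemeasurable hs
  simp_rw [measure_lt_dist] at h
  rw [← h, distMomentPow]
  refine lintegral_congr fun y => ?_
  rw [edist_comm, edist_dist, ENNReal.ofReal_rpow_of_nonneg dist_nonneg hs.le]

theorem lintegral_Ioc_rpow {p t : ℝ} (hp : 0 < p) (ht : 0 ≤ t) :
    ∫⁻ s in Set.Ioc (0 : ℝ) t, ENNReal.ofReal (s ^ (p - 1)) = ENNReal.ofReal (t ^ p / p) := by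
  have hint : IntervalIntegrable (fun s : ℝ => s ^ (p - 1)) volume 0 t :=
    intervalIntegral.intervalIntegrable_rpow' (by linarith)
  rw [← ofReal_integral_eq_lintegral_ofReal]
  · rw [← intervalIntegral.integral_of_le ht, integral_rpow (Or.inl (by linarith))]
    simp [Real.zero_rpow hp.ne']
  · rwa [intervalIntegrable_iff_integrableOn_Ioc_of_le ht] at hint
  · filter_upwards [self_mem_ae_restrict measurableSet_Ioc] with s hs
    exact Real.rpow_nonneg hs.1.le _

omit [BorelSpace E] in
-- The integrand's factor `√H` is nonincreasing, so the integral over `(0, t]` is at least `√(H(t))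
-- * t ^ p / p`.
theorem rpow_mul_sqrt_tailFun_le {p t : ℝ} (hp : 0 < p) (ht : 0 ≤ t)
    (hI : sqrtTailIntegral x₀ μ p < ∞) :
    t ^ p * √(tailFun x₀ μ t) ≤ p * (sqrtTailIntegral x₀ μ p).toReal := by
  have h1 : ENNReal.ofReal (√(tailFun x₀ μ t)) * ENNReal.ofReal (t ^ p / p) ≤
      sqrtTailIntegral x₀ μ p := by
    rw [← lintegral_Ioc_rpow hp ht, ← lintegral_const_mul' _ _ ENNReal.ofReal_ne_top,
      sqrtTailIntegral]
    refine le_trans (setLIntegral_mono' measurableSet_Ioc fun s hs => ?_)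
      (lintegral_mono_set (fun s hs => hs.1))
    rw [← ENNReal.ofReal_mul (Real.sqrt_nonneg _)]
    refine ENNReal.ofReal_le_ofReal (mul_le_mul_of_nonneg_right ?_ (Real.rpow_nonneg hs.1.le _))
    exact Real.sqrt_le_sqrt (tailFun_antitone x₀ μ hs.2)
  rw [← ENNReal.ofReal_mul (Real.sqrt_nonneg _), ← ENNReal.ofReal_toReal hI.ne,
    ENNReal.ofReal_le_ofReal_iff ENNReal.toReal_nonneg] at h1
  rw [mul_div_assoc', div_le_iff₀ hp] at h1
  linarith

/-- Layer-cake formula together with `H ≤ √H`, valid because `H ≤ 1`. -/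
theorem distMomentPow_le {p : ℝ} (hp : 0 < p) :
    distMomentPow x₀ μ p ≤ ENNReal.ofReal p * sqrtTailIntegral x₀ μ p := by
  rw [distMomentPow_eq x₀ μ hp, sqrtTailIntegral]
  refine mul_le_mul_right (setLIntegral_mono' measurableSet_Ioi fun t ht => ?_) _
  rw [← ENNReal.ofReal_mul (tailFun_nonneg _ _ _)]
  refine ENNReal.ofReal_le_ofReal (mul_le_mul_of_nonneg_right ?_ (Real.rpow_nonneg (le_of_lt ht) _))
  refine Real.le_sqrt_of_sq_le ?_
  nlinarith [tailFun_nonneg x₀ μ t, tailFun_le_one x₀ μ t]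

/-- Write `H(t) t ^ (2p - 1)` as `(t ^ p √H(t)) * (√H(t) t ^ (p - 1))`: the first factor is at most
`p I` and the second integrates to `I`. This controls the variance by `I ^ 2`. -/
theorem distMomentPow_two_mul_le {p : ℝ} (hp : 0 < p) (hI : sqrtTailIntegral x₀ μ p < ∞) :
    distMomentPow x₀ μ (2 * p) ≤
      ENNReal.ofReal (2 * p ^ 2 * (sqrtTailIntegral x₀ μ p).toReal ^ 2) := by
  set I := (sqrtTailIntegral x₀ μ p).toReal with hI'
  have hI0 : 0 ≤ I := ENNReal.toReal_nonneg
  have h1 : ∫⁻ t in Set.Ioi (0 : ℝ), ENNReal.ofReal (tailFun x₀ μ t) *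
      ENNReal.ofReal (t ^ (2 * p - 1)) ≤ ENNReal.ofReal (p * I) * sqrtTailIntegral x₀ μ p := by
    rw [sqrtTailIntegral, ← lintegral_const_mul' _ _ ENNReal.ofReal_ne_top]
    refine setLIntegral_mono' measurableSet_Ioi fun t ht => ?_
    have ht0 : (0 : ℝ) < t := ht
    rw [← ENNReal.ofReal_mul (tailFun_nonneg _ _ _), ← ENNReal.ofReal_mul (by positivity)]
    refine ENNReal.ofReal_le_ofReal ?_
    have h2 := rpow_mul_sqrt_tailFun_le x₀ μ hp ht0.le hI
    have h3 : tailFun x₀ μ t * t ^ (2 * p - 1) =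
        t ^ p * √(tailFun x₀ μ t) * (√(tailFun x₀ μ t) * t ^ (p - 1)) := by
      have : t ^ (2 * p - 1) = t ^ p * t ^ (p - 1) := by
        rw [← Real.rpow_add ht0]; ring_nf
      rw [this]
      nth_rewrite 1 [← Real.mul_self_sqrt (tailFun_nonneg x₀ μ t)]
      ring
    rw [h3]
    exact mul_le_mul_of_nonneg_right h2 (by positivity)
  rw [distMomentPow_eq x₀ μ (by linarith : 0 < 2 * p)]
  refine (mul_le_mul_right h1 _).trans (le_of_eq ?_)
  rw [← ENNReal.ofReal_toReal hI.ne, ← hI', ← ENNReal.ofReal_mul (by positivity),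
    ← ENNReal.ofReal_mul (by positivity)]
  congr 1; ring

omit [BorelSpace E] in
-- Riemann-sum comparison on the disjoint intervals `(R / 2 ^ (k + 2), R / 2 ^ (k + 1)]`. The factor
-- `4 ^ p` arises because `R / 2 ^ k` is four times the left endpoint.
theorem sum_rpow_mul_sqrt_tailFun_le {p R : ℝ} (hp : 1 ≤ p) (hR : 0 < R)
    (hI : sqrtTailIntegral x₀ μ p < ∞) (J : ℕ) :
    ∑ k ∈ Finset.range J, (R / 2 ^ k) ^ p * √(tailFun x₀ μ (R / 2 ^ (k + 1))) ≤
      4 ^ p * (sqrtTailIntegral x₀ μ p).toReal := by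
  set a : ℕ → ℝ := fun k => R / 2 ^ (k + 1) with ha
  have ha0 : ∀ k, 0 < a k := fun k => by positivity
  have hs : ∀ k, a k = 2 * a (k + 1) := fun k => by
    simp only [ha]; rw [pow_succ _ (k + 1)]; field_simp
  have hanti : Antitone a := antitone_nat_of_succ_le fun k => by
    have := hs k; have := ha0 (k + 1); linarith
  have hdisj := hanti.pairwise_disjoint_on_Ioc_succ
  set φ : ℝ → ℝ≥0∞ := fun t => ENNReal.ofReal (√(tailFun x₀ μ t) * t ^ (p - 1)) with hφ
  have hk : ∀ k, ENNReal.ofReal ((R / 2 ^ k) ^ p * √(tailFun x₀ μ (R / 2 ^ (k + 1))) / 4 ^ p) ≤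
      ∫⁻ t in Set.Ioc (a (Order.succ k)) (a k), φ t := by
    intro k
    rw [Order.succ_eq_add_one]
    have hb := ha0 (k + 1)
    have e1 : R / 2 ^ k = 4 * a (k + 1) := by
      simp only [ha]; rw [pow_succ _ (k + 1), pow_succ]; field_simp; ring
    have e2 : R / 2 ^ (k + 1) = 2 * a (k + 1) := hs k
    rw [hs k, e1, e2]
    set b := a (k + 1)
    calc _ = ∫⁻ t in Set.Ioc b (2 * b), ENNReal.ofReal (√(tailFun x₀ μ (2 * b)) * b ^ (p - 1)) := by
          rw [setLIntegral_const, Real.volume_Ioc, ← ENNReal.ofReal_mul (by positivity)]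
          congr 1
          have : b ^ (p - 1) * b = b ^ p := by
            rw [← Real.rpow_add_one hb.ne']; ring_nf
          rw [Real.mul_rpow (by norm_num) hb.le, ← this]
          field_simp; ring
      _ ≤ _ := by
          refine setLIntegral_mono' measurableSet_Ioc fun t ht => ENNReal.ofReal_le_ofReal ?_
          exact mul_le_mul (Real.sqrt_le_sqrt (tailFun_antitone x₀ μ ht.2))
            (Real.rpow_le_rpow hb.le ht.1.le (by linarith)) (by positivity) (by positivity)
  have hsum : ∑ k ∈ Finset.range J,
      ENNReal.ofReal ((R / 2 ^ k) ^ p * √(tailFun x₀ μ (R / 2 ^ (k + 1))) / 4 ^ p) ≤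
      sqrtTailIntegral x₀ μ p := by
    refine (Finset.sum_le_sum fun k _ => hk k).trans ?_
    rw [← lintegral_biUnion_finset (fun i _ j _ hij => hdisj hij) (fun _ _ => measurableSet_Ioc)]
    refine lintegral_mono_set fun t ht => ?_
    obtain ⟨k, _, hkt⟩ := Set.mem_iUnion₂.1 ht
    exact (ha0 _).trans hkt.1
  rw [← ENNReal.ofReal_sum_of_nonneg (fun k _ => by positivity), ← ENNReal.ofReal_toReal hI.ne,
    ENNReal.ofReal_le_ofReal_iff ENNReal.toReal_nonneg, ← Finset.sum_div,
    div_le_iff₀ (by positivity)] at hsum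
  linarith

omit [BorelSpace E] [IsProbabilityMeasure μ] in
theorem tailFun_le_of_weakMomentPow {q t : ℝ} (ht : 0 ≤ t) (hw : weakMomentPow x₀ μ q < ∞) :
    t ^ q * tailFun x₀ μ t ≤ (weakMomentPow x₀ μ q).toReal := by
  have h : ENNReal.ofReal (t ^ q * tailFun x₀ μ t) ≤ weakMomentPow x₀ μ q :=
    le_iSup₂ (f := fun (t : ℝ) (_ : 0 ≤ t) => ENNReal.ofReal (t ^ q * tailFun x₀ μ t)) t ht
  rw [← ENNReal.ofReal_toReal hw.ne] at h
  exact (ENNReal.ofReal_le_ofReal_iff ENNReal.toReal_nonneg).1 h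

omit [BorelSpace E] in
-- Near `0` one uses `H ≤ 1`; at infinity `√H` decays like `t ^ (-q / 2)`, and `q / 2 > p`.
theorem sqrtTailIntegral_lt_top {p q : ℝ} (hp : 0 < p) (hq : 2 * p < q)
    (hw : weakMomentPow x₀ μ q < ∞) : sqrtTailIntegral x₀ μ p < ∞ := by
  set w := (weakMomentPow x₀ μ q).toReal with hw'
  have hw0 : 0 ≤ w := ENNReal.toReal_nonneg
  have hsplit : Set.Ioi (0 : ℝ) = Set.Ioc 0 1 ∪ Set.Ioi 1 :=
    (Set.Ioc_union_Ioi_eq_Ioi zero_le_one).symm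
  rw [sqrtTailIntegral, hsplit]
  refine lt_of_le_of_lt (lintegral_union_le _ _ _) (ENNReal.add_lt_top.2 ⟨?_, ?_⟩)
  · refine lt_of_le_of_lt (setLIntegral_mono' measurableSet_Ioc (g := fun t =>
      ENNReal.ofReal (t ^ (p - 1))) fun t ht => ENNReal.ofReal_le_ofReal ?_) ?_
    · refine mul_le_of_le_one_left (Real.rpow_nonneg ht.1.le _) ?_
      exact Real.sqrt_le_one.2 (tailFun_le_one x₀ μ t)
    · rw [lintegral_Ioc_rpow hp zero_le_one]; exact ENNReal.ofReal_lt_top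
  · have hint : IntegrableOn (fun t : ℝ => √w * t ^ (p - 1 - q / 2)) (Set.Ioi 1) :=
      (integrableOn_Ioi_rpow_of_lt (by linarith) zero_lt_one).const_mul _
    refine lt_of_le_of_lt (setLIntegral_mono' measurableSet_Ioi (g := fun t =>
      ENNReal.ofReal (√w * t ^ (p - 1 - q / 2))) fun t ht => ENNReal.ofReal_le_ofReal ?_) ?_
    · have ht0 : (0 : ℝ) < t := zero_lt_one.trans ht
      have h1 := tailFun_le_of_weakMomentPow x₀ μ ht0.le hw
      have h2 : √(tailFun x₀ μ t) ≤ √w * t ^ (-(q / 2)) := by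
        rw [Real.sqrt_le_left (by positivity), mul_pow, Real.sq_sqrt hw0, ← Real.rpow_natCast,
          ← Real.rpow_mul ht0.le]
        have : -(q / 2) * ((2 : ℕ) : ℝ) = -q := by push_cast; ring
        rw [this, Real.rpow_neg ht0.le, ← div_eq_mul_inv, le_div_iff₀ (by positivity)]
        linarith
      calc _ ≤ √w * t ^ (-(q / 2)) * t ^ (p - 1) := by gcongr
        _ = _ := by rw [mul_assoc, ← Real.rpow_add ht0]; ring_nf
    · exact hint.setLIntegral_lt_top

/-- Layer-cake formula for `μ` restricted to the exterior: levels below `R` see the constant mass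
`H(R)`, levels above see `H(t)`. The two contributions add up to `1 + p / (q - p) = q / (q - p)`. -/
theorem lintegral_lt_dist_le {p q R w : ℝ} (hp : 0 < p) (hq : p < q) (hR : 0 < R) (hw : 0 ≤ w)
    (h : ∀ t, 0 < t → t ^ q * tailFun x₀ μ t ≤ w) :
    ∫⁻ y in {y | R < dist y x₀}, edist x₀ y ^ p ∂μ ≤
      ENNReal.ofReal (q / (q - p) * w * R ^ (p - q)) := by
  have hqp : 0 < q - p := by linarith
  have ht : ∀ t, 0 < t → tailFun x₀ μ t ≤ w * t ^ (-q) := by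
    intro t ht
    rw [Real.rpow_neg ht.le, ← div_eq_mul_inv, le_div_iff₀ (by positivity)]
    linarith [h t ht]
  set μR := μ.restrict {y | R < dist y x₀} with hμR
  have hl := lintegral_rpow_eq_lintegral_meas_lt_mul μR (f := fun y => dist y x₀)
    (Filter.Eventually.of_forall fun _ => dist_nonneg)
    (continuous_id.dist continuous_const).measurable.aemeasurable hp
  have he : ∫⁻ y in {y | R < dist y x₀}, edist x₀ y ^ p ∂μ =
      ∫⁻ y, ENNReal.ofReal (dist y x₀ ^ p) ∂μR := by
    refine lintegral_congr fun y => ?_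
    rw [edist_comm, edist_dist, ENNReal.ofReal_rpow_of_nonneg dist_nonneg hp.le]
  rw [he, hl, ← Set.Ioc_union_Ioi_eq_Ioi hR.le]
  have hmeas : ∀ t : ℝ, MeasurableSet {y : E | t < dist y x₀} := fun t =>
    (isOpen_lt continuous_const (continuous_id.dist continuous_const)).measurableSet
  have h1 : ∫⁻ t in Set.Ioc 0 R, μR {a | t < dist a x₀} * ENNReal.ofReal (t ^ (p - 1)) ≤
      ENNReal.ofReal (w * R ^ (-q) * (R ^ p / p)) := by
    rw [ENNReal.ofReal_mul (by positivity), ← lintegral_Ioc_rpow hp hR.le,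
      ← lintegral_const_mul' _ _ ENNReal.ofReal_ne_top]
    refine setLIntegral_mono' measurableSet_Ioc fun t _ => mul_le_mul_left ?_ _
    calc μR {a | t < dist a x₀} ≤ μR Set.univ := measure_mono (Set.subset_univ _)
      _ = ENNReal.ofReal (tailFun x₀ μ R) := by
          rw [hμR, Measure.restrict_apply_univ, measure_lt_dist]
      _ ≤ _ := ENNReal.ofReal_le_ofReal (ht R hR)
  have h2 : ∫⁻ t in Set.Ioi R, μR {a | t < dist a x₀} * ENNReal.ofReal (t ^ (p - 1)) ≤
      ENNReal.ofReal (w * (R ^ (p - q) / (q - p))) := by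
    have hint : IntegrableOn (fun t : ℝ => t ^ (p - 1 - q)) (Set.Ioi R) :=
      integrableOn_Ioi_rpow_of_lt (by linarith) hR
    have hv : ∫ t in Set.Ioi R, t ^ (p - 1 - q) = R ^ (p - q) / (q - p) := by
      rw [integral_Ioi_rpow_of_lt (by linarith) hR]
      have : p - 1 - q + 1 = -(q - p) := by ring
      rw [this, div_neg, neg_div, neg_neg, neg_sub]
    rw [← hv, ← integral_const_mul, ofReal_integral_eq_lintegral_ofReal (hint.const_mul w)
      (by filter_upwards [self_mem_ae_restrict measurableSet_Ioi] with t ht'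
          exact mul_nonneg hw (Real.rpow_nonneg (hR.trans ht').le _))]
    refine setLIntegral_mono' measurableSet_Ioi fun t ht' => ?_
    have ht0 : 0 < t := hR.trans ht'
    calc _ ≤ ENNReal.ofReal (w * t ^ (-q)) * ENNReal.ofReal (t ^ (p - 1)) := by
          refine mul_le_mul_left ?_ _
          refine (Measure.restrict_apply_le _ _).trans ?_
          rw [measure_lt_dist]
          exact ENNReal.ofReal_le_ofReal (ht t ht0)
      _ = _ := by
          rw [← ENNReal.ofReal_mul (by positivity), mul_assoc, ← Real.rpow_add ht0]
          ring_nf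
  refine (mul_le_mul_right ((lintegral_union_le _ _ _).trans (add_le_add h1 h2)) _).trans ?_
  rw [← ENNReal.ofReal_add (by positivity) (by positivity), ← ENNReal.ofReal_mul hp.le]
  refine ENNReal.ofReal_le_ofReal (le_of_eq ?_)
  have : R ^ (-q) * R ^ p = R ^ (p - q) := by rw [← Real.rpow_add hR]; ring_nf
  calc p * (w * R ^ (-q) * (R ^ p / p) + w * (R ^ (p - q) / (q - p)))
      = w * (R ^ (-q) * R ^ p) + p * w * R ^ (p - q) / (q - p) := by field_simp
    _ = _ := by rw [this]; field_simp; ring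

omit [BorelSpace E] in
theorem ringMass_le_tailFun {R : ℝ} {J k : ℕ} (hk : k < J) :
    ringMass μ x₀ R J k ≤ tailFun x₀ μ (R / 2 ^ (k + 1)) := by
  refine measureReal_mono fun x hx => ?_
  have hx' : ringIndex x₀ R J x = k := hx
  have := lt_dist_of_ringIndex_lt (x₀ := x₀) (R := R) (J := J) (x := x) (hx' ▸ hk)
  rw [hx'] at this
  simpa using this

omit [BorelSpace E] in
theorem ringMass_le_one (R : ℝ) (J k : ℕ) : ringMass μ x₀ R J k ≤ 1 := measureReal_le_one

/-- On a ring `k < J` the outer radius is at most twice the distance to `x₀`; the innermost ball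
accounts for the remainder, which vanishes as `J` grows. -/
theorem sum_rpow_mul_ringMass_le {s R : ℝ} (hs : 0 < s) (hR : 0 < R) (J : ℕ)
    (hM : distMomentPow x₀ μ s < ∞) :
    ∑ k ∈ Finset.range (J + 1), (R / 2 ^ k) ^ s * ringMass μ x₀ R J k ≤
      2 ^ s * (distMomentPow x₀ μ s).toReal + (R / 2 ^ J) ^ s := by
  have hm : Measurable fun y => dist y x₀ ^ s := (continuous_id.dist continuous_const).measurable.pow_const s
  have he : ∫⁻ y, ENNReal.ofReal (dist y x₀ ^ s) ∂μ = distMomentPow x₀ μ s := by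
    refine lintegral_congr fun y => ?_
    rw [edist_comm, edist_dist, ENNReal.ofReal_rpow_of_nonneg dist_nonneg hs.le]
  have hint : Integrable (fun y => dist y x₀ ^ s) μ := by
    refine ⟨hm.aestronglyMeasurable, ?_⟩
    rw [hasFiniteIntegral_iff_ofReal (Filter.Eventually.of_forall fun y => by positivity), he]
    exact hM
  have hval : ∫ y, dist y x₀ ^ s ∂μ = (distMomentPow x₀ μ s).toReal := by
    rw [integral_eq_lintegral_of_nonneg_ae (Filter.Eventually.of_forall fun y => by positivity)
      hm.aestronglyMeasurable, he]
  set F : ℕ → ℝ := fun k => if k ≤ J then (R / 2 ^ k) ^ s else 0 with hF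
  have h1 := integral_comp_ringIndex μ x₀ R J F (by simp [hF])
  have h2 : ∑ k ∈ Finset.range (J + 1), (R / 2 ^ k) ^ s * ringMass μ x₀ R J k =
      ∑ k ∈ Finset.range (J + 1), F k * ringMass μ x₀ R J k := by
    refine Finset.sum_congr rfl fun k hk => ?_
    have : k ≤ J := by have := Finset.mem_range.1 hk; omega
    simp only [hF, this, if_true]
  rw [h2, ← h1, ← hval]
  have hI : Integrable (fun y => 2 ^ s * dist y x₀ ^ s + (R / 2 ^ J) ^ s) μ :=
    (hint.const_mul _).add (integrable_const _)
  calc _ ≤ ∫ y, (2 ^ s * dist y x₀ ^ s + (R / 2 ^ J) ^ s) ∂μ := by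
        refine integral_mono_of_nonneg (Filter.Eventually.of_forall fun y => ?_) hI
          (Filter.Eventually.of_forall fun y => ?_)
        · simp only [hF, Pi.zero_apply]; split_ifs <;> positivity
        · simp only [hF]
          rcases lt_trichotomy (ringIndex x₀ R J y) J with h | h | h
          · rw [if_pos h.le]
            have h3 := lt_dist_of_ringIndex_lt h
            have h4 : R / 2 ^ ringIndex x₀ R J y ≤ 2 * dist y x₀ := by
              rw [pow_succ] at h3
              have : R / 2 ^ ringIndex x₀ R J y = 2 * (R / (2 ^ ringIndex x₀ R J y * 2)) := by
                field_simp
              linarith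
            have h5 := Real.rpow_le_rpow (by positivity) h4 hs.le
            rw [Real.mul_rpow (by norm_num) dist_nonneg] at h5
            have : 0 ≤ (R / 2 ^ J) ^ s := by positivity
            linarith
          · rw [if_pos h.le, h]
            have : 0 ≤ 2 ^ s * dist y x₀ ^ s := by positivity
            linarith
          · rw [if_neg (not_le.2 h)]; positivity
    _ = _ := by
        rw [integral_add (hint.const_mul _) (integrable_const _), integral_const_mul]
        simp

end Moments

/-! ### Deviation bound with the logarithmic factor -/

section Critical

variable {E : Type u} [MetricSpace E] [MeasurableSpace E] [BorelSpace E]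

theorem exists_div_two_pow_rpow_le {R s ε : ℝ} (hR : 0 < R) (hs : 0 < s) (hε : 0 < ε) :
    ∃ J : ℕ, (R / 2 ^ J) ^ s ≤ ε := by
  obtain ⟨J, hJ⟩ := exists_pow_lt_of_lt_one (x := ε ^ (1 / s) / R) (by positivity)
    (by norm_num : (1 / 2 : ℝ) < 1)
  refine ⟨J, ?_⟩
  rw [lt_div_iff₀ hR] at hJ
  have h1 : R / 2 ^ J ≤ ε ^ (1 / s) := by
    refine le_of_eq_of_le ?_ hJ.le
    rw [div_pow, one_pow]; ring
  calc (R / 2 ^ J) ^ s ≤ (ε ^ (1 / s)) ^ s := Real.rpow_le_rpow (by positivity) h1 hs.le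
    _ = ε := by rw [← Real.rpow_mul hε.le, one_div_mul_cancel hs.ne', Real.rpow_one]

theorem ringWeight_eq {p R : ℝ} (hR : 0 < R) {J k : ℕ} (l : ℕ) (hk : k ∈ Finset.range (J + 1)) :
    ringWeight p R J l k = (R / 2 ^ k) ^ p / (2 ^ l) ^ p := by
  have : k ≤ J := by have := Finset.mem_range.1 hk; omega
  rw [ringWeight, if_pos this, Real.div_rpow (by positivity) (by positivity)]

omit [BorelSpace E] in
theorem sum_ringWeight_mul_ringMass (μ : Measure E) (x₀ : E) {p R : ℝ} (hR : 0 < R) (J L : ℕ) :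
    ∑ k ∈ Finset.range (J + 1), ringWeight p R J L k * ringMass μ x₀ R J k =
      (∑ k ∈ Finset.range (J + 1), (R / 2 ^ k) ^ p * ringMass μ x₀ R J k) / (2 ^ L) ^ p := by
  rw [Finset.sum_div]
  refine Finset.sum_congr rfl fun k hk => ?_
  rw [ringWeight_eq hR L hk]; ring

omit [BorelSpace E] in
theorem sum_ringWeight_sq_mul_ringMass (μ : Measure E) (x₀ : E) {p R : ℝ} (hR : 0 < R) (J : ℕ) :
    ∑ k ∈ Finset.range (J + 1), 4 * ringWeight p R J 0 k ^ 2 * ringMass μ x₀ R J k =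
      4 * ∑ k ∈ Finset.range (J + 1), (R / 2 ^ k) ^ (2 * p) * ringMass μ x₀ R J k := by
  rw [Finset.mul_sum]
  refine Finset.sum_congr rfl fun k hk => ?_
  rw [ringWeight_eq hR 0 hk, mul_comm 2 p, Real.rpow_mul (by positivity), Real.rpow_two]
  simp [mul_assoc]

omit [BorelSpace E] in
theorem discrepancyBound_zero_le (μ : Measure E) (x₀ : E) {p β R : ℝ} (hR : 0 < R) (J n : ℕ) :
    discrepancyBound μ x₀ p β R J 0 n ≤
      2 * ∑ k ∈ Finset.range (J + 1), (R / 2 ^ k) ^ p * ringMass μ x₀ R J k := by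
  rw [discrepancyBound, Finset.sum_range_one, Finset.mul_sum]
  refine Finset.sum_le_sum fun k hk => ?_
  refine (mul_le_mul_of_nonneg_left (min_le_right _ _) (ringWeight_nonneg hR _ _ _)).trans ?_
  rw [ringWeight_eq hR 0 hk]
  simp only [pow_zero, Real.one_rpow, div_one]
  linarith

omit [BorelSpace E] in
-- Criticality enters here: the weight `2 ^ (-p l)` cancels the square root of the cell count `2 ^
-- (2 p l)`, so each of the `L + 1` levels contributes the same amount, a dyadic sum controlled by
-- `I_{2p,p}`.
theorem discrepancyBound_le (μ : Measure E) [IsProbabilityMeasure μ] (x₀ : E) {p β R : ℝ}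
    (hp : 1 ≤ p) (hR : 0 < R) (hI : sqrtTailIntegral x₀ μ p < ∞)
    (J L n : ℕ) : discrepancyBound μ x₀ p β R J L n ≤ (L + 1) * (√((β + 1) / n) *
      (4 ^ p * (sqrtTailIntegral x₀ μ p).toReal + (R / 2 ^ J) ^ p)) := by
  have hstep : ∀ l, ∑ k ∈ Finset.range (J + 1), ringWeight p R J l k *
      min (√((β + 1) * 2 ^ (2 * p * l) * ringMass μ x₀ R J k / n)) (2 * ringMass μ x₀ R J k) ≤
      √((β + 1) / n) * (4 ^ p * (sqrtTailIntegral x₀ μ p).toReal + (R / 2 ^ J) ^ p) := by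
    intro l
    have h1 : ∀ k ∈ Finset.range (J + 1), ringWeight p R J l k *
        min (√((β + 1) * 2 ^ (2 * p * l) * ringMass μ x₀ R J k / n)) (2 * ringMass μ x₀ R J k) ≤
        √((β + 1) / n) * ((R / 2 ^ k) ^ p * √(ringMass μ x₀ R J k)) := by
      intro k hk
      refine (mul_le_mul_of_nonneg_left (min_le_left _ _) (ringWeight_nonneg hR _ _ _)).trans
        (le_of_eq ?_)
      have e : (β + 1) * 2 ^ (2 * p * l) * ringMass μ x₀ R J k / n =
          (((2 : ℝ) ^ l) ^ p) ^ 2 * (ringMass μ x₀ R J k * ((β + 1) / n)) := by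
        have : (2 : ℝ) ^ (2 * p * l) = (((2 : ℝ) ^ l) ^ p) ^ 2 := by
          rw [← Real.rpow_natCast, ← Real.rpow_natCast, ← Real.rpow_mul (by norm_num),
            ← Real.rpow_mul (by norm_num)]
          push_cast; ring_nf
        rw [this]; ring
      rw [e, Real.sqrt_mul (sq_nonneg _), Real.sqrt_sq (by positivity),
        Real.sqrt_mul (ringMass_nonneg ..), ringWeight_eq hR l hk]
      field_simp
    refine (Finset.sum_le_sum h1).trans ?_
    rw [← Finset.mul_sum]
    refine mul_le_mul_of_nonneg_left ?_ (Real.sqrt_nonneg _)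
    rw [Finset.sum_range_succ]
    refine add_le_add (le_trans (Finset.sum_le_sum fun k hk => ?_)
      (sum_rpow_mul_sqrt_tailFun_le x₀ μ hp hR hI J)) ?_
    · exact mul_le_mul_of_nonneg_left
        (Real.sqrt_le_sqrt (ringMass_le_tailFun x₀ μ (Finset.mem_range.1 hk))) (by positivity)
    · exact mul_le_of_le_one_right (by positivity)
        (Real.sqrt_le_one.2 (ringMass_le_one x₀ μ R J J))
  refine (Finset.sum_le_sum fun l _ => hstep l).trans (le_of_eq ?_)
  rw [Finset.sum_const, Finset.card_range, nsmul_eq_mul]; push_cast; ring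

theorem criticalExpTerm_nonneg (n : ℕ) (c c' a I m x : ℝ) : 0 ≤ criticalExpTerm n c c' a I m x := by
  unfold criticalExpTerm; split_ifs <;> positivity

/-- The prefactor `e²` outweighs `e⁻¹`. In this regime the exponential term dominates any
probability, so no estimate is needed. -/
theorem one_le_criticalExpTerm {n : ℕ} {c c' a I m x : ℝ} (hx : x ≤ a * m)
    (h : (n : ℝ) * c * (x / (I * Real.log (Real.exp 1 + c' * I / x))) ^ 2 ≤ 1) :
    1 ≤ criticalExpTerm n c c' a I m x := by
  unfold criticalExpTerm
  rw [if_pos hx, mul_one, ← Real.exp_add]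
  exact Real.one_le_exp (by linarith)

/-- Take `L = ⌈2Λ⌉`: since `2 log 2 > 1`, `2 ^ L` exceeds `exp Λ`, and `L + 1 ≤ 2Λ + 2 ≤ 4Λ` because
`Λ ≥ 1`. -/
theorem exists_nat_two_pow_ge {z : ℝ} (hz : 0 ≤ z) :
    ∃ L : ℕ, z ≤ 2 ^ L ∧ (L + 1 : ℝ) ≤ 4 * Real.log (Real.exp 1 + z) := by
  set Λ := Real.log (Real.exp 1 + z) with hΛ
  have hΛ1 : 1 ≤ Λ := by
    rw [hΛ, Real.le_log_iff_exp_le (by positivity)]; linarith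
  refine ⟨⌈2 * Λ⌉₊, ?_, ?_⟩
  · have h1 : 2 * Λ ≤ (⌈2 * Λ⌉₊ : ℝ) := Nat.le_ceil _
    have h2 := Real.log_two_gt_d9
    have h3 : Λ ≤ ⌈2 * Λ⌉₊ * Real.log 2 := by nlinarith
    have h4 : Real.exp 1 + z ≤ 2 ^ ⌈2 * Λ⌉₊ := by
      rw [← Real.log_le_log_iff (by positivity) (by positivity), Real.log_pow]
      exact h3
    linarith [Real.exp_pos 1]
  · have := Nat.ceil_lt_add_one (a := 2 * Λ) (by linarith)
    linarith

variable {Ω : Type v} [MeasurableSpace Ω] {P : Measure Ω} [IsProbabilityMeasure P]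
  {μ : Measure E} [IsProbabilityMeasure μ] {n : ℕ} {X : Fin n → Ω → E} {x₀ : E}

/-- Deviation bound when `x` is large compared with the moment of order `p`. -/
theorem measure_wassersteinPow_gt_le_of_moment_lt {S : Set E} {p β : ℝ} (hp : 1 ≤ p) (hβ : 0 < β)
    (hS : HasCoveringDim x₀ S (2 * p) β) (hμ : μ S = 1) (hX : IsIIDSample X P μ) (hn : 0 < n)
    {x κ R : ℝ} (hx : 0 < x) (hκ : 0 < κ) (hR : 0 < R)
    (hRp : R ^ p = n * (x / 16 ^ p) / (16 * κ)) (hI : sqrtTailIntegral x₀ μ p < ∞)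
    (hxm : 16 * 32 ^ p * (distMomentPow x₀ μ p).toReal < x) :
    P.real {ω | ENNReal.ofReal x < wassersteinPow p μ (empiricalMeasure fun i => X i ω)} ≤
      n * tailFun x₀ μ R + Real.exp (κ ^ 2) * (64 * (4 ^ p * (2 * p ^ 2)) * (16 ^ p) ^ 2 *
        ((sqrtTailIntegral x₀ μ p).toReal ^ 2 / (n * x ^ 2))) ^ κ := by
  have hp0 : 0 < p := by linarith
  have hn' : (0 : ℝ) < n := by exact_mod_cast hn
  set I := (sqrtTailIntegral x₀ μ p).toReal with hI'
  have hm : distMomentPow x₀ μ p < ∞ :=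
    lt_of_le_of_lt (distMomentPow_le x₀ μ hp0) (ENNReal.mul_lt_top ENNReal.ofReal_lt_top hI)
  have hV := distMomentPow_two_mul_le x₀ μ hp0 hI
  rw [← hI'] at hV
  have hVt : distMomentPow x₀ μ (2 * p) < ∞ := lt_of_le_of_lt hV ENNReal.ofReal_lt_top
  have hV' : (distMomentPow x₀ μ (2 * p)).toReal ≤ 2 * p ^ 2 * I ^ 2 :=
    ENNReal.toReal_le_of_le_ofReal (by positivity) hV
  set m := (distMomentPow x₀ μ p).toReal with hm'
  have hm0 : 0 ≤ m := ENNReal.toReal_nonneg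
  set y := x / 16 ^ p with hy
  have hy0 : 0 < y := by positivity
  have hmy : 16 * 2 ^ p * m ≤ y := by
    rw [hy, le_div_iff₀ (by positivity)]
    have : (32 : ℝ) ^ p = 2 ^ p * 16 ^ p := by
      rw [← Real.mul_rpow (by norm_num) (by norm_num)]; norm_num
    rw [this] at hxm; linarith
  have h2p : (1 : ℝ) ≤ 2 ^ p := Real.one_le_rpow (by norm_num) hp0.le
  -- The slack `ε` absorbs the innermost ball in the variance and keeps the variance bound positive
  -- when `I = 0`; it tends to `0` at the end.
  have hmain : ∀ ε : ℝ, 0 < ε →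
      P.real {ω | ENNReal.ofReal x < wassersteinPow p μ (empiricalMeasure fun i => X i ω)} ≤
      n * tailFun x₀ μ R + Real.exp (κ ^ 2) *
        (16 * (4 * (4 ^ p * (2 * p ^ 2 * I ^ 2) + ε)) / (n * y ^ 2)) ^ κ := by
    intro ε hε
    obtain ⟨J₁, hJ₁⟩ := exists_div_two_pow_rpow_le hR hp0 (by positivity : 0 < y / 16)
    obtain ⟨J₂, hJ₂⟩ := exists_div_two_pow_rpow_le hR (by positivity : 0 < 2 * p) hε
    set J := max J₁ J₂ with hJ
    have hmono : ∀ (s : ℝ) (i : ℕ), 0 < s → i ≤ J → (R / 2 ^ J) ^ s ≤ (R / 2 ^ i) ^ s := by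
      intro s i hs hi
      refine Real.rpow_le_rpow (by positivity) ?_ hs.le
      exact div_le_div_of_nonneg_left hR.le (by positivity)
        (pow_le_pow_right₀ (by norm_num) hi)
    have hρ1 := (hmono p J₁ hp0 (le_max_left _ _)).trans hJ₁
    have hρ2 := (hmono (2 * p) J₂ (by positivity) (le_max_right _ _)).trans hJ₂
    have hs1 := sum_rpow_mul_ringMass_le x₀ μ hp0 hR J hm
    have hs2 := sum_rpow_mul_ringMass_le x₀ μ (by positivity : 0 < 2 * p) hR J hVt
    have e4 : (2 : ℝ) ^ (2 * p) = 4 ^ p := by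
      rw [Real.rpow_mul (by norm_num)]; norm_num
    rw [e4] at hs2
    -- One level is enough (`L = 0`): the outer moment, the finest-level term and the mean are all
    -- bounded through the `p`-moment, which is at most `y / (16 * 2 ^ p)`, and the inner remainder.
    refine measure_wassersteinPow_gt_le hp hβ hS hμ hX hn (m := m) hx hκ hR hRp J 0 hm0 ?_ ?_ ?_ ?_
      (by positivity) ?_
    · rw [hm', ENNReal.ofReal_toReal hm.ne]
      exact setLIntegral_le_lintegral _ _
    · rw [← hy]; nlinarith
    · rw [sum_ringWeight_mul_ringMass μ x₀ hR, ← hy]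
      simp only [pow_zero, Real.one_rpow, div_one]
      linarith
    · refine (discrepancyBound_zero_le μ x₀ hR J n).trans ?_
      rw [← hy]; linarith
    · rw [sum_ringWeight_sq_mul_ringMass μ x₀ hR]
      have : (4 : ℝ) ^ p * (distMomentPow x₀ μ (2 * p)).toReal ≤
          4 ^ p * (2 * p ^ 2 * I ^ 2) := by gcongr
      linarith
  have hcont : Continuous fun ε : ℝ => n * tailFun x₀ μ R + Real.exp (κ ^ 2) *
        (16 * (4 * (4 ^ p * (2 * p ^ 2 * I ^ 2) + ε)) / (n * y ^ 2)) ^ κ := by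
    refine continuous_const.add (continuous_const.mul
      (Continuous.rpow_const (by fun_prop) fun _ => Or.inr hκ.le))
  have hlim := (hcont.tendsto 0).mono_left (nhdsWithin_le_nhds (s := Set.Ioi 0))
  have hfin := ge_of_tendsto hlim (by
    filter_upwards [self_mem_nhdsWithin] with ε hε using hmain ε hε)
  refine hfin.trans (le_of_eq ?_)
  congr 3
  rw [hy]; field_simp; ring

set_option maxHeartbeats 1000000 in
/-- Deviation bound in the critical case, with an arbitrary exponent `κ` in the polynomial term. -/
theorem measure_wassersteinPow_gt_le_critical {S : Set E} {p β : ℝ} (hp : 1 ≤ p) (hβ : 0 < β)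
    (hS : HasCoveringDim x₀ S (2 * p) β) (hμ : μ S = 1) (hX : IsIIDSample X P μ) (hn : 0 < n)
    {x κ R : ℝ} (hx : 0 < x) (hκ : 1 ≤ κ) (hR : 0 < R)
    (hRp : R ^ p = n * (x / 16 ^ p) / (16 * κ)) (hI : sqrtTailIntegral x₀ μ p < ∞) :
    P.real {ω | ENNReal.ofReal x < wassersteinPow p μ (empiricalMeasure fun i => X i ω)} ≤
      criticalExpTerm n (1 / (256 * (16 ^ p) ^ 2 * (4 ^ p + 1) ^ 2 * (|β| + 1)))
        (4 * 16 ^ p * (2 ^ p * |p| + 1)) (16 * 32 ^ p) (sqrtTailIntegral x₀ μ p).toReal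
        (distMomentPow x₀ μ p).toReal x +
      (n * tailFun x₀ μ R + Real.exp (κ ^ 2) * (128 * κ * (4 ^ p * (2 * p ^ 2) + 1) *
        (16 ^ p) ^ 2 * ((sqrtTailIntegral x₀ μ p).toReal ^ 2 / (n * x ^ 2))) ^ κ) := by
  have hp0 : 0 < p := by linarith
  have hκ0 : 0 < κ := by linarith
  have hn' : (0 : ℝ) < n := by exact_mod_cast hn
  have hmI := distMomentPow_le x₀ μ hp0
  have hV := distMomentPow_two_mul_le x₀ μ hp0 hI
  have hm : distMomentPow x₀ μ p < ∞ :=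
    lt_of_le_of_lt hmI (ENNReal.mul_lt_top ENNReal.ofReal_lt_top hI)
  have hdisc := fun J L => discrepancyBound_le μ x₀ (β := β) hp hR hI J L n
  by_cases hxm : 16 * 32 ^ p * (distMomentPow x₀ μ p).toReal < x
  · have h1 := measure_wassersteinPow_gt_le_of_moment_lt hp hβ hS hμ hX hn hx hκ0 hR hRp hI hxm
    refine h1.trans (le_trans ?_ (le_add_of_nonneg_left (criticalExpTerm_nonneg ..)))
    have h4 : 64 * ((4 : ℝ) ^ p * (2 * p ^ 2)) ≤ 128 * κ * (4 ^ p * (2 * p ^ 2) + 1) := by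
      have : (0 : ℝ) ≤ 4 ^ p * (2 * p ^ 2) := by positivity
      nlinarith
    gcongr
  rw [not_lt] at hxm
  set I := (sqrtTailIntegral x₀ μ p).toReal with hI'
  have hI0 : 0 ≤ I := ENNReal.toReal_nonneg
  set m := (distMomentPow x₀ μ p).toReal with hm'
  have hm0 : 0 ≤ m := ENNReal.toReal_nonneg
  have hmI' : m ≤ p * I := by
    have := ENNReal.toReal_mono (ENNReal.mul_lt_top ENNReal.ofReal_lt_top hI).ne hmI
    rwa [ENNReal.toReal_mul, ENNReal.toReal_ofReal hp0.le] at this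
  have hIpos : 0 < I := by
    rcases hI0.lt_or_eq with h | h
    · exact h
    · rw [← h, mul_zero] at hmI'
      have : m = 0 := le_antisymm hmI' hm0
      rw [this, mul_zero] at hxm; linarith
  have hVt : distMomentPow x₀ μ (2 * p) < ∞ := lt_of_le_of_lt hV ENNReal.ofReal_lt_top
  have hV' : (distMomentPow x₀ μ (2 * p)).toReal ≤ 2 * p ^ 2 * I ^ 2 :=
    ENNReal.toReal_le_of_le_ofReal (by positivity) hV
  set c' := 4 * (16 : ℝ) ^ p * (2 ^ p * |p| + 1) with hc'
  set Cc := 128 * κ * (4 ^ p * (2 * p ^ 2) + 1) * ((16 : ℝ) ^ p) ^ 2 with hCc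
  have hCc0 : 0 < Cc := by positivity
  have hPone : P.real {ω | ENNReal.ofReal x <
      wassersteinPow p μ (empiricalMeasure fun i => X i ω)} ≤ 1 := measureReal_le_one
  have htail0 : 0 ≤ n * tailFun x₀ μ R := mul_nonneg hn'.le (tailFun_nonneg ..)
  -- If this quantity is at least `1`, the polynomial term alone exceeds `1`; otherwise the
  -- resulting lower bound on `n * x ^ 2` controls the outer moment.
  by_cases hbig : 1 ≤ Cc * (I ^ 2 / (n * x ^ 2))
  · have h1 : 1 ≤ (Cc * (I ^ 2 / (n * x ^ 2))) ^ κ := Real.one_le_rpow hbig hκ0.le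
    have h2 : 1 ≤ Real.exp (κ ^ 2) := Real.one_le_exp (sq_nonneg _)
    have h3 : 1 ≤ Real.exp (κ ^ 2) * (Cc * (I ^ 2 / (n * x ^ 2))) ^ κ := by nlinarith
    have h4 := criticalExpTerm_nonneg n (1 / (256 * (16 ^ p) ^ 2 * (4 ^ p + 1) ^ 2 * (|β| + 1)))
      c' (16 * 32 ^ p) I m x
    linarith
  rw [not_le] at hbig
  set Λ := Real.log (Real.exp 1 + c' * I / x) with hΛ
  have hΛ1 : 1 ≤ Λ := by
    rw [hΛ, Real.le_log_iff_exp_le (by positivity)]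
    have : 0 ≤ c' * I / x := by positivity
    linarith
  by_cases hexp : (n : ℝ) * (1 / (256 * (16 ^ p) ^ 2 * (4 ^ p + 1) ^ 2 * (|β| + 1))) *
      (x / (I * Λ)) ^ 2 ≤ 1
  · have h1 := one_le_criticalExpTerm (n := n) (c' := c') hxm hexp
    have h2 : 0 ≤ Real.exp (κ ^ 2) * (Cc * (I ^ 2 / (n * x ^ 2))) ^ κ := by positivity
    linarith
  rw [not_le] at hexp
  refine le_trans ?_ (le_add_of_nonneg_left (criticalExpTerm_nonneg ..))
  set y := x / 16 ^ p with hy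
  have hy0 : 0 < y := by positivity
  have hxy : x = 16 ^ p * y := by rw [hy]; field_simp
  -- `J` makes the inner ball's contribution at most `I`; `L` is the number of levels that brings
  -- the finest-level term below its quarter.
  obtain ⟨J, hJ⟩ := exists_div_two_pow_rpow_le hR hp0 hIpos
  obtain ⟨L, hL1, hL2⟩ := exists_nat_two_pow_ge (z := c' * I / x) (by positivity)
  rw [← hΛ] at hL2
  have hs1 := sum_rpow_mul_ringMass_le x₀ μ hp0 hR J hm
  have hs2 := sum_rpow_mul_ringMass_le x₀ μ (by positivity : 0 < 2 * p) hR J hVt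
  have e4 : (2 : ℝ) ^ (2 * p) = 4 ^ p := by
    rw [Real.rpow_mul (by norm_num)]; norm_num
  rw [e4] at hs2
  have hJ2 : (R / 2 ^ J) ^ (2 * p) ≤ I ^ 2 := by
    rw [mul_comm, Real.rpow_mul (by positivity), Real.rpow_two]
    exact pow_le_pow_left₀ (by positivity) hJ 2
  have hRpos : 0 < R ^ p := by positivity
  have hcore := measure_wassersteinPow_gt_le (P := P) hp hβ hS hμ hX hn
    (m := 2 * p ^ 2 * I ^ 2 / R ^ p) (σ2 := 4 * ((4 ^ p * (2 * p ^ 2) + 1) * I ^ 2))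
    hx hκ0 hR hRp J L (by positivity) ?_ ?_ ?_ ?_ (by positivity) ?_
  · refine hcore.trans (add_le_add le_rfl ?_)
    refine mul_le_mul_of_nonneg_left (Real.rpow_le_rpow (by positivity) ?_ hκ0.le)
      (Real.exp_pos _).le
    rw [← hy, hxy, hCc]
    have : 16 * (4 * ((4 ^ p * (2 * p ^ 2) + 1) * I ^ 2)) / (n * y ^ 2) =
        64 * (4 ^ p * (2 * p ^ 2) + 1) * ((16 : ℝ) ^ p) ^ 2 * (I ^ 2 / (n * (16 ^ p * y) ^ 2)) := by
      field_simp; ring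
    rw [this]
    gcongr
    linarith
  -- Markov-type bound for the outer moment: beyond `R`, `d ^ p ≤ d ^ (2p) / R ^ p`, and the
  -- `2p`-moment is at most `2 p² I²`.
  · rw [ENNReal.ofReal_div_of_pos hRpos,
      ENNReal.le_div_iff_mul_le (Or.inl (by simpa using hRpos)) (Or.inl ENNReal.ofReal_ne_top)]
    refine le_trans ?_ hV
    rw [← lintegral_mul_const' _ _ ENNReal.ofReal_ne_top, distMomentPow]
    have hms : MeasurableSet {y : E | R < dist y x₀} :=
      (isOpen_lt continuous_const (continuous_id.dist continuous_const)).measurableSet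
    refine (setLIntegral_mono' hms fun z hz => ?_).trans (setLIntegral_le_lintegral _ _)
    have hz' : R < dist z x₀ := hz
    rw [edist_comm, edist_dist, ENNReal.ofReal_rpow_of_nonneg dist_nonneg hp0.le,
      ENNReal.ofReal_rpow_of_nonneg dist_nonneg (by positivity),
      ← ENNReal.ofReal_mul (by positivity)]
    refine ENNReal.ofReal_le_ofReal ?_
    rw [two_mul, Real.rpow_add (hR.trans hz')]
    gcongr
  · rw [← hy, hRp, div_le_iff₀ (by positivity)]
    have h1 : Cc * I ^ 2 < n * x ^ 2 := by
      rw [← mul_div_assoc, div_lt_one (by positivity)] at hbig; exact hbig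
    have h2 : 128 * κ * p ^ 2 * ((16 : ℝ) ^ p) ^ 2 * I ^ 2 ≤ Cc * I ^ 2 := by
      rw [hCc]
      have h4 : (1 : ℝ) ≤ 4 ^ p := Real.one_le_rpow (by norm_num) hp0.le
      have : p ^ 2 ≤ 4 ^ p * (2 * p ^ 2) + 1 := by nlinarith [sq_nonneg p]
      exact mul_le_mul_of_nonneg_right (mul_le_mul_of_nonneg_right
        (mul_le_mul_of_nonneg_left this (by positivity)) (by positivity)) (sq_nonneg I)
    have h3 : 128 * κ * p ^ 2 * I ^ 2 ≤ n * y ^ 2 := by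
      rw [hxy, mul_pow] at h1
      have h5 : (0 : ℝ) < ((16 : ℝ) ^ p) ^ 2 := by positivity
      exact le_of_mul_le_mul_left
        (le_trans (le_of_eq (by ring)) ((h2.trans h1.le).trans (le_of_eq (by ring)))) h5
    have h4 : y / 4 * (n * y / (16 * κ)) = n * y ^ 2 / (64 * κ) := by field_simp; norm_num
    rw [h4, le_div_iff₀ (by positivity)]
    linarith
  · rw [sum_ringWeight_mul_ringMass μ x₀ hR, ← hy, div_le_iff₀ (by positivity)]
    have h1 : (2 : ℝ) ^ L ≤ (2 ^ L) ^ p :=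
      Real.self_le_rpow_of_one_le (one_le_pow₀ (by norm_num)) hp
    have h2 : (2 : ℝ) ^ p * m + (R / 2 ^ J) ^ p ≤ (2 ^ p * p + 1) * I := by
      have : (2 : ℝ) ^ p * m ≤ 2 ^ p * (p * I) := by gcongr
      linarith
    have h3 : y / 4 * (c' * I / x) = (2 ^ p * p + 1) * I := by
      rw [hc', hxy, abs_of_pos hp0]; field_simp
    calc _ ≤ y / 4 * (c' * I / x) := by rw [h3]; exact hs1.trans h2
      _ ≤ y / 4 * (2 ^ L) ^ p := by gcongr; exact hL1.trans h1
  · refine (hdisc J L).trans ?_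
    rw [← hy]
    have hβ' : |β| = β := abs_of_pos hβ
    rw [hβ'] at hexp
    have h1 : (4 : ℝ) ^ p * I + (R / 2 ^ J) ^ p ≤ (4 ^ p + 1) * I := by linarith
    have h2 : (L + 1 : ℝ) * (√((β + 1) / n) * (4 ^ p * I + (R / 2 ^ J) ^ p)) ≤
        4 * Λ * (√((β + 1) / n) * ((4 ^ p + 1) * I)) := by gcongr
    refine h2.trans ?_
    -- This is the square root of the inequality saying that the exponent exceeds `1`; the constant
    -- in that exponent is calibrated so that the mean discrepancy is then at most `y / 4`.
    have h3 : √((β + 1) / n) ≤ y / (16 * Λ * ((4 ^ p + 1) * I)) := by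
      rw [Real.sqrt_le_left (by positivity)]
      have h5 : (n : ℝ) * (1 / (256 * (16 ^ p) ^ 2 * (4 ^ p + 1) ^ 2 * (β + 1))) *
          (x / (I * Λ)) ^ 2 = n / (β + 1) * (y / (16 * Λ * ((4 ^ p + 1) * I))) ^ 2 := by
        rw [hxy]; field_simp; norm_num
      rw [h5] at hexp
      rw [div_le_iff₀ hn']
      have h6 : (0 : ℝ) < β + 1 := by linarith
      rw [div_mul_eq_mul_div, lt_div_iff₀ h6] at hexp
      linarith
    calc 4 * Λ * (√((β + 1) / n) * ((4 ^ p + 1) * I))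
        ≤ 4 * Λ * (y / (16 * Λ * ((4 ^ p + 1) * I)) * ((4 ^ p + 1) * I)) := by gcongr
      _ = y / 4 := by field_simp; norm_num
  · rw [sum_ringWeight_sq_mul_ringMass μ x₀ hR]
    have : (4 : ℝ) ^ p * (distMomentPow x₀ μ (2 * p)).toReal ≤
        4 ^ p * (2 * p ^ 2 * I ^ 2) := by gcongr
    linarith

end Critical

/-! ### Mean discrepancy under a weak moment of order below `2p` -/

section WeakMoment

theorem sum_two_rpow_neg_pow_le {s : ℝ} (hs : 0 < s) (K : ℕ) :
    ∑ k ∈ Finset.range K, ((2 : ℝ) ^ (-s)) ^ k ≤ (1 - 2 ^ (-s))⁻¹ := by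
  have h1 : (2 : ℝ) ^ (-s) < 1 := Real.rpow_lt_one_of_one_lt_of_neg (by norm_num) (by linarith)
  have h0 : (0 : ℝ) ≤ 2 ^ (-s) := by positivity
  rw [← tsum_geometric_of_lt_one h0 h1]
  exact (summable_geometric_of_lt_one h0 h1).sum_le_tsum _ fun i _ => by positivity

theorem one_sub_two_rpow_neg_pos {s : ℝ} (hs : 0 < s) : 0 < (1 - (2 : ℝ) ^ (-s))⁻¹ := by
  have h1 : (2 : ℝ) ^ (-s) < 1 := Real.rpow_lt_one_of_one_lt_of_neg (by norm_num) (by linarith)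
  exact inv_pos.2 (by linarith)

theorem two_pow_rpow_rpow (p s : ℝ) (l : ℕ) :
    (((2 : ℝ) ^ l) ^ p) ^ s = ((2 : ℝ) ^ (p * s)) ^ l := by
  rw [← Real.rpow_natCast, ← Real.rpow_natCast, ← Real.rpow_mul (by norm_num),
    ← Real.rpow_mul (by norm_num), ← Real.rpow_mul (by norm_num)]
  ring_nf

theorem min_le_rpow_mul_rpow {a b θ : ℝ} (ha : 0 ≤ a) (hb : 0 ≤ b) (h0 : 0 ≤ θ) (h1 : θ ≤ 1) :
    min a b ≤ a ^ (1 - θ) * b ^ θ := by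
  have hm : 0 ≤ min a b := le_min ha hb
  calc min a b = min a b ^ (1 - θ) * min a b ^ θ := by
        rw [← Real.rpow_add_of_nonneg hm (by linarith) h0, sub_add_cancel, Real.rpow_one]
    _ ≤ _ := mul_le_mul (Real.rpow_le_rpow hm (min_le_left _ _) (by linarith))
        (Real.rpow_le_rpow hm (min_le_right _ _) h0) (by positivity) (by positivity)

/-- A minimum is at most any weighted geometric mean. Exponent `θ > 0` gains a factor `N ^ (-θ)`
over the square-root bound, at the price of a higher power of the mass `z`. -/
theorem min_sqrt_le_interpolate {B N z n θ : ℝ} (hB : 1 ≤ B) (hN : 0 ≤ N) (hz : 0 ≤ z)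
    (hn : 0 ≤ n) (h0 : 0 ≤ θ) (h1 : θ ≤ 1) :
    min (B * N * √z) (2 * (n * z)) ≤ 2 * B * N ^ (1 - θ) * n ^ θ * z ^ ((1 + θ) / 2) := by
  have hB0 : 0 ≤ B := by linarith
  refine (min_le_rpow_mul_rpow (by positivity) (by positivity) h0 h1).trans ?_
  rw [Real.mul_rpow (by positivity) (by positivity), Real.mul_rpow hB0 hN,
    Real.mul_rpow (by norm_num) (by positivity), Real.mul_rpow hn hz, Real.sqrt_eq_rpow,
    ← Real.rpow_mul hz]
  have e1 : z ^ ((1 + θ) / 2) = z ^ (1 / 2 * (1 - θ)) * z ^ θ := by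
    rw [← Real.rpow_add_of_nonneg hz (by nlinarith) h0]; ring_nf
  have hB' : B ^ (1 - θ) ≤ B := Real.rpow_le_self_of_one_le hB (by linarith)
  have h2 : (2 : ℝ) ^ θ ≤ 2 := Real.rpow_le_self_of_one_le (by norm_num) h1
  rw [e1]
  calc B ^ (1 - θ) * N ^ (1 - θ) * z ^ (1 / 2 * (1 - θ)) * (2 ^ θ * (n ^ θ * z ^ θ))
      = (B ^ (1 - θ) * 2 ^ θ) * (N ^ (1 - θ) * n ^ θ * (z ^ (1 / 2 * (1 - θ)) * z ^ θ)) := by ring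
    _ ≤ (B * 2) * (N ^ (1 - θ) * n ^ θ * (z ^ (1 / 2 * (1 - θ)) * z ^ θ)) := by gcongr
    _ = _ := by ring

variable {E : Type u} [MetricSpace E] [MeasurableSpace E] [BorelSpace E]

omit [BorelSpace E] in
-- After interpolation the term at level `l` and ring `k` decays geometrically in both indices, so
-- the bound is uniform in `L` and `J` and has no logarithm.
theorem discrepancyBound_le_of_ringMass_le (μ : Measure E) (x₀ : E) {p β R A r : ℝ} {n : ℕ}
    (hp : 0 < p) (hβ : 0 < β) (hR : 0 < R) (hA : 0 ≤ A) (hr1 : 1 < r) (hr2 : r < 2) (hn : 0 < n)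
    {J : ℕ} (h : ∀ k ≤ J, ringMass μ x₀ R J k ≤ A * ((2 ^ k) ^ p) ^ r / n) (L : ℕ) :
    discrepancyBound μ x₀ p β R J L n ≤
      2 * √(β + 1) * (1 - 2 ^ (-(p * (1 / r - 1 / 2))))⁻¹ * (1 - 2 ^ (-(p * (1 / 2 - r / 4))))⁻¹ *
        A ^ (1 / 4 + 1 / (2 * r)) * (R ^ p / n) := by
  have hn' : (0 : ℝ) < n := by exact_mod_cast hn
  have hr0 : 0 < r := by linarith
  -- Summability over levels needs `θ > 0` and over rings needs `θ < 2 / r - 1`; this is the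
  -- midpoint, available because `r < 2`.
  set θ := 1 / r - 1 / 2 with hθ
  have hθ0 : 0 < θ := by
    rw [hθ, sub_pos]; exact one_div_lt_one_div_of_lt hr0 hr2
  have hθ1 : θ ≤ 1 := by
    have : 1 / r < 1 := by rw [div_lt_one hr0]; exact hr1
    linarith
  set η := 1 / 4 + 1 / (2 * r) with hη
  have hηθ : η = (1 + θ) / 2 := by rw [hη, hθ]; field_simp; ring
  have hrη : r * η - 1 = -(1 / 2 - r / 4) := by rw [hη]; field_simp; ring
  have hη0 : 0 ≤ η := by rw [hηθ]; linarith
  have hB1 : 1 ≤ √(β + 1) := by rw [Real.one_le_sqrt]; linarith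
  set B := √(β + 1) with hB
  have hterm : ∀ l, ∀ k ∈ Finset.range (J + 1), ringWeight p R J l k *
      min (√((β + 1) * 2 ^ (2 * p * l) * ringMass μ x₀ R J k / n)) (2 * ringMass μ x₀ R J k) ≤
      2 * B * A ^ η * (R ^ p / n) * ((2 ^ (-(p * θ))) ^ l * (2 ^ (-(p * (1 / 2 - r / 4)))) ^ k) := by
    intro l k hk
    have hkJ : k ≤ J := by have := Finset.mem_range.1 hk; omega
    have hm0 := ringMass_nonneg μ x₀ R J k
    set N : ℝ := (2 ^ l) ^ p with hN
    set D : ℝ := (2 ^ k) ^ p with hD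
    have hN0 : 0 < N := by positivity
    have hD0 : 0 < D := by positivity
    set z := ringMass μ x₀ R J k / n with hz
    have hz0 : 0 ≤ z := by positivity
    have hzle : z ≤ A * D ^ r / n ^ 2 := by
      rw [hz, div_le_iff₀ hn']
      refine (h k hkJ).trans (le_of_eq ?_)
      rw [← hD]
      field_simp
    have e1 : √((β + 1) * 2 ^ (2 * p * l) * ringMass μ x₀ R J k / n) = B * N * √z := by
      have : (2 : ℝ) ^ (2 * p * l) = N ^ 2 := by
        rw [hN, ← Real.rpow_natCast, ← Real.rpow_natCast, ← Real.rpow_mul (by norm_num),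
          ← Real.rpow_mul (by norm_num)]
        push_cast; ring_nf
      rw [this, mul_div_assoc, ← hz, Real.sqrt_mul (by positivity), Real.sqrt_mul (by positivity),
        Real.sqrt_sq hN0.le]
    have e2 : ringMass μ x₀ R J k = n * z := by rw [hz]; field_simp
    rw [e1, e2]
    have hw : ringWeight p R J l k = R ^ p / D / N := by
      rw [ringWeight_eq hR l hk, Real.div_rpow hR.le (by positivity)]
    rw [hw]
    have h1 := min_sqrt_le_interpolate hB1 hN0.le hz0 hn'.le hθ0.le hθ1
    rw [← hηθ] at h1
    have h2 : z ^ η ≤ A ^ η * D ^ (r * η) * (n : ℝ) ^ (-(1 + θ)) := by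
      refine (Real.rpow_le_rpow hz0 hzle hη0).trans (le_of_eq ?_)
      rw [Real.div_rpow (by positivity) (by positivity), Real.mul_rpow hA (by positivity),
        ← Real.rpow_mul hD0.le, ← Real.rpow_natCast, ← Real.rpow_mul hn'.le, Real.rpow_neg hn'.le,
        div_eq_mul_inv]
      congr 3
      rw [hηθ]; push_cast; ring
    have e3 : (2 ^ (-(p * θ)) : ℝ) ^ l = N ^ (-θ) := by
      rw [hN, two_pow_rpow_rpow]; ring_nf
    have e4 : (2 ^ (-(p * (1 / 2 - r / 4))) : ℝ) ^ k = D ^ (r * η - 1) := by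
      rw [hrη, hD, two_pow_rpow_rpow]; ring_nf
    rw [e3, e4]
    have e5 : N ^ (1 - θ) = N * N ^ (-θ) := by
      rw [sub_eq_add_neg, Real.rpow_add hN0, Real.rpow_one]
    have e6 : (n : ℝ) ^ θ * (n : ℝ) ^ (-(1 + θ)) = (n : ℝ)⁻¹ := by
      rw [← Real.rpow_add hn', ← Real.rpow_neg_one]; ring_nf
    calc R ^ p / D / N * min (B * N * √z) (2 * (n * z))
        ≤ R ^ p / D / N * (2 * B * N ^ (1 - θ) * (n : ℝ) ^ θ *
          (A ^ η * D ^ (r * η) * (n : ℝ) ^ (-(1 + θ)))) := by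
          refine mul_le_mul_of_nonneg_left (h1.trans ?_) (by positivity)
          exact mul_le_mul_of_nonneg_left h2 (by positivity)
      _ = R ^ p / D / N * (2 * B * N ^ (1 - θ) * (A ^ η * D ^ (r * η))) *
          ((n : ℝ) ^ θ * (n : ℝ) ^ (-(1 + θ))) := by ring
      _ = _ := by
          rw [e5, e6, Real.rpow_sub_one hD0.ne']
          field_simp
  have hp1 : 0 < p * θ := by positivity
  have hp2 : 0 < p * (1 / 2 - r / 4) := mul_pos hp (by linarith)
  unfold discrepancyBound
  refine (Finset.sum_le_sum fun l _ => Finset.sum_le_sum fun k hk => hterm l k hk).trans ?_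
  have e7 : ∑ l ∈ Finset.range (L + 1), ∑ k ∈ Finset.range (J + 1),
      2 * B * A ^ η * (R ^ p / n) *
        (((2 : ℝ) ^ (-(p * θ))) ^ l * ((2 : ℝ) ^ (-(p * (1 / 2 - r / 4)))) ^ k) =
      2 * B * A ^ η * (R ^ p / n) * ((∑ l ∈ Finset.range (L + 1), ((2 : ℝ) ^ (-(p * θ))) ^ l) *
        ∑ k ∈ Finset.range (J + 1), ((2 : ℝ) ^ (-(p * (1 / 2 - r / 4)))) ^ k) := by
    rw [Finset.sum_mul_sum, Finset.mul_sum]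
    refine Finset.sum_congr rfl fun l _ => ?_
    rw [Finset.mul_sum]
  rw [e7]
  have h8 := mul_le_mul (sum_two_rpow_neg_pow_le hp1 (L + 1)) (sum_two_rpow_neg_pow_le hp2 (J + 1))
    (Finset.sum_nonneg fun k _ => by positivity) (one_sub_two_rpow_neg_pos hp1).le
  refine (mul_le_mul_of_nonneg_left h8 (by positivity)).trans (le_of_eq (by ring))

omit [BorelSpace E] in
-- A ring `k < J` lies beyond radius `R / 2 ^ (k + 1)`, hence the factor `2 ^ q`. For the innermost
-- ball only mass at most `1` is known, and `hJ` makes the right-hand side at least `1`.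
theorem ringMass_le_of_tailFun_le (μ : Measure E) [IsProbabilityMeasure μ] (x₀ : E)
    {q R w : ℝ} (hR : 0 < R) (hq : 0 < q)
    (hw : ∀ t, 0 < t → t ^ q * tailFun x₀ μ t ≤ w) {J : ℕ} (hJ : (R / 2 ^ J) ^ q ≤ w) {k : ℕ}
    (hk : k ≤ J) : ringMass μ x₀ R J k ≤ 2 ^ q * w / R ^ q * (2 ^ k) ^ q := by
  have hRk : ∀ i : ℕ, 0 < R / 2 ^ i := fun i => by positivity
  have hwpos : 0 ≤ w := le_trans (by positivity) hJ
  rcases hk.lt_or_eq with h | rfl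
  · refine (ringMass_le_tailFun x₀ μ h).trans ?_
    have h1 := hw _ (hRk (k + 1))
    rw [Real.div_rpow hR.le (by positivity), pow_succ, Real.mul_rpow (by positivity) (by norm_num),
      div_mul_eq_mul_div, div_le_iff₀ (by positivity)] at h1
    have : 2 ^ q * w / R ^ q * (2 ^ k) ^ q = w * ((2 ^ k) ^ q * 2 ^ q) / R ^ q := by ring
    rw [this, le_div_iff₀ (by positivity), pow_succ]
    linarith
  · refine (ringMass_le_one x₀ μ R k k).trans ?_
    rw [Real.div_rpow hR.le (by positivity), div_le_iff₀ (by positivity)] at hJ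
    have h2 : (1 : ℝ) ≤ 2 ^ q := Real.one_le_rpow (by norm_num) hq.le
    rw [div_mul_eq_mul_div, le_div_iff₀ (by positivity)]
    have : 0 ≤ w * (2 ^ k) ^ q := by positivity
    nlinarith

end WeakMoment

/-! ### The case `r < 2` and assembly of the three statements -/

section Main

/-- Deviation bound with `κ = 1`, everything expressed through `q = n * w / M ^ r` with `M = R ^ p`.
The hypotheses `hA1` and `hA2` are the quarter conditions for the outer moment and the mean. The
variance sum over rings is geometric since `r < 2`. -/
theorem measure_wassersteinPow_gt_le_of_tailFun_le {E : Type u} [MetricSpace E]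
    [MeasurableSpace E] [BorelSpace E] {Ω : Type v} [MeasurableSpace Ω] {P : Measure Ω}
    [IsProbabilityMeasure P] {μ : Measure E} [IsProbabilityMeasure μ] {n : ℕ} {X : Fin n → Ω → E}
    {x₀ : E} {S : Set E} {p β : ℝ} (hp : 1 ≤ p) (hβ : 0 < β)
    (hS : HasCoveringDim x₀ S (2 * p) β) (hμ : μ S = 1) (hX : IsIIDSample X P μ) (hn : 0 < n)
    {x r w C : ℝ} (hx : 0 < x) (hr1 : 1 < r) (hr2 : r < 2) (hw : 0 < w)
    (hwt : ∀ t, 0 < t → t ^ (r * p) * tailFun x₀ μ t ≤ w)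
    (hC : C = 2 * √(β + 1) * (1 - 2 ^ (-(p * (1 / r - 1 / 2))))⁻¹ *
      (1 - 2 ^ (-(p * (1 / 2 - r / 4))))⁻¹)
    (hA1 : r / (r - 1) * (n * w / (n * (x / 16 ^ p) / 16) ^ r) ≤ 4)
    (hA2 : C * (2 ^ (r * p) * (n * w / (n * (x / 16 ^ p) / 16) ^ r)) ^ (1 / 4 + 1 / (2 * r)) ≤ 4) :
    P.real {ω | ENNReal.ofReal x < wassersteinPow p μ (empiricalMeasure fun i => X i ω)} ≤
      (1 + Real.exp 1 * (2 ^ (r * p) * (1 - 2 ^ (-(p * (2 - r))))⁻¹)) *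
        (n * w / (n * (x / 16 ^ p) / 16) ^ r) := by
  have hp0 : 0 < p := by linarith
  have hr0 : 0 < r := by linarith
  have hn' : (0 : ℝ) < n := by exact_mod_cast hn
  set y := x / 16 ^ p with hy
  have hy0 : 0 < y := by positivity
  set M := n * y / 16 with hM
  have hM0 : 0 < M := by positivity
  have hyM : y = 16 * M / n := by rw [hM]; field_simp
  set R := M ^ (1 / p) with hRdef
  have hR : 0 < R := by positivity
  have hRM : R ^ p = M := by
    rw [hRdef, ← Real.rpow_mul hM0.le, one_div_mul_cancel hp0.ne', Real.rpow_one]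
  have hRMs : ∀ s, R ^ (s * p) = M ^ s := fun s => by
    rw [mul_comm, Real.rpow_mul hR.le, hRM]
  set q := n * w / M ^ r with hq
  have hq0 : 0 < q := by positivity
  have hrp : 0 < r * p := by positivity
  obtain ⟨J, hJ⟩ := exists_div_two_pow_rpow_le hR hrp hw
  have hmass : ∀ k ≤ J, ringMass μ x₀ R J k ≤ 2 ^ (r * p) * q * ((2 ^ k) ^ p) ^ r / n := by
    intro k hk
    refine (ringMass_le_of_tailFun_le μ x₀ hR hrp hwt hJ hk).trans (le_of_eq ?_)
    rw [hRMs, hq, ← Real.rpow_mul (by positivity), mul_comm p r]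
    field_simp
  set T₁ := ∑ k ∈ Finset.range (J + 1), (R / 2 ^ k) ^ p * ringMass μ x₀ R J k with hT₁
  -- The mean is bounded uniformly in `L`, so `L` may be as large as the finest-level term requires.
  obtain ⟨L, hL⟩ := pow_unbounded_of_one_lt (T₁ / (y / 4)) (by norm_num : (1 : ℝ) < 2)
  have hdisc := discrepancyBound_le_of_ringMass_le μ x₀ hp0 hβ hR
    (by positivity : 0 ≤ 2 ^ (r * p) * q) hr1 hr2 hn hmass L
  rw [← hC, hRM] at hdisc
  set g := (1 - (2 : ℝ) ^ (-(p * (2 - r))))⁻¹ with hg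
  have hp2r : 0 < p * (2 - r) := mul_pos hp0 (by linarith)
  have hg0 : 0 < g := one_sub_two_rpow_neg_pos hp2r
  have hr1' : 0 < r - 1 := by linarith
  have hcore := measure_wassersteinPow_gt_le (P := P) hp hβ hS hμ hX hn
    (m := r * p / (r * p - p) * w * R ^ (p - r * p)) (κ := 1)
    (σ2 := 4 * (2 ^ (r * p) * q * M ^ 2 / n * g))
    hx one_pos hR (by rw [hRM, hM, mul_one]) J L ?_ ?_ ?_ ?_ ?_ (by positivity) ?_
  · refine hcore.trans ?_
    rw [one_pow, Real.rpow_one, add_mul, one_mul]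
    refine add_le_add ?_ ?_
    · have h1 := hwt R hR
      rw [hRMs] at h1
      rw [hq, mul_div_assoc]
      refine mul_le_mul_of_nonneg_left ?_ hn'.le
      rw [le_div_iff₀ (by positivity)]; linarith
    · have e1 : Real.exp (1 ^ 2) * (16 * (4 * (2 ^ (r * p) * q * M ^ 2 / n * g)) /
          (n * (x / 16 ^ p) ^ 2)) ^ 1 = 1 / 4 * (Real.exp 1 * (2 ^ (r * p) * g) * q) := by
        rw [← hy, hyM, one_pow]; field_simp; norm_num
      have h2 : 0 ≤ Real.exp 1 * (2 ^ (r * p) * g) * q := by positivity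
      simp only [one_pow, pow_one] at e1 ⊢
      rw [e1]; linarith
  · have : 0 ≤ r * p - p := by nlinarith
    positivity
  · exact lintegral_lt_dist_le x₀ μ hp0 (by nlinarith) hR hw.le hwt
  · rw [← hy, hyM]
    have e1 : R ^ (p - r * p) = M / M ^ r := by
      rw [Real.rpow_sub hR, hRM, hRMs]
    have e2 : r * p / (r * p - p) = r / (r - 1) := by
      have : r * p - p = (r - 1) * p := by ring
      rw [this]; field_simp
    rw [e1, e2]
    have e3 : r / (r - 1) * w * (M / M ^ r) = r / (r - 1) * q * (M / n) := by
      rw [hq]; field_simp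
    have e4 : 16 * M / n / 4 = 4 * (M / n) := by ring
    rw [e3, e4]
    exact mul_le_mul_of_nonneg_right hA1 (by positivity)
  · rw [sum_ringWeight_mul_ringMass μ x₀ hR, ← hy, ← hT₁, div_le_iff₀ (by positivity)]
    have h1 : (2 : ℝ) ^ L ≤ (2 ^ L) ^ p :=
      Real.self_le_rpow_of_one_le (one_le_pow₀ (by norm_num)) hp
    rw [div_lt_iff₀ (by positivity)] at hL
    nlinarith
  · refine hdisc.trans ?_
    rw [← hy, hyM]
    have e4 : 16 * M / n / 4 = 4 * (M / n) := by ring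
    rw [e4]
    exact mul_le_mul_of_nonneg_right hA2 (by positivity)
  · rw [sum_ringWeight_sq_mul_ringMass μ x₀ hR]
    refine mul_le_mul_of_nonneg_left ?_ (by norm_num)
    calc ∑ k ∈ Finset.range (J + 1), (R / 2 ^ k) ^ (2 * p) * ringMass μ x₀ R J k
        ≤ ∑ k ∈ Finset.range (J + 1), 2 ^ (r * p) * q * M ^ 2 / n *
            ((2 : ℝ) ^ (-(p * (2 - r)))) ^ k := by
          refine Finset.sum_le_sum fun k hk => ?_
          have hkJ : k ≤ J := by have := Finset.mem_range.1 hk; omega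
          have hD0 : (0 : ℝ) < (2 ^ k) ^ p := by positivity
          have e1 : (R / 2 ^ k) ^ (2 * p) = M ^ 2 / ((2 ^ k) ^ p) ^ (2 : ℝ) := by
            rw [mul_comm, Real.rpow_mul (by positivity), Real.div_rpow hR.le (by positivity), hRM,
              Real.div_rpow hM0.le hD0.le, Real.rpow_two]
          have e2 : ((2 : ℝ) ^ (-(p * (2 - r)))) ^ k =
              (((2 : ℝ) ^ k) ^ p) ^ r / ((2 ^ k) ^ p) ^ (2 : ℝ) := by
            rw [← Real.rpow_sub hD0, two_pow_rpow_rpow]; ring_nf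
          rw [e1, e2]
          refine (mul_le_mul_of_nonneg_left (hmass k hkJ) (by positivity)).trans (le_of_eq ?_)
          field_simp
      _ ≤ _ := by
          rw [← Finset.mul_sum]
          exact mul_le_mul_of_nonneg_left (sum_two_rpow_neg_pow_le hp2r _) (by positivity)

theorem exists_const_of_weakMoment (p β r : ℝ) (hp : 1 ≤ p) (hβ : 0 < β) (hr1 : 1 < r)
    (hr2 : r < 2) : ∃ G : ℝ, 0 < G ∧
      ∀ (E : Type u) [MetricSpace E] [PolishSpace E] [MeasurableSpace E] [BorelSpace E]
        (x₀ : E) (S : Set E) (μ : Measure E) [IsProbabilityMeasure μ],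
        μ S = 1 → HasCoveringDim x₀ S (2 * p) β →
      ∀ (Ω : Type v) [MeasurableSpace Ω] (P : Measure Ω) [IsProbabilityMeasure P]
        (n : ℕ) (X : Fin n → Ω → E), 0 < n → IsIIDSample X P μ →
        weakMomentPow x₀ μ (r * p) < ∞ → ∀ x : ℝ, 0 < x →
            P.real {ω | ENNReal.ofReal x < wassersteinPow p μ (empiricalMeasure fun i => X i ω)} ≤
              G * ((weakMomentPow x₀ μ (r * p)).toReal / (x ^ r * (n : ℝ) ^ (r - 1))) := by
  have hp0 : 0 < p := by linarith
  have hr0 : 0 < r := by linarith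
  set C := 2 * √(β + 1) * (1 - 2 ^ (-(p * (1 / r - 1 / 2))))⁻¹ *
      (1 - 2 ^ (-(p * (1 / 2 - r / 4))))⁻¹ with hC
  have hC0 : 0 < C := by
    have h1 : 0 < p * (1 / r - 1 / 2) :=
      mul_pos hp0 (sub_pos.2 (one_div_lt_one_div_of_lt hr0 hr2))
    have h2 : 0 < p * (1 / 2 - r / 4) := mul_pos hp0 (by linarith)
    have h3 := one_sub_two_rpow_neg_pos h1
    have h4 := one_sub_two_rpow_neg_pos h2
    have h5 : 0 < √(β + 1) := Real.sqrt_pos.2 (by linarith)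
    positivity
  set η := 1 / 4 + 1 / (2 * r) with hη
  have hη0 : 0 < η := by positivity
  -- Threshold below which both quarter conditions hold. Above it the estimate is trivial, since `1
  -- ≤ q / q₀`.
  set q₀ := min (4 * (r - 1) / r) ((4 / C) ^ (1 / η) / 2 ^ (r * p)) with hq₀
  have hq₀0 : 0 < q₀ := lt_min (div_pos (by linarith) hr0) (by positivity)
  set G₁ := 1 + Real.exp 1 * (2 ^ (r * p) * (1 - (2 : ℝ) ^ (-(p * (2 - r))))⁻¹) with hG₁
  have hG₁0 : 0 < G₁ := by
    have := one_sub_two_rpow_neg_pos (mul_pos hp0 (by linarith : 0 < 2 - r))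
    positivity
  refine ⟨(G₁ + 1 / q₀) * (16 * 16 ^ p) ^ r, by positivity, ?_⟩
  intro E _ _ _ _ x₀ S μ _ hμ hS Ω _ P _ n X hn hX hwm x hx
  have hn' : (0 : ℝ) < n := by exact_mod_cast hn
  set w₀ := (weakMomentPow x₀ μ (r * p)).toReal with hw₀
  have hw₀0 : 0 ≤ w₀ := ENNReal.toReal_nonneg
  have hr1' : 0 < r - 1 := by linarith
  -- The weak moment may be `0`, so it is enlarged by `ε`, which is then sent to `0`.
  have hmain : ∀ ε : ℝ, 0 < ε →
      P.real {ω | ENNReal.ofReal x < wassersteinPow p μ (empiricalMeasure fun i => X i ω)} ≤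
        (G₁ + 1 / q₀) * (n * (w₀ + ε) / (n * (x / 16 ^ p) / 16) ^ r) := by
    intro ε hε
    set q := n * (w₀ + ε) / (n * (x / 16 ^ p) / 16) ^ r with hq
    have hq0 : 0 < q := by positivity
    by_cases hqq : q ≤ q₀
    · refine (measure_wassersteinPow_gt_le_of_tailFun_le hp hβ hS hμ hX hn hx hr1 hr2
        (by positivity : 0 < w₀ + ε) (fun t ht => ?_) hC ?_ ?_).trans ?_
      · exact (tailFun_le_of_weakMomentPow x₀ μ ht.le hwm).trans (by linarith)
      · rw [← hq]
        have h1 : q ≤ 4 * (r - 1) / r := hqq.trans (min_le_left _ _)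
        calc r / (r - 1) * q ≤ r / (r - 1) * (4 * (r - 1) / r) := by gcongr
          _ = 4 := by field_simp
      · rw [← hq, ← hη]
        have h1 : q ≤ (4 / C) ^ (1 / η) / 2 ^ (r * p) := hqq.trans (min_le_right _ _)
        rw [le_div_iff₀ (by positivity)] at h1
        have h2 : (2 ^ (r * p) * q) ^ η ≤ 4 / C := by
          calc (2 ^ (r * p) * q) ^ η ≤ ((4 / C) ^ (1 / η)) ^ η :=
                Real.rpow_le_rpow (by positivity) (by linarith) hη0.le
            _ = 4 / C := by
                rw [← Real.rpow_mul (by positivity), one_div_mul_cancel hη0.ne', Real.rpow_one]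
        calc C * (2 ^ (r * p) * q) ^ η ≤ C * (4 / C) := by gcongr
          _ = 4 := by field_simp
      · rw [← hq, ← hG₁]
        refine mul_le_mul_of_nonneg_right ?_ hq0.le
        have : 0 < 1 / q₀ := by positivity
        linarith
    · rw [not_le] at hqq
      have h1 : (1 : ℝ) ≤ 1 / q₀ * q := by
        rw [one_div_mul_eq_div, le_div_iff₀ hq₀0]; linarith
      have h2 : 0 < G₁ * q := by positivity
      refine (measureReal_le_one).trans ?_
      linarith
  have hcont : Continuous fun ε : ℝ =>
      (G₁ + 1 / q₀) * (n * (w₀ + ε) / (n * (x / 16 ^ p) / 16) ^ r) := by fun_prop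
  have hlim := (hcont.tendsto 0).mono_left (nhdsWithin_le_nhds (s := Set.Ioi 0))
  refine (ge_of_tendsto hlim (by
    filter_upwards [self_mem_nhdsWithin] with ε hε using hmain ε hε)).trans (le_of_eq ?_)
  have e1 : n * (x / 16 ^ p) / 16 = n * x / (16 * 16 ^ p) := by field_simp
  rw [add_zero, e1, Real.div_rpow (by positivity) (by positivity),
    Real.mul_rpow hn'.le hx.le, Real.rpow_sub_one hn'.ne']
  field_simp

theorem exists_radius {p κ y : ℝ} {n : ℕ} (hp : 0 < p) (hn : 0 < n) (hy : 0 < y) (hκ : 0 < κ) :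
    ∃ R : ℝ, 0 < R ∧ R ^ p = n * y / (16 * κ) := by
  have hn' : (0 : ℝ) < n := by exact_mod_cast hn
  refine ⟨(n * y / (16 * κ)) ^ (1 / p), by positivity, ?_⟩
  rw [← Real.rpow_mul (by positivity), one_div_mul_cancel hp.ne', Real.rpow_one]

end Main

theorem mainTheorem3 :
    ∃ (a : ℝ → ℝ) (c c' : ℝ → ℝ → ℝ) (K : ℝ → ℝ → ℝ → ℝ) (D : ℝ → ℝ → ℝ) (G : ℝ → ℝ → ℝ → ℝ),
      (∀ p, 0 < a p) ∧ (∀ p β, 0 < c p β) ∧ (∀ p β, 0 < c' p β) ∧ (∀ p q r, 0 < K p q r) ∧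
      (∀ p β, 0 < D p β) ∧ (∀ p β r, 0 < G p β r) ∧
      ∀ (p β : ℝ), 1 ≤ p → 0 < β →
      ∀ (E : Type u) [MetricSpace E] [PolishSpace E] [MeasurableSpace E] [BorelSpace E]
        (x₀ : E) (S : Set E) (μ : Measure E) [IsProbabilityMeasure μ],
        μ S = 1 → HasCoveringDim x₀ S (2 * p) β →
      ∀ (Ω : Type v) [MeasurableSpace Ω] (P : Measure Ω) [IsProbabilityMeasure P]
        (n : ℕ) (X : Fin n → Ω → E), 0 < n → IsIIDSample X P μ →
        (∀ r : ℝ, 2 < r → weakMomentPow x₀ μ (r * p) < ∞ →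
          sqrtTailIntegral x₀ μ p < ∞ ∧ distMomentPow x₀ μ p < ∞ ∧
          ∀ q : ℝ, r < q → ∀ x : ℝ, 0 < x →
            P.real {ω | ENNReal.ofReal x < wassersteinPow p μ (empiricalMeasure fun i => X i ω)} ≤
              criticalExpTerm n (c p β) (c' p β) (a p) (sqrtTailIntegral x₀ μ p).toReal
                  (distMomentPow x₀ μ p).toReal x +
                K p q r * ((sqrtTailIntegral x₀ μ p).toReal ^ q / (x ^ q * (n : ℝ) ^ (q / 2)) +
                  (weakMomentPow x₀ μ (r * p)).toReal / (x ^ r * (n : ℝ) ^ (r - 1)))) ∧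
        (sqrtTailIntegral x₀ μ p < ∞ →
          distMomentPow x₀ μ p < ∞ ∧
          ∀ x : ℝ, 0 < x →
            P.real {ω | ENNReal.ofReal x < wassersteinPow p μ (empiricalMeasure fun i => X i ω)} ≤
              criticalExpTerm n (c p β) (c' p β) (a p) (sqrtTailIntegral x₀ μ p).toReal
                  (distMomentPow x₀ μ p).toReal x +
                D p β * ((sqrtTailIntegral x₀ μ p).toReal ^ 2 / (x ^ 2 * (n : ℝ)))) ∧
        (∀ r : ℝ, 1 < r → r < 2 → weakMomentPow x₀ μ (r * p) < ∞ →
          ∀ x : ℝ, 0 < x →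
            P.real {ω | ENNReal.ofReal x < wassersteinPow p μ (empiricalMeasure fun i => X i ω)} ≤
              G p β r * ((weakMomentPow x₀ μ (r * p)).toReal / (x ^ r * (n : ℝ) ^ (r - 1)))) := by
  classical
  -- The constant must be a function on all of `ℝ³`; outside the admissible range it takes the
  -- default value `1`.
  have hG : ∀ p β r : ℝ, ∃ G : ℝ, 0 < G ∧ (1 ≤ p → 0 < β → 1 < r → r < 2 →
      ∀ (E : Type u) [MetricSpace E] [PolishSpace E] [MeasurableSpace E] [BorelSpace E]
        (x₀ : E) (S : Set E) (μ : Measure E) [IsProbabilityMeasure μ],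
        μ S = 1 → HasCoveringDim x₀ S (2 * p) β →
      ∀ (Ω : Type v) [MeasurableSpace Ω] (P : Measure Ω) [IsProbabilityMeasure P]
        (n : ℕ) (X : Fin n → Ω → E), 0 < n → IsIIDSample X P μ →
        weakMomentPow x₀ μ (r * p) < ∞ → ∀ x : ℝ, 0 < x →
            P.real {ω | ENNReal.ofReal x < wassersteinPow p μ (empiricalMeasure fun i => X i ω)} ≤
              G * ((weakMomentPow x₀ μ (r * p)).toReal / (x ^ r * (n : ℝ) ^ (r - 1)))) := by
    intro p β r
    by_cases h : 1 ≤ p ∧ 0 < β ∧ 1 < r ∧ r < 2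
    · obtain ⟨G, hG0, hG⟩ := exists_const_of_weakMoment p β r h.1 h.2.1 h.2.2.1 h.2.2.2
      exact ⟨G, hG0, fun _ _ _ _ => hG⟩
    · exact ⟨1, one_pos, fun h1 h2 h3 h4 => absurd ⟨h1, h2, h3, h4⟩ h⟩
  choose G hG0 hG using hG
  -- Absolute values keep the constants positive for all real arguments; on the admissible range
  -- they only enlarge the constants or leave them unchanged.
  refine ⟨fun p => 16 * 32 ^ p,
    fun p β => 1 / (256 * (16 ^ p) ^ 2 * (4 ^ p + 1) ^ 2 * (|β| + 1)),
    fun p _ => 4 * 16 ^ p * (2 ^ p * |p| + 1),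
    fun p q r => Real.exp ((q / 2) ^ 2) *
      (128 * (|q| / 2 + 1) * (4 ^ p * (2 * p ^ 2) + 1) * (16 ^ p) ^ 2) ^ (q / 2) +
      (16 * (|q| / 2 + 1) * 16 ^ p) ^ r,
    fun p _ => Real.exp 1 * (128 * (4 ^ p * (2 * p ^ 2) + 1) * (16 ^ p) ^ 2) +
      512 * p ^ 2 * (16 ^ p) ^ 2, G,
    fun p => by positivity, fun p β => by positivity, fun p β => by positivity,
    fun p q r => by positivity, fun p β => by positivity, hG0, ?_⟩
  intro p β hp hβ E _ _ _ _ x₀ S μ _ hμ hS Ω _ P _ n X hn hX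
  have hp0 : 0 < p := by linarith
  have hn' : (0 : ℝ) < n := by exact_mod_cast hn
  have hmom : sqrtTailIntegral x₀ μ p < ∞ → distMomentPow x₀ μ p < ∞ := fun hI =>
    lt_of_le_of_lt (distMomentPow_le x₀ μ hp0) (ENNReal.mul_lt_top ENNReal.ofReal_lt_top hI)
  refine ⟨fun r hr hw => ?_, fun hI => ⟨hmom hI, fun x hx => ?_⟩, fun r hr1 hr2 hw x hx =>
    hG p β r hp hβ hr1 hr2 E x₀ S μ hμ hS Ω P n X hn hX hw x hx⟩
  · have hI := sqrtTailIntegral_lt_top x₀ μ hp0 (by nlinarith : 2 * p < r * p) hw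
    refine ⟨hI, hmom hI, fun q hq x hx => ?_⟩
    have hq0 : 0 < q := by linarith
    -- The exponent `κ = q / 2` turns `(I² / (n x²)) ^ κ` into `I ^ q / (x ^ q n ^ (q / 2))`; it is
    -- at least `1` because `q > r > 2`.
    obtain ⟨R, hR, hRp⟩ := exists_radius hp0 hn (by positivity : 0 < x / 16 ^ p)
      (by positivity : 0 < q / 2)
    have h1 := measure_wassersteinPow_gt_le_critical hp hβ hS hμ hX hn hx
      (by linarith : 1 ≤ q / 2) hR hRp hI
    refine h1.trans (add_le_add le_rfl ?_)
    set I := (sqrtTailIntegral x₀ μ p).toReal with hI'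
    have hI0 : 0 ≤ I := ENNReal.toReal_nonneg
    set w := (weakMomentPow x₀ μ (r * p)).toReal with hw'
    have hw0 : 0 ≤ w := ENNReal.toReal_nonneg
    have hqa : q / 2 ≤ |q| / 2 + 1 := by have := le_abs_self q; linarith
    have hterm1 : n * tailFun x₀ μ R ≤
        (16 * (|q| / 2 + 1) * 16 ^ p) ^ r * (w / (x ^ r * (n : ℝ) ^ (r - 1))) := by
      have h2 := tailFun_le_of_weakMomentPow x₀ μ hR.le hw
      rw [mul_comm r p, Real.rpow_mul hR.le, hRp] at h2
      have e1 : n * (x / 16 ^ p) / (16 * (q / 2)) = n * x / (16 * (q / 2) * 16 ^ p) := by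
        field_simp
      rw [e1, Real.div_rpow (by positivity) (by positivity), div_mul_eq_mul_div,
        div_le_iff₀ (by positivity), Real.mul_rpow hn'.le hx.le] at h2
      rw [Real.rpow_sub_one hn'.ne', mul_div_assoc', le_div_iff₀ (by positivity)]
      have h3 : n * tailFun x₀ μ R * (x ^ r * ((n : ℝ) ^ r / n)) =
          (n : ℝ) ^ r * x ^ r * tailFun x₀ μ R := by field_simp
      rw [h3]
      rw [mul_comm p r, ← hw'] at h2
      refine h2.trans ?_
      rw [mul_comm w]
      gcongr
    have hterm2 : (128 * (q / 2) * (4 ^ p * (2 * p ^ 2) + 1) * (16 ^ p) ^ 2 *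
        (I ^ 2 / (n * x ^ 2))) ^ (q / 2) ≤
        (128 * (|q| / 2 + 1) * (4 ^ p * (2 * p ^ 2) + 1) * (16 ^ p) ^ 2) ^ (q / 2) *
          (I ^ q / (x ^ q * (n : ℝ) ^ (q / 2))) := by
      rw [Real.mul_rpow (by positivity) (by positivity)]
      have e2 : (I ^ 2 / (n * x ^ 2)) ^ (q / 2) = I ^ q / (x ^ q * (n : ℝ) ^ (q / 2)) := by
        have e3 : ∀ z : ℝ, 0 ≤ z → (z ^ 2) ^ (q / 2) = z ^ q := fun z hz => by
          rw [← Real.rpow_two, ← Real.rpow_mul hz]; ring_nf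
        rw [Real.div_rpow (by positivity) (by positivity), Real.mul_rpow hn'.le (by positivity),
          e3 I hI0, e3 x hx.le, mul_comm (x ^ q)]
      rw [e2]
      gcongr
    have hu : 0 ≤ I ^ q / (x ^ q * (n : ℝ) ^ (q / 2)) := by positivity
    have hv : 0 ≤ w / (x ^ r * (n : ℝ) ^ (r - 1)) := by positivity
    set u := I ^ q / (x ^ q * (n : ℝ) ^ (q / 2)) with hu'
    set v := w / (x ^ r * (n : ℝ) ^ (r - 1)) with hv'
    set k₁ := Real.exp ((q / 2) ^ 2) *
      (128 * (|q| / 2 + 1) * (4 ^ p * (2 * p ^ 2) + 1) * (16 ^ p) ^ 2) ^ (q / 2) with hk₁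
    set k₂ := (16 * (|q| / 2 + 1) * (16 : ℝ) ^ p) ^ r with hk₂
    have hk₁0 : 0 ≤ k₁ := by positivity
    have hk₂0 : 0 ≤ k₂ := by positivity
    have h3 := (mul_le_mul_of_nonneg_left hterm2 (Real.exp_pos ((q / 2) ^ 2)).le).trans
      (le_of_eq (mul_assoc _ _ u).symm)
    rw [← hk₁] at h3
    have h4 : 0 ≤ k₁ * v := by positivity
    have h5 : 0 ≤ k₂ * u := by positivity
    have h6 : (k₁ + k₂) * (u + v) = k₁ * u + k₂ * v + (k₁ * v + k₂ * u) := by ring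
    change _ ≤ (k₁ + k₂) * (u + v)
    rw [h6]; linarith
  -- Here `κ = 1`, and `n * H(R)` is bounded by squaring `R ^ p * √(H(R)) ≤ p * I`, which has the
  -- same form as the polynomial term.
  · obtain ⟨R, hR, hRp⟩ := exists_radius hp0 hn (by positivity : 0 < x / 16 ^ p) one_pos
    have h1 := measure_wassersteinPow_gt_le_critical hp hβ hS hμ hX hn hx le_rfl hR hRp hI
    refine h1.trans (add_le_add le_rfl ?_)
    have h2 := rpow_mul_sqrt_tailFun_le x₀ μ hp0 hR.le hI
    set I := (sqrtTailIntegral x₀ μ p).toReal with hI'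
    have hI0 : 0 ≤ I := ENNReal.toReal_nonneg
    have h3 : (R ^ p * √(tailFun x₀ μ R)) ^ 2 ≤ (p * I) ^ 2 :=
      pow_le_pow_left₀ (by positivity) h2 2
    rw [mul_pow, Real.sq_sqrt (tailFun_nonneg ..), hRp, mul_one] at h3
    have h4 : n * tailFun x₀ μ R ≤ 512 * p ^ 2 * (16 ^ p) ^ 2 * (I ^ 2 / (x ^ 2 * n)) := by
      rw [mul_div_assoc', le_div_iff₀ (by positivity)]
      have e1 : (n * (x / 16 ^ p) / 16) ^ 2 * tailFun x₀ μ R =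
          (n * tailFun x₀ μ R * (x ^ 2 * n)) / (256 * (16 ^ p) ^ 2) := by
        field_simp; ring
      rw [e1, div_le_iff₀ (by positivity)] at h3
      have : 0 ≤ p ^ 2 * (16 ^ p) ^ 2 * I ^ 2 := by positivity
      nlinarith
    rw [one_pow, Real.rpow_one, mul_one, mul_comm (n : ℝ) (x ^ 2), add_mul]
    refine (add_le_add h4 le_rfl).trans (le_of_eq ?_)
    ring
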